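/- Let $\alpha>0$. Let $\mathcal K(\alpha)$ be the class of all functions $\mathcal G(z)=P(e^{\alpha z})/Q(e^{\alpha z})$, where $P,Q$ are nonzero complex polynomials without common zeros such that $1\le\deg P<\deg Q$, $P(0)=0$, and $Q(x)\neq 0$ for all real $x\ge 0$. Let $\mathcal C(\alpha)$ be the class of all functions $\mathcal G(z)=e^{-\alpha z^2/2}P(e^{\alpha z})/Q(e^{\alpha z})$, where $P,Q$ are nonzero complex polynomials without common zeros and $Q(x)\neq 0$ for all real $x\ge 0$. In both cases put $q(\mathcal G)=\deg Q$; for $\mathcal G\in\mathcal K(\alpha)$ let $k(\mathcal G)$ be the greatest positive integer $k$ for which there is a constant $c\in\mathbb C$ with $\mathcal G(z+2\pi i/(k\alpha))=c\,\mathcal G(z)$ as meromorphic functions on $\mathbb C$ (such a greatest $k$ exists). A set $\Lambda\subset\mathbb R$ is separated if $\inf\{|\lambda-\lambda'|:\lambda,\lambda'\in\Lambda,\ \lambda\ne\lambda'\}>0$, and its lower uniform density is $$D^-(\Lambda)=\lim_{R\to\infty}\inf_{x\in\mathbb R}\frac{\#(\Lambda\cap[x-R,x+R])}{2R}.$$ Write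 $\hat{\mathcal G}(t)=\int_{\mathbb R}e^{-2\pi i xt}\mathcal G(x)\,dx$, and say that $\mathcal G$ satisfies (V) if for every $b\in[0,1)$ there is $n\in\mathbb Z$ with $\hat{\mathcal G}(n+b)\neq0$. The Gabor system $G(\mathcal G,\Lambda\times\mathbb Z)=\{e^{2\pi i n x}\mathcal G(x-\lambda):\lambda\in\Lambda,\ n\in\mathbb Z\}$ is a frame in $L^2(\mathbb R)$ if there are constants $0<A,B<\infty$ with $$A\|f\|_2^2\le\sum_{(\lambda,n)\in\Lambda\times\mathbb Z}\Bigl|\int_{\mathbb R}f(x)\,\overline{e^{2\pi i n x}\mathcal G(x-\lambda)}\,dx\Bigr|^2\le B\|f\|_2^2\qquad\text{for all } f\in L^2(\mathbb R).$$ Theorem. (i) Let $\alpha>0$ and let $\mathcal G\in\mathcal K(\alpha)$ satisfy (V). If $\Lambda\subset\mathbb R$ is separated and $D^-(\Lambda)>q(\mathcal G)/k(\mathcal G)$, then $G(\mathcal G,\Lambda\times\mathbb Z)$ is a frame in $L^2(\mathbb R)$. (ii) For every $\alpha>0$ there exist $\mathcal G\in\mathcal K(\alpha)$ satisfying (V)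 and a separated set $\Lambda$ with $D^-(\Lambda)=q(\mathcal G)/k(\mathcal G)$ such that $G(\mathcal G,\Lambda\times\mathbb Z)$ is not a frame in $L^2(\mathbb R)$. (iii) Let $\alpha>0$ and let $\mathcal G\in\mathcal C(\alpha)$ satisfy (V). If $\Lambda\subset\mathbb R$ is separated and $D^-(\Lambda)>q(\mathcal G)+1$, then $G(\mathcal G,\Lambda\times\mathbb Z)$ is a frame in $L^2(\mathbb R)$. (iv) For every $\alpha>0$ there exist $\mathcal G\in\mathcal C(\alpha)$ satisfying (V) and a separated set $\Lambda$ with $D^-(\Lambda)=q(\mathcal G)+1$ such that $G(\mathcal G,\Lambda\times\mathbb Z)$ is not a frame in $L^2(\mathbb R)$. -/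

import Mathlib

open MeasureTheory Filter Topology Polynomial
open scoped FourierTransform ComplexConjugate

namespace GaborRational

/-- A set of real numbers is separated if distinct points have distance bounded below. -/
def IsSeparatedSet (Λ : Set ℝ) : Prop :=
  ∃ δ : ℝ, 0 < δ ∧ ∀ x ∈ Λ, ∀ y ∈ Λ, x ≠ y → δ ≤ |x - y|

/-- `HasLowerDensity Λ D` says that the lower uniform (Beurling) density
`lim_{R → ∞} inf_x #(Λ ∩ [x - R, x + R]) / (2R)` exists and equals `D`. For a separated set the
counts are finite (so `ncard` is the true cardinality) and the limit always exists. -/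
def HasLowerDensity (Λ : Set ℝ) (D : ℝ) : Prop :=
  Tendsto (fun R : ℝ => ⨅ x : ℝ, ((Λ ∩ Set.Icc (x - R) (x + R)).ncard : ℝ) / (2 * R))
    atTop (𝓝 D)

/-- The time-frequency shift `M_ξ T_s g`, that is `x ↦ exp(2πiξx) g(x - s)`. -/
noncomputable def timeFreqShift (s ξ : ℝ) (g : ℝ → ℂ) (x : ℝ) : ℂ :=
  Complex.exp (2 * Real.pi * Complex.I * ξ * x) * g (x - s)

/-- The inner product `⟨f, M_ξ T_s g⟩`, linear in `f`. -/
noncomputable def gaborCoeff (g : ℝ → ℂ) (f : Lp ℂ 2 (volume : Measure ℝ)) (s ξ : ℝ) : ℂ :=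
  ∫ x : ℝ, f x * conj (timeFreqShift s ξ g x)

/-- The Gabor system `{M_ξ T_s g : (s, ξ) ∈ Λ × Ψ}` is a frame in `L²(ℝ)`. -/
def IsGaborFrame (g : ℝ → ℂ) (Λ Ψ : Set ℝ) : Prop :=
  ∃ A B : ℝ, 0 < A ∧ 0 < B ∧ ∀ f : Lp ℂ 2 (volume : Measure ℝ),
    Summable (fun p : Λ × Ψ => ‖gaborCoeff g f p.1 p.2‖ ^ 2) ∧
    A * ‖f‖ ^ 2 ≤ ∑' p : Λ × Ψ, ‖gaborCoeff g f p.1 p.2‖ ^ 2 ∧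
    ∑' p : Λ × Ψ, ‖gaborCoeff g f p.1 p.2‖ ^ 2 ≤ B * ‖f‖ ^ 2

/-- The integers as a subset of `ℝ`. -/
def intSet : Set ℝ := Set.range ((↑) : ℤ → ℝ)

/-- The Fourier transform `ĝ(t) = ∫ exp(-2πixt) g(x) dx` does not vanish (identically) on any of
the sets `ℤ + b`, `0 ≤ b < 1`. -/
def FourierNonvanishing (g : ℝ → ℂ) : Prop :=
  ∀ b : ℝ, 0 ≤ b → b < 1 → ∃ n : ℤ, 𝓕 g (n + b) ≠ 0

/-- The class `K(α)`: generators `P(exp(αz)) / Q(exp(αz))`, recorded by the polynomials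
`P` and `Q` (which the generator determines up to a common constant factor). -/
structure ClassK (α : ℝ) where
  P : ℂ[X]
  Q : ℂ[X]
  P_ne_zero : P ≠ 0
  Q_ne_zero : Q ≠ 0
  no_common_zero : ∀ z : ℂ, ¬ (P.eval z = 0 ∧ Q.eval z = 0)
  one_le_deg : 1 ≤ P.natDegree
  deg_lt : P.natDegree < Q.natDegree
  P_zero : P.eval 0 = 0
  Q_nonneg : ∀ x : ℝ, 0 ≤ x → Q.eval (x : ℂ) ≠ 0

namespace ClassK

variable {α : ℝ}

/-- The generator as a (meromorphic) function on `ℂ`. -/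
noncomputable def toComplexFun (G : ClassK α) (z : ℂ) : ℂ :=
  G.P.eval (Complex.exp (α * z)) / G.Q.eval (Complex.exp (α * z))

/-- The generator on the real line. -/
noncomputable def toFun (G : ClassK α) (x : ℝ) : ℂ := G.toComplexFun (x : ℂ)

/-- `q(G) = deg Q`. -/
noncomputable def q (G : ClassK α) : ℕ := G.Q.natDegree

/-- `z` is not a pole of the generator. -/
def Regular (G : ClassK α) (z : ℂ) : Prop := G.Q.eval (Complex.exp (α * z)) ≠ 0

/-- The positive integers `k` for which `G(z + 2πi/(kα)) = c G(z)` holds, for some constant `c`,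
as an identity of meromorphic functions on `ℂ` (that is, wherever both sides are defined). -/
def symmetryOrders (G : ClassK α) : Set ℕ :=
  {k | 0 < k ∧ ∃ c : ℂ, ∀ z : ℂ,
    G.Regular z → G.Regular (z + 2 * Real.pi * Complex.I / (k * α)) →
      G.toComplexFun (z + 2 * Real.pi * Complex.I / (k * α)) = c * G.toComplexFun z}

/-- `k(G)`: the greatest of the `symmetryOrders`; see `isGreatest_k`. -/
noncomputable def k (G : ClassK α) : ℕ := sSup G.symmetryOrders

theorem le_q_of_mem (hα : 0 < α) (G : ClassK α) {k : ℕ} (hk : k ∈ G.symmetryOrders) :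
    k ≤ G.q := by
  obtain ⟨hk0, c, hc⟩ := hk
  have hαc : (α : ℂ) ≠ 0 := by exact_mod_cast hα.ne'
  have hkc : (k : ℂ) ≠ 0 := by exact_mod_cast hk0.ne'
  set ζ : ℂ := Complex.exp (2 * Real.pi * Complex.I / k) with hζ
  have hprim : IsPrimitiveRoot ζ k := Complex.isPrimitiveRoot_exp k hk0.ne'
  have hζ0 : ζ ≠ 0 := Complex.exp_ne_zero _
  have hshift : ∀ z : ℂ, Complex.exp (α * (z + 2 * Real.pi * Complex.I / (k * α)))
      = ζ * Complex.exp (α * z) := by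
    intro z
    rw [hζ, ← Complex.exp_add]
    congr 1
    field_simp
    ring
  set P' := G.P.comp (C ζ * X) with hP'
  set Q' := G.Q.comp (C ζ * X) with hQ'
  have hQ'0 : Q' ≠ 0 := by
    intro h
    have := congrArg (Polynomial.eval 0) h
    have h2 := G.Q_nonneg 0 le_rfl
    simp [hQ'] at this h2
    exact h2 this
  have hP'0 : P' ≠ 0 := by
    intro h
    apply G.P_ne_zero
    apply Polynomial.funext
    intro r
    have := congrArg (Polynomial.eval (ζ⁻¹ * r)) h
    simpa [hP', hζ0] using this
  have key : (P' * G.Q - C c * G.P * Q') * (G.Q * Q' * X) = 0 := by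
    apply Polynomial.funext
    intro u
    by_cases hu : u = 0
    · simp [hu]
    by_cases h1 : G.Q.eval u = 0
    · simp [h1]
    by_cases h2 : G.Q.eval (ζ * u) = 0
    · simp [hQ', h2]
    have hz : Complex.exp (α * (Complex.log u / α)) = u := by
      rw [mul_div_cancel₀ _ hαc, Complex.exp_log hu]
    have := hc (Complex.log u / α) (by simpa [Regular, hz] using h1)
      (by unfold Regular; rw [hshift, hz]; exact h2)
    simp only [toComplexFun] at this
    rw [hshift, hz] at this
    field_simp at this
    simp [hP', hQ', this]
    exact Or.inl (by ring)
  have hne : G.Q * Q' * X ≠ 0 := mul_ne_zero (mul_ne_zero G.Q_ne_zero hQ'0) X_ne_zero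
  have hid : P' * G.Q = C c * G.P * Q' :=
    sub_eq_zero.mp ((mul_eq_zero.mp key).resolve_right hne)
  have hc0 : c ≠ 0 := by
    rintro rfl
    simp [hP'0, G.Q_ne_zero] at hid
  have hroot : ∀ w : ℂ, G.Q.eval w = 0 → G.Q.eval (ζ * w) = 0 := by
    intro w hw
    have := congrArg (Polynomial.eval w) hid
    simp [hQ', hw, hc0] at this
    exact this.resolve_left fun h => G.no_common_zero w ⟨h, hw⟩
  have hdeg : 0 < G.Q.natDegree := lt_of_le_of_lt (Nat.zero_le _) G.deg_lt
  obtain ⟨w, hw⟩ := Complex.exists_root (Polynomial.natDegree_pos_iff_degree_pos.mp hdeg)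
  have hw0 : w ≠ 0 := by
    rintro rfl
    exact G.Q_nonneg 0 le_rfl (by simpa using hw)
  have hpow : ∀ j : ℕ, G.Q.eval (ζ ^ j * w) = 0 := by
    intro j
    induction j with
    | zero => simpa using hw
    | succ j ih => rw [pow_succ', mul_assoc]; exact hroot _ ih
  calc k = ((Finset.range k).image fun j => ζ ^ j * w).card := by
        rw [Finset.card_image_of_injOn, Finset.card_range]
        intro a ha b hb hab
        simp only [Finset.coe_range, Set.mem_Iio] at ha hb
        exact hprim.pow_inj ha hb (mul_right_cancel₀ hw0 hab)
    _ ≤ G.Q.roots.toFinset.card := by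
        apply Finset.card_le_card
        intro x hx
        obtain ⟨j, -, rfl⟩ := Finset.mem_image.mp hx
        simpa [G.Q_ne_zero] using hpow j
    _ ≤ G.Q.natDegree := (Multiset.toFinset_card_le _).trans (Polynomial.card_roots' _)

theorem one_mem_symmetryOrders (hα : 0 < α) (G : ClassK α) : 1 ∈ G.symmetryOrders := by
  have hαc : (α : ℂ) ≠ 0 := by exact_mod_cast hα.ne'
  refine ⟨one_pos, 1, fun z _ _ => ?_⟩
  have : Complex.exp (α * (z + 2 * Real.pi * Complex.I / ((1 : ℕ) * α)))
      = Complex.exp (α * z) := by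
    rw [← Complex.exp_periodic (α * z)]
    congr 1
    field_simp
    simp
  simp only [toComplexFun, this, one_mul]

/-- For `α > 0` the number `k(G)` is the maximum of the set that defines it. -/
theorem isGreatest_k (hα : 0 < α) (G : ClassK α) : IsGreatest G.symmetryOrders G.k := by
  have hb : BddAbove G.symmetryOrders := ⟨G.q, fun _ hk => le_q_of_mem hα G hk⟩
  exact ⟨Nat.sSup_mem ⟨1, one_mem_symmetryOrders hα G⟩ hb, fun _ hk => le_csSup hb hk⟩

end ClassK

/-- The class `C(α)`: generators `exp(-αz²/2) P(exp(αz)) / Q(exp(αz))`, recorded by the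
polynomials `P` and `Q`. -/
structure ClassC (α : ℝ) where
  P : ℂ[X]
  Q : ℂ[X]
  P_ne_zero : P ≠ 0
  Q_ne_zero : Q ≠ 0
  no_common_zero : ∀ z : ℂ, ¬ (P.eval z = 0 ∧ Q.eval z = 0)
  Q_nonneg : ∀ x : ℝ, 0 ≤ x → Q.eval (x : ℂ) ≠ 0

namespace ClassC

variable {α : ℝ}

/-- The generator on the real line. -/
noncomputable def toFun (G : ClassC α) (x : ℝ) : ℂ :=
  Complex.exp (-(α * x ^ 2 / 2)) *
    (G.P.eval (Complex.exp (α * x)) / G.Q.eval (Complex.exp (α * x)))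

/-- `q(G) = deg Q`. -/
noncomputable def q (G : ClassC α) : ℕ := G.Q.natDegree

end ClassC

end GaborRational

namespace GaborRational

/-! ### Exponential sums over the integers and periodization -/

/-! Fibres. The modulations run over ℤ, so for fixed λ the Gabor coefficients of f are the Fourier
coefficients of the 1-periodization of f · conj g(· - λ). Parseval turns the frame inequality into a
sampling inequality on fibres: with F(t) = ∑ c_k g(t + k), the values F(x - λ), λ ∈ Λ, must control
the ℓ² norm of c uniformly in x (`isGaborFrame_of_sampling`).

Sufficiency, compactness. `isGaborFrame_of_uniqueness` reduces stable sampling to a uniqueness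
statement. If the sampling constants degenerated, normalized integer translates of bad examples
would converge to a series F with coefficients of linear growth that has N zeros in every block of
length L, where N / L exceeds the critical density. Condition (V) says that for no b does the Zak
transform vanish identically in x. Hence finitely many sample sequences control the ℓ² norm
(`exists_stable_samples`), and this keeps the limit nonzero.

Sufficiency, uniqueness. `tsum_ratTerm_eq_zero` is a zero count of Jensen type in strips |Re z| ≤ R.
The series, multiplied by exp(αz²/2) in the class `ClassC`, is meromorphic with period 2πi/α.
Clearing its poles costs a growth of about exp(qαR²/2) on the boundary, and the Gaussian factor
costs a further exp(αR²/2). A real zero recurs κ times per period, with κ = k for `ClassK` and κ = 1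
for `ClassC`, so zeros of density d gain a factor of about exp(-κα d R²/2)
(`norm_le_of_zeros_in_strip`). The gain wins exactly when d exceeds q/k, respectively q + 1, and R →
∞ forces F = 0.

Sharpness. The Zak transform of an even generator vanishes at (1/2, 1/2), so ℤ × ℤ gives no frame
(`not_isGaborFrame_of_even`). The hyperbolic secant has q = k = 2 and the Gaussian has q = 0, so the
critical density is 1, the density of ℤ, in both cases. Their Fourier transforms have no zeros. -/

theorem summable_one_add_abs_mul_exp {a : ℝ} (ha : 0 < a) :
    Summable fun k : ℤ => (1 + |(k : ℝ)|) * Real.exp (-a * |(k : ℝ)|) := by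
  have h : Summable fun n : ℕ => (1 + (n : ℝ)) * Real.exp (-a * n) := by
    have h1 := Real.summable_pow_mul_exp_neg_nat_mul 0 ha
    have h2 := Real.summable_pow_mul_exp_neg_nat_mul 1 ha
    refine (h1.add h2).congr fun n => ?_
    ring_nf
  apply Summable.of_nat_of_neg
  · simpa using h
  · simpa using h

theorem summable_exp_neg_abs {a : ℝ} (ha : 0 < a) :
    Summable fun k : ℤ => Real.exp (-a * |(k : ℝ)|) := by
  refine Summable.of_nonneg_of_le (fun _ => (Real.exp_pos _).le) (fun k => ?_)
    (summable_one_add_abs_mul_exp ha)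
  have := Real.exp_pos (-a * |(k : ℝ)|)
  nlinarith [abs_nonneg (k : ℝ)]

theorem lintegral_eq_lintegral_tsum_add_int {h : ℝ → ENNReal} (hh : Measurable h) :
    ∫⁻ x, h x = ∫⁻ x in Set.Ioc (0 : ℝ) 1, ∑' k : ℤ, h (x + k) := by
  rw [lintegral_tsum (f := fun (k : ℤ) (x : ℝ) => h (x + k))
    (fun k => (hh.comp (measurable_add_const _)).aemeasurable)]
  rw [← setLIntegral_univ, ← iUnion_Ioc_intCast ℝ,
    lintegral_iUnion (fun _ => measurableSet_Ioc) (Set.pairwise_disjoint_Ioc_intCast ℝ)]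
  congr 1
  ext k
  rw [← (measurePreserving_add_right volume (k : ℝ)).setLIntegral_comp_preimage
    measurableSet_Ioc hh]
  simp

theorem ae_summable_add_int {f : ℝ → ℂ} (hf : Measurable f) (hfi : Integrable f) :
    (∀ᵐ x ∂(volume.restrict (Set.Ioc (0 : ℝ) 1)), Summable fun k : ℤ => f (x + k)) ∧
    ∫ x, f x = ∫ x in Set.Ioc (0 : ℝ) 1, ∑' k : ℤ, f (x + k) := by
  have hm : ∀ k : ℤ, Measurable fun x : ℝ => f (x + k) := fun k =>
    hf.comp (measurable_add_const _)
  have hI : ∀ k : ℤ, Integrable (fun x : ℝ => f (x + k))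
      (volume.restrict (Set.Ioc (0 : ℝ) 1)) := fun k =>
    (hfi.comp_add_right (k : ℝ)).integrableOn
  have hL : ∫⁻ x in Set.Ioc (0 : ℝ) 1, ∑' k : ℤ, ‖f (x + k)‖ₑ < ⊤ := by
    rw [← lintegral_eq_lintegral_tsum_add_int hf.enorm]
    exact hfi.2
  constructor
  · have := ae_lt_top (Measurable.tsum fun k => (hm k).enorm) hL.ne
    filter_upwards [this] with x hx
    apply Summable.of_norm
    have h2 : Summable fun k : ℤ => (‖f (x + k)‖₊ : ℝ) := by
      rw [NNReal.summable_coe]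
      exact ENNReal.tsum_coe_ne_top_iff_summable.mp hx.ne
    simpa using h2
  · rw [integral_tsum (fun k => (hm k).aestronglyMeasurable)]
    · rw [← setIntegral_univ, ← iUnion_Ioc_intCast ℝ,
        integral_iUnion (fun _ => measurableSet_Ioc) (Set.pairwise_disjoint_Ioc_intCast ℝ)
          hfi.integrableOn]
      congr 1
      ext k
      rw [← (measurePreserving_add_right volume (k : ℝ)).setIntegral_preimage_emb
        (measurableEmbedding_addRight _)]
      simp
    · rw [← lintegral_tsum (fun k => (hm k).enorm.aemeasurable)]
      exact hL.ne

/-- Cauchy–Schwarz for sums in `[0, ∞]`. -/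
theorem ennreal_sq_tsum_mul_le {ι : Type*} (a g : ι → ENNReal) :
    (∑' k, a k * g k) ^ 2 ≤ (∑' k, g k) * ∑' k, a k ^ 2 * g k := by
  have hxy : ∀ x y : ENNReal, x * y ≤ (x ^ 2 + y ^ 2) / 2 := by
    intro x y
    rw [ENNReal.le_div_iff_mul_le (by simp) (by simp)]
    rcases eq_or_ne x ⊤ with rfl | hx
    · simp
    rcases eq_or_ne y ⊤ with rfl | hy
    · simp
    lift x to NNReal using hx
    lift y to NNReal using hy
    norm_cast
    have := two_mul_le_add_sq (x : ℝ) y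
    rw [← NNReal.coe_le_coe]
    push_cast
    linarith
  -- Both sides become double sums with the symmetric weight g k * g l, and the inequality follows
  -- termwise from a k * a l ≤ (a k ^ 2 + a l ^ 2) / 2.
  have h1 : (∑' k, a k * g k) ^ 2 = ∑' k, ∑' l, (a k * a l) * (g k * g l) := by
    rw [sq, ← ENNReal.tsum_mul_right]
    congr 1; ext k
    rw [← ENNReal.tsum_mul_left]
    congr 1; ext l; ring
  have h2 : ∑' k, ∑' l, (a k ^ 2) * (g k * g l) = (∑' k, g k) * ∑' k, a k ^ 2 * g k := by
    rw [mul_comm, ← ENNReal.tsum_mul_right]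
    congr 1; ext k
    rw [← ENNReal.tsum_mul_left]
    congr 1; ext l; ring
  have h3 : ∑' k, ∑' l, (a l ^ 2) * (g k * g l) = (∑' k, g k) * ∑' k, a k ^ 2 * g k := by
    rw [ENNReal.tsum_comm, ← h2]
    congr 1; ext k; congr 1; ext l; ring
  rw [h1]
  calc ∑' k, ∑' l, (a k * a l) * (g k * g l)
      ≤ ∑' k, ∑' l, ((a k ^ 2) * (g k * g l) / 2 + (a l ^ 2) * (g k * g l) / 2) := by
        gcongr with k l
        calc (a k * a l) * (g k * g l) ≤ ((a k ^ 2 + a l ^ 2) / 2) * (g k * g l) := by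
              gcongr; exact hxy _ _
          _ = _ := by rw [div_eq_mul_inv, div_eq_mul_inv, div_eq_mul_inv]; ring
    _ = (∑' k, g k) * ∑' k, a k ^ 2 * g k := by
        simp_rw [ENNReal.tsum_add, div_eq_mul_inv, ENNReal.tsum_mul_right]
        rw [h2, h3, ← div_eq_mul_inv, ENNReal.add_halves]

/-- Cauchy–Schwarz for the splitting |a g| = (|a| |g|^{1/2}) |g|^{1/2}. One factor |g| stays with
|a|², which is the form needed for Schur tests. -/
theorem enorm_tsum_mul_sq_le {ι : Type*} (a g : ι → ℂ) :
    ‖∑' k, a k * g k‖ₑ ^ 2 ≤ (∑' k, ‖g k‖ₑ) * ∑' k, ‖a k‖ₑ ^ 2 * ‖g k‖ₑ := by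
  refine le_trans ?_ (ennreal_sq_tsum_mul_le _ _)
  gcongr
  refine enorm_tsum_le_tsum_enorm.trans ?_
  simp

/-- A continuous function with exponential decay. -/
def ExpDecay (g : ℝ → ℂ) : Prop :=
  Continuous g ∧ ∃ C a : ℝ, 0 < C ∧ 0 < a ∧ ∀ x, ‖g x‖ ≤ C * Real.exp (-a * |x|)

theorem exp_neg_abs_add_le {a : ℝ} (ha : 0 < a) {t r : ℝ} (ht : |t| ≤ r) (s : ℝ) :
    Real.exp (-a * |t + s|) ≤ Real.exp (a * r) * Real.exp (-a * |s|) := by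
  rw [← Real.exp_add]
  apply Real.exp_le_exp.mpr
  have h1 : |s| ≤ |t + s| + |t| := by
    calc |s| = |(t + s) - t| := by ring_nf
      _ ≤ _ := abs_sub _ _
  nlinarith

namespace ExpDecay

variable {g : ℝ → ℂ}

/-- A locally uniform summable majorant for the integer translates. -/
theorem exists_bound (hg : ExpDecay g) (r : ℝ) :
    ∃ u : ℤ → ℝ, (Summable fun k : ℤ => (1 + |(k : ℝ)|) * u k) ∧ Summable u ∧ (∀ k, 0 ≤ u k) ∧
      ∀ t : ℝ, |t| ≤ r → ∀ k : ℤ, ‖g (t + k)‖ ≤ u k := by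
  obtain ⟨-, C, a, hC, ha, h⟩ := hg
  refine ⟨fun k => C * (Real.exp (a * r) * Real.exp (-a * |(k : ℝ)|)), ?_, ?_, ?_, ?_⟩
  · refine ((summable_one_add_abs_mul_exp ha).mul_left (C * Real.exp (a * r))).congr fun k => ?_
    ring
  · exact ((summable_exp_neg_abs ha).mul_left _).mul_left _
  · intro k; positivity
  · intro t ht k
    exact (h _).trans (mul_le_mul_of_nonneg_left (exp_neg_abs_add_le ha ht _) hC.le)

/-- The sums of the integer translates are uniformly bounded. -/
theorem exists_tsum_le (hg : ExpDecay g) :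
    ∃ S : NNReal, 0 < S ∧ ∀ t : ℝ, ∑' k : ℤ, ‖g (t + k)‖ₑ ≤ S := by
  obtain ⟨u, -, hu, hu0, hb⟩ := hg.exists_bound 1
  refine ⟨(∑' k, u k).toNNReal + 1, by positivity, fun t => ?_⟩
  have h1 : ∑' k : ℤ, ‖g (t + k)‖ₑ = ∑' k : ℤ, ‖g (Int.fract t + k)‖ₑ := by
    rw [← (Equiv.addRight (⌊t⌋)).tsum_eq (fun k : ℤ => ‖g (Int.fract t + k)‖ₑ)]
    congr 1; ext k
    simp only [Equiv.coe_addRight, Int.cast_add]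
    congr 2
    rw [Int.fract]; ring
  rw [h1]
  calc ∑' k : ℤ, ‖g (Int.fract t + k)‖ₑ ≤ ∑' k : ℤ, ENNReal.ofReal (u k) := by
        gcongr with k
        rw [← ofReal_norm]
        apply ENNReal.ofReal_le_ofReal
        apply hb
        rw [abs_of_nonneg (Int.fract_nonneg t)]
        exact (Int.fract_lt_one t).le
    _ = ENNReal.ofReal (∑' k, u k) := (ENNReal.ofReal_tsum_of_nonneg hu0 hu).symm
    _ ≤ _ := by
        rw [ENNReal.ofReal]
        exact_mod_cast le_self_add

theorem integrable (hg : ExpDecay g) : Integrable g := by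
  obtain ⟨S, -, hS⟩ := hg.exists_tsum_le
  refine ⟨hg.1.aestronglyMeasurable, ?_⟩
  rw [HasFiniteIntegral, lintegral_eq_lintegral_tsum_add_int hg.1.measurable.enorm]
  calc _ ≤ ∫⁻ x in Set.Ioc (0 : ℝ) 1, (S : ENNReal) := lintegral_mono fun x => hS x
    _ < ⊤ := by simp

theorem bounded (hg : ExpDecay g) : ∃ B : ℝ, 0 < B ∧ ∀ x, ‖g x‖ ≤ B := by
  obtain ⟨-, C, a, hC, ha, h⟩ := hg
  refine ⟨C, hC, fun x => (h x).trans ?_⟩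
  have : Real.exp (-a * |x|) ≤ 1 := Real.exp_le_one_iff.mpr (by nlinarith [abs_nonneg x])
  nlinarith

end ExpDecay

/-- Sums of an exponentially decaying function over a separated set are uniformly bounded. -/
theorem IsSeparatedSet.exists_tsum_le {Λ : Set ℝ} (hΛ : IsSeparatedSet Λ) {g : ℝ → ℂ}
    (hg : ExpDecay g) :
    ∃ S : NNReal, 0 < S ∧ ∀ t : ℝ, ∑' l : Λ, ‖g (t - l)‖ₑ ≤ S := by
  obtain ⟨δ, hδ, hsep⟩ := hΛ
  obtain ⟨-, C, a, hC, ha, h⟩ := hg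
  have hs := ((summable_exp_neg_abs (mul_pos ha hδ)).mul_left (C * Real.exp (a * δ)))
  refine ⟨(∑' k : ℤ, C * Real.exp (a * δ) * Real.exp (-(a * δ) * |(k : ℝ)|)).toNNReal + 1,
    by positivity, fun t => ?_⟩
  -- Each cell of length δ contains at most one point, so the sum over Λ is dominated by a sum over
  -- ℤ.
  have hinj : Function.Injective fun l : Λ => ⌊(t - l) / δ⌋ := by
    intro l l' hl
    by_contra hne
    have h1 := hsep l l.2 l' l'.2 (fun h => hne (Subtype.ext h))
    have h2 := Int.abs_sub_lt_one_of_floor_eq_floor hl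
    rw [← sub_div, abs_div, abs_of_pos hδ, div_lt_one hδ] at h2
    rw [show t - (l : ℝ) - (t - l') = -(l - l') by ring, abs_neg] at h2
    linarith
  calc ∑' l : Λ, ‖g (t - l)‖ₑ
      ≤ ∑' l : Λ, ENNReal.ofReal (C * Real.exp (a * δ) *
          Real.exp (-(a * δ) * |((⌊(t - l) / δ⌋ : ℤ) : ℝ)|)) := by
        gcongr with l
        rw [← ofReal_norm]
        apply ENNReal.ofReal_le_ofReal
        refine (h _).trans ?_
        rw [mul_assoc, ← Real.exp_add]
        gcongr
        set y := (t - (l : ℝ)) / δ with hy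
        have hy' : t - (l : ℝ) = δ * y := by rw [hy]; field_simp
        rw [hy', abs_mul, abs_of_pos hδ]
        have : |((⌊y⌋ : ℤ) : ℝ)| ≤ |y| + 1 := by
          have h3 := Int.fract_nonneg y
          have h4 := (Int.fract_lt_one y).le
          have h5 : ((⌊y⌋ : ℤ) : ℝ) = y - Int.fract y := by rw [Int.fract]; ring
          rw [h5]
          refine (abs_sub _ _).trans ?_
          rw [abs_of_nonneg h3]; linarith
        nlinarith [mul_pos ha hδ]
    _ ≤ ∑' k : ℤ, ENNReal.ofReal (C * Real.exp (a * δ) * Real.exp (-(a * δ) * |(k : ℝ)|)) :=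
        ENNReal.tsum_comp_le_tsum_of_injective hinj
          (fun k : ℤ => ENNReal.ofReal (C * Real.exp (a * δ) * Real.exp (-(a * δ) * |(k : ℝ)|)))
    _ = ENNReal.ofReal (∑' k : ℤ, C * Real.exp (a * δ) * Real.exp (-(a * δ) * |(k : ℝ)|)) :=
        (ENNReal.ofReal_tsum_of_nonneg (fun k => by positivity) hs).symm
    _ ≤ _ := by
        rw [ENNReal.ofReal]
        exact_mod_cast le_self_add

theorem IsSeparatedSet.countable {Λ : Set ℝ} (hΛ : IsSeparatedSet Λ) : Λ.Countable := by
  obtain ⟨δ, hδ, hsep⟩ := hΛ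
  have hinj : Set.InjOn (fun l : ℝ => ⌊l / δ⌋) Λ := by
    intro l hl l' hl' h
    by_contra hne
    have h1 := hsep l hl l' hl' hne
    have h2 := Int.abs_sub_lt_one_of_floor_eq_floor h
    rw [← sub_div, abs_div, abs_of_pos hδ, div_lt_one hδ] at h2
    linarith
  exact Set.countable_of_injective_of_countable_image hinj (Set.to_countable _)


/-! ### Fiberization of Gabor systems over the integers -/

theorem ofReal_norm_sq (z : ℂ) : ENNReal.ofReal (‖z‖ ^ 2) = ‖z‖ₑ ^ 2 := by
  rw [ENNReal.ofReal_pow (norm_nonneg _), ofReal_norm]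

theorem memLp_two_iff_lintegral {μ : Measure ℝ} {f : ℝ → ℂ} (hf : AEStronglyMeasurable f μ) :
    MemLp f 2 μ ↔ ∫⁻ x, ‖f x‖ₑ ^ 2 ∂μ < ⊤ := by
  rw [MemLp, eLpNorm_lt_top_iff_lintegral_rpow_enorm_lt_top (by simp) (by simp)]
  simp [hf]

theorem tsum_enorm_sq_fourierCoeffOn {f : ℝ → ℂ}
    (hf : MemLp f 2 (volume.restrict (Set.Ioc (0 : ℝ) 1))) :
    ∑' n : ℤ, ‖∫ x in Set.Ioc (0 : ℝ) 1, Complex.exp (-(2 * Real.pi * Complex.I * n * x)) * f x‖ₑ ^ 2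
      = ∫⁻ x in Set.Ioc (0 : ℝ) 1, ‖f x‖ₑ ^ 2 := by
  have h := hasSum_sq_fourierCoeffOn zero_lt_one hf
  have hc : ∀ n : ℤ, fourierCoeffOn zero_lt_one f n =
      ∫ x in Set.Ioc (0 : ℝ) 1, Complex.exp (-(2 * Real.pi * Complex.I * n * x)) * f x := by
    intro n
    rw [fourierCoeffOn_eq_integral, intervalIntegral.integral_of_le zero_le_one]
    simp only [sub_zero, div_one, one_smul]
    congr 1
    ext x
    rw [smul_eq_mul, fourier_coe_apply]
    congr 2
    push_cast
    ring
  simp_rw [hc] at h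
  have hint : Integrable (fun x => ‖f x‖ ^ 2) (volume.restrict (Set.Ioc (0 : ℝ) 1)) :=
    (memLp_two_iff_integrable_sq_norm hf.1).mp hf
  calc _ = ∑' n : ℤ, ENNReal.ofReal (‖∫ x in Set.Ioc (0 : ℝ) 1,
        Complex.exp (-(2 * Real.pi * Complex.I * n * x)) * f x‖ ^ 2) := by
        simp_rw [ofReal_norm_sq]
    _ = ENNReal.ofReal (∫ x in Set.Ioc (0 : ℝ) 1, ‖f x‖ ^ 2) := by
        rw [← ENNReal.ofReal_tsum_of_nonneg (fun _ => by positivity) h.summable, h.tsum_eq,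
          intervalIntegral.integral_of_le zero_le_one]
        simp
    _ = ∫⁻ x in Set.Ioc (0 : ℝ) 1, ENNReal.ofReal (‖f x‖ ^ 2) :=
        ofReal_integral_eq_lintegral_ofReal hint (ae_of_all _ fun x => by positivity)
    _ = _ := by simp_rw [ofReal_norm_sq]

namespace ExpDecay

variable {g : ℝ → ℂ}

theorem memLp_two (hg : ExpDecay g) : MemLp g 2 volume := by
  obtain ⟨B, -, hB⟩ := hg.bounded
  rw [memLp_two_iff_integrable_sq_norm hg.1.aestronglyMeasurable]
  simp_rw [sq]
  exact hg.integrable.norm.bdd_mul hg.1.norm.aestronglyMeasurable (c := B)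
    (ae_of_all _ fun x => by simpa using hB x)

theorem tsum_enorm_sq_mul_le (hg : ExpDecay g) : ∃ S : NNReal, 0 < S ∧ ∀ (c : ℤ → ℂ) (t : ℝ),
    ‖∑' k : ℤ, c k * g (t + k)‖ₑ ^ 2 ≤ S * ∑' k : ℤ, ‖c k‖ₑ ^ 2 := by
  obtain ⟨S, hS0, hS⟩ := hg.exists_tsum_le
  refine ⟨S * S, by positivity, fun c t => ?_⟩
  refine (enorm_tsum_mul_sq_le _ _).trans ?_
  rw [ENNReal.coe_mul, mul_assoc]
  gcongr
  · exact hS t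
  rw [← ENNReal.tsum_mul_left]
  refine ENNReal.tsum_le_tsum fun k => ?_
  rw [mul_comm]
  gcongr
  exact (ENNReal.le_tsum k).trans (hS t)

end ExpDecay

theorem ExpDecay.conj {g : ℝ → ℂ} (hg : ExpDecay g) : ExpDecay fun x => conj (g x) := by
  obtain ⟨hc, C, a, hC, ha, h⟩ := hg
  exact ⟨Complex.continuous_conj.comp hc, C, a, hC, ha, fun x => by simpa using h x⟩

/-- The coefficients are the Fourier coefficients of the periodization of f · conj g(· - s);
Parseval on (0, 1] gives the identity. -/
theorem tsum_enorm_sq_coeff {g : ℝ → ℂ} (hg : ExpDecay g) {f : ℝ → ℂ} (hfm : Measurable f)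
    (hf : MemLp f 2 volume) (s : ℝ) :
    ∑' n : ℤ, ‖∫ x, f x * conj (timeFreqShift s n g x)‖ₑ ^ 2 =
      ∫⁻ x in Set.Ioc (0 : ℝ) 1, ‖∑' k : ℤ, f (x + k) * conj (g (x - s + k))‖ₑ ^ 2 := by
  set φ : ℝ → ℂ := fun x => f x * conj (g (x - s)) with hφ
  have hgm : Measurable fun x => conj (g (x - s)) :=
    (hg.conj.1.measurable).comp (measurable_sub_const s)
  have hφm : Measurable φ := hfm.mul hgm
  have hg2 : MemLp (fun x => conj (g (x - s))) 2 volume :=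
    hg.conj.memLp_two.comp_measurePreserving (measurePreserving_sub_right volume s)
  have hφi : Integrable φ := hf.integrable_mul hg2
  have hper : ∀ x : ℝ, ∑' k : ℤ, f (x + k) * conj (g (x - s + k)) = ∑' k : ℤ, φ (x + k) := by
    intro x
    congr 1; ext k
    simp only [hφ]
    congr 3; ring
  simp_rw [hper]
  have hΦm : Measurable fun x : ℝ => ∑' k : ℤ, φ (x + k) :=
    Measurable.tsum fun k => hφm.comp (measurable_add_const _)
  have hL2 : MemLp (fun x : ℝ => ∑' k : ℤ, φ (x + k)) 2
      (volume.restrict (Set.Ioc (0 : ℝ) 1)) := by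
    rw [memLp_two_iff_lintegral hΦm.aestronglyMeasurable]
    obtain ⟨S, -, hS⟩ := hg.conj.tsum_enorm_sq_mul_le
    calc ∫⁻ x in Set.Ioc (0 : ℝ) 1, ‖∑' k : ℤ, φ (x + k)‖ₑ ^ 2
        ≤ ∫⁻ x in Set.Ioc (0 : ℝ) 1, S * ∑' k : ℤ, ‖f (x + k)‖ₑ ^ 2 := by
          apply lintegral_mono
          intro x
          simp only [← hper]
          exact hS (fun k => f (x + k)) (x - s)
      _ = S * ∫⁻ x, ‖f x‖ₑ ^ 2 := by
          rw [lintegral_const_mul, lintegral_eq_lintegral_tsum_add_int (hfm.enorm.pow_const 2)]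
          exact Measurable.tsum fun k => (hfm.comp (measurable_add_const _)).enorm.pow_const 2
      _ < ⊤ := ENNReal.mul_lt_top (by simp) ((memLp_two_iff_lintegral hf.1).mp hf)
  rw [← tsum_enorm_sq_fourierCoeffOn hL2]
  congr 1; ext n
  have he : Continuous fun x : ℝ => Complex.exp (-(2 * Real.pi * Complex.I * n * x)) := by
    fun_prop
  have hn : ∀ x : ℝ, ‖Complex.exp (-(2 * Real.pi * Complex.I * n * x))‖ = 1 := by
    intro x
    rw [show -(2 * Real.pi * Complex.I * n * x) = ((-(2 * Real.pi * n * x) : ℝ) : ℂ) * Complex.I by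
      push_cast; ring]
    exact Complex.norm_exp_ofReal_mul_I _
  have h1 := (ae_summable_add_int (f := fun x : ℝ => Complex.exp (-(2 * Real.pi * Complex.I * n * x)) * φ x)
    (he.measurable.mul hφm) (hφi.bdd_mul (c := 1) he.aestronglyMeasurable
      (ae_of_all _ fun x => (hn x).le))).2
  have h2 : ∫ x, f x * conj (timeFreqShift s n g x) =
      ∫ x : ℝ, Complex.exp (-(2 * Real.pi * Complex.I * n * x)) * φ x := by
    congr 1; ext x
    simp only [timeFreqShift, map_mul, hφ, ← Complex.exp_conj, Complex.conj_ofReal, Complex.conj_I]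
    rw [show (starRingEnd ℂ) 2 = 2 from Complex.conj_ofNat 2]
    push_cast
    ring_nf
  rw [h2, h1]
  congr 3; ext x
  rw [← tsum_mul_left]
  congr 1; ext k
  congr 1
  -- An integer frequency makes the exponential 1-periodic, so it factors out of the periodization.
  rw [show -(2 * Real.pi * Complex.I * n * ((x + k : ℝ) : ℂ)) =
    -(2 * Real.pi * Complex.I * n * x) + ((-(n * k) : ℤ) : ℂ) * (2 * Real.pi * Complex.I) by
    push_cast; ring, Complex.exp_add, Complex.exp_int_mul_two_pi_mul_I, mul_one]

/-- The sum of the squared Gabor coefficients as an integral over fibers. -/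
theorem tsum_enorm_sq_gaborCoeff {g : ℝ → ℂ} (hg : ExpDecay g) {Λ : Set ℝ} (hΛ : Λ.Countable)
    {f : Lp ℂ 2 (volume : Measure ℝ)} {f₀ : ℝ → ℂ} (hfm : Measurable f₀) (hf₀ : f =ᵐ[volume] f₀) :
    ∑' p : Λ × intSet, ‖gaborCoeff g f p.1 p.2‖ₑ ^ 2 =
      ∫⁻ x in Set.Ioc (0 : ℝ) 1, ∑' l : Λ,
        ‖∑' k : ℤ, f₀ (x + k) * conj (g (x - l + k))‖ₑ ^ 2 := by
  have := hΛ.to_subtype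
  have hL : MemLp f₀ 2 volume := (memLp_congr_ae hf₀).mp (Lp.memLp f)
  have hco : ∀ s ξ : ℝ, gaborCoeff g f s ξ = ∫ x, f₀ x * conj (timeFreqShift s ξ g x) := by
    intro s ξ
    apply integral_congr_ae
    filter_upwards [hf₀] with x hx
    rw [hx]
  rw [ENNReal.tsum_prod (f := fun (l : Λ) (n : intSet) => ‖gaborCoeff g f l n‖ₑ ^ 2), lintegral_tsum]
  · congr 1; ext l
    rw [← tsum_enorm_sq_coeff hg hfm hL l]
    let e : ℤ ≃ intSet := Equiv.ofInjective ((↑) : ℤ → ℝ) Int.cast_injective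
    rw [← e.tsum_eq (fun b : intSet => ‖gaborCoeff g f l b‖ₑ ^ 2)]
    congr 1; ext n
    rw [hco]
    rfl
  · intro l
    refine Measurable.aemeasurable ?_
    refine Measurable.pow_const (Measurable.enorm (Measurable.tsum fun k => ?_)) 2
    exact (hfm.comp (measurable_add_const _)).mul (hg.conj.1.measurable.comp (by fun_prop))

theorem enorm_sq_lp {f : Lp ℂ 2 (volume : Measure ℝ)} {f₀ : ℝ → ℂ} (hf₀ : f =ᵐ[volume] f₀) :
    ENNReal.ofReal (‖f‖ ^ 2) = ∫⁻ x, ‖f₀ x‖ₑ ^ 2 := by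
  rw [ENNReal.ofReal_pow (norm_nonneg _), Lp.norm_def, ENNReal.ofReal_toReal (Lp.eLpNorm_ne_top f),
    eLpNorm_congr_ae hf₀, eLpNorm_eq_lintegral_rpow_enorm_toReal (by simp) (by simp),
    ← ENNReal.rpow_natCast, ← ENNReal.rpow_mul]
  simp

/-- The sampled values `∑ c_k g(t + k)`. -/
noncomputable def shiftSum (g : ℝ → ℂ) (c : ℤ → ℂ) (t : ℝ) : ℂ := ∑' k : ℤ, c k * g (t + k)

theorem tsum_norm_sq_eq_toReal {ι : Type*} (u : ι → ℂ) :
    ∑' i, ‖u i‖ ^ 2 = (∑' i, ‖u i‖ₑ ^ 2).toReal := by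
  rw [ENNReal.tsum_toReal_eq]
  · simp
  · intro i; simp

theorem summable_norm_sq_iff {ι : Type*} (u : ι → ℂ) :
    (Summable fun i => ‖u i‖ ^ 2) ↔ ∑' i, ‖u i‖ₑ ^ 2 ≠ ⊤ := by
  have h : ∀ i, ‖u i‖ₑ ^ 2 = ((‖u i‖₊ ^ 2 : NNReal) : ENNReal) := fun i => by
    rw [ENNReal.coe_pow]; rfl
  simp_rw [h]
  rw [ENNReal.tsum_coe_ne_top_iff_summable, ← NNReal.summable_coe]
  simp

/-- Schur test: the sums of |g| over ℤ-translates and over Λ-translates are both uniformly bounded.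
-/
theorem IsSeparatedSet.bessel {Λ : Set ℝ} (hΛ : IsSeparatedSet Λ) {g : ℝ → ℂ} (hg : ExpDecay g) :
    ∃ B : NNReal, 0 < B ∧ ∀ (x : ℝ) (c : ℤ → ℂ),
      ∑' l : Λ, ‖shiftSum g c (x - l)‖ₑ ^ 2 ≤ B * ∑' k : ℤ, ‖c k‖ₑ ^ 2 := by
  obtain ⟨S, hS0, hS⟩ := hg.exists_tsum_le
  obtain ⟨T, hT0, hT⟩ := hΛ.exists_tsum_le hg
  refine ⟨S * T, by positivity, fun x c => ?_⟩
  calc ∑' l : Λ, ‖shiftSum g c (x - l)‖ₑ ^ 2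
      ≤ ∑' l : Λ, S * ∑' k : ℤ, ‖c k‖ₑ ^ 2 * ‖g (x - l + k)‖ₑ := by
        gcongr with l
        refine (enorm_tsum_mul_sq_le _ _).trans ?_
        gcongr
        exact hS _
    _ = S * ∑' k : ℤ, ‖c k‖ₑ ^ 2 * ∑' l : Λ, ‖g ((x + k) - l)‖ₑ := by
        rw [ENNReal.tsum_mul_left, ENNReal.tsum_comm]
        congr 2; ext k
        rw [← ENNReal.tsum_mul_left]
        congr 1; ext l
        congr 3; ring
    _ ≤ S * ∑' k : ℤ, ‖c k‖ₑ ^ 2 * T := by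
        gcongr with k
        exact hT _
    _ = _ := by rw [ENNReal.tsum_mul_right, ENNReal.coe_mul]; ring

theorem conj_tsum_mul_conj (g : ℝ → ℂ) (c : ℤ → ℂ) (t : ℝ) :
    ‖∑' k : ℤ, c k * conj (g (t + k))‖ₑ = ‖shiftSum g (fun k => conj (c k)) t‖ₑ := by
  rw [shiftSum, ← ofReal_norm, ← ofReal_norm, ← RCLike.norm_conj, Complex.conj_tsum]
  simp

/-- Stable sampling for the shift-invariant space at all translates of `Λ` gives a Gabor frame. -/
theorem isGaborFrame_of_sampling {Λ : Set ℝ} (hΛ : IsSeparatedSet Λ) {g : ℝ → ℂ}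
    (hg : ExpDecay g) {A : NNReal} (hA : 0 < A)
    (h : ∀ (x : ℝ) (c : ℤ → ℂ), ∑' k : ℤ, ‖c k‖ₑ ^ 2 ≠ ⊤ →
      A * ∑' k : ℤ, ‖c k‖ₑ ^ 2 ≤ ∑' l : Λ, ‖shiftSum g c (x - l)‖ₑ ^ 2) :
    IsGaborFrame g Λ intSet := by
  obtain ⟨B, hB0, hB⟩ := hΛ.bessel hg
  refine ⟨A, B, by exact_mod_cast hA, by exact_mod_cast hB0, fun f => ?_⟩
  obtain ⟨f₀, hfm, hf₀⟩ := (Lp.aestronglyMeasurable f).aemeasurable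
  have hS := tsum_enorm_sq_gaborCoeff hg hΛ.countable hfm hf₀
  have hN := enorm_sq_lp hf₀
  simp_rw [conj_tsum_mul_conj g (fun k : ℤ => f₀ (_ + k))] at hS
  have hm2 : Measurable fun x => ‖f₀ x‖ₑ ^ 2 := hfm.enorm.pow_const 2
  have hm3 : Measurable fun x : ℝ => ∑' k : ℤ, ‖f₀ (x + k)‖ₑ ^ 2 :=
    Measurable.tsum fun k => hm2.comp (measurable_add_const _)
  rw [lintegral_eq_lintegral_tsum_add_int hm2] at hN
  have hlo : A * ENNReal.ofReal (‖f‖ ^ 2) ≤ ∑' p : Λ × intSet, ‖gaborCoeff g f p.1 p.2‖ₑ ^ 2 := by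
    rw [hS, hN, ← lintegral_const_mul _ hm3]
    -- The sampling hypothesis applies to square-summable c only, and almost every fibre of an L²
    -- function is one.
    have hfin : ∀ᵐ x ∂(volume.restrict (Set.Ioc (0 : ℝ) 1)),
        ∑' k : ℤ, ‖f₀ (x + k)‖ₑ ^ 2 < ⊤ :=
      ae_lt_top hm3 (by rw [← hN]; exact ENNReal.ofReal_ne_top)
    apply lintegral_mono_ae
    filter_upwards [hfin] with x hx
    have := h x (fun k => conj (f₀ (x + k))) (by simpa using hx.ne)
    simpa using this
  have hhi : ∑' p : Λ × intSet, ‖gaborCoeff g f p.1 p.2‖ₑ ^ 2 ≤ B * ENNReal.ofReal (‖f‖ ^ 2) := by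
    rw [hS, hN, ← lintegral_const_mul _ hm3]
    apply lintegral_mono
    intro x
    have := hB x (fun k => conj (f₀ (x + k)))
    simpa using this
  have hfin : ∑' p : Λ × intSet, ‖gaborCoeff g f p.1 p.2‖ₑ ^ 2 ≠ ⊤ :=
    (hhi.trans_lt (ENNReal.mul_lt_top (by simp) (by simp))).ne
  refine ⟨(summable_norm_sq_iff _).mpr hfin, ?_, ?_⟩
  · rw [tsum_norm_sq_eq_toReal]
    have := ENNReal.toReal_mono hfin hlo
    rwa [ENNReal.toReal_mul, ENNReal.toReal_ofReal (by positivity)] at this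
  · rw [tsum_norm_sq_eq_toReal]
    have := ENNReal.toReal_mono (ENNReal.mul_ne_top (by simp) (by simp)) hhi
    rwa [ENNReal.toReal_mul, ENNReal.toReal_ofReal (by positivity)] at this


/-! ### Stability of the integer shifts -/

/-- The Zak transform `∑ g(x + m) exp(-2πimb)` as a continuous function of `b`. -/
noncomputable def zak (g : ℝ → ℂ) (x : ℝ) : C(UnitAddCircle, ℂ) :=
  ∑' m : ℤ, g (x + m) • fourier (-m)

theorem ExpDecay.summable_norm {g : ℝ → ℂ} (hg : ExpDecay g) (x : ℝ) :
    Summable fun m : ℤ => ‖g (x + m)‖ := by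
  obtain ⟨u, -, hu, -, h⟩ := hg.exists_bound |x|
  exact Summable.of_nonneg_of_le (fun _ => norm_nonneg _) (fun k => h x le_rfl k) hu

theorem zak_hasSum {g : ℝ → ℂ} (hg : ExpDecay g) (x : ℝ) :
    HasSum (fun m : ℤ => g (x + m) • (fourier (-m) : C(UnitAddCircle, ℂ))) (zak g x) := by
  apply Summable.hasSum
  apply Summable.of_norm
  simp_rw [norm_smul, fourier_norm, mul_one]
  exact hg.summable_norm x

theorem zak_apply {g : ℝ → ℂ} (hg : ExpDecay g) (x : ℝ) (b : UnitAddCircle) :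
    HasSum (fun m : ℤ => g (x + m) * fourier (-m) b) (zak g x b) := by
  simpa using ((ContinuousMap.evalCLM ℂ b).hasSum (zak_hasSum hg x))

/-- For fixed b, the numbers 𝓕 g (n + b) are the Fourier coefficients of x ↦ exp(-2πixb) Z(x, b).
Thus (V) excludes that Z(·, b) vanishes identically. -/
theorem fourier_eq_integral_zak {g : ℝ → ℂ} (hg : ExpDecay g) (n : ℤ) (b : ℝ) :
    𝓕 g (n + b) = ∫ x in Set.Ioc (0 : ℝ) 1,
      Complex.exp (-(2 * Real.pi * Complex.I * x * (n + b))) * zak g x (b : UnitAddCircle) := by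
  have he : Continuous fun x : ℝ => Complex.exp (-(2 * Real.pi * Complex.I * x * (n + b))) := by
    fun_prop
  have hn : ∀ x : ℝ, ‖Complex.exp (-(2 * Real.pi * Complex.I * x * (n + b)))‖ = 1 := by
    intro x
    rw [show -(2 * Real.pi * Complex.I * x * (n + b)) =
      ((-(2 * Real.pi * x * (n + b)) : ℝ) : ℂ) * Complex.I by push_cast; ring]
    exact Complex.norm_exp_ofReal_mul_I _
  have h1 := (ae_summable_add_int
    (f := fun x : ℝ => Complex.exp (-(2 * Real.pi * Complex.I * x * (n + b))) * g x)
    (he.measurable.mul hg.1.measurable)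
    (hg.integrable.bdd_mul (c := 1) he.aestronglyMeasurable (ae_of_all _ fun x => (hn x).le))).2
  rw [Real.fourier_eq']
  have h2 : ∫ v : ℝ, Complex.exp ((-2 * Real.pi * inner ℝ v ((n : ℝ) + b) : ℝ) * Complex.I) • g v =
      ∫ x : ℝ, Complex.exp (-(2 * Real.pi * Complex.I * x * (n + b))) * g x := by
    congr 1; ext x
    rw [smul_eq_mul]
    congr 2
    simp only [inner, RCLike.re_to_real, star_trivial]
    push_cast; ring
  rw [h2, h1]
  congr 1; ext x
  rw [← (zak_apply hg x b).tsum_eq, ← tsum_mul_left]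
  congr 1; ext k
  rw [fourier_coe_apply, mul_comm (g _), ← mul_assoc, ← Complex.exp_add]
  congr 1
  rw [show -(2 * Real.pi * Complex.I * ((x + k : ℝ) : ℂ) * (n + b)) =
    (-(2 * Real.pi * Complex.I * x * (n + b)) + 2 * Real.pi * Complex.I * ((-k : ℤ) : ℂ) * b / ((1 : ℝ) : ℂ)) +
     ((-(n * k) : ℤ) : ℂ) * (2 * Real.pi * Complex.I) by
    push_cast; ring, Complex.exp_add _ (_ * (2 * Real.pi * Complex.I)),
    Complex.exp_int_mul_two_pi_mul_I, mul_one]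

theorem exists_zak_ne_zero {g : ℝ → ℂ} (hg : ExpDecay g) (hV : FourierNonvanishing g)
    (b : UnitAddCircle) : ∃ x : ℝ, zak g x b ≠ 0 := by
  by_contra! h
  obtain ⟨b', hb', rfl⟩ : ∃ b' : ℝ, b' ∈ Set.Ico (0 : ℝ) 1 ∧ (b' : UnitAddCircle) = b := by
    refine ⟨AddCircle.equivIco 1 0 b, ?_, AddCircle.coe_equivIco⟩
    simpa using (AddCircle.equivIco 1 0 b).2
  obtain ⟨n, hn⟩ := hV b' hb'.1 hb'.2
  apply hn
  rw [fourier_eq_integral_zak hg]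
  simp [h]

/-- The open sets where Z(x, ·) is nonzero cover the compact circle. A finite subcover gives X, and
a continuous positive function on the circle has a positive minimum. -/
theorem exists_zak_lower {g : ℝ → ℂ} (hg : ExpDecay g) (hV : FourierNonvanishing g) :
    ∃ (X : Finset ℝ) (A : ℝ), 0 < A ∧ ∀ b : UnitAddCircle, A ≤ ∑ x ∈ X, ‖zak g x b‖ ^ 2 := by
  obtain ⟨X, hX⟩ := isCompact_univ.elim_finite_subcover
    (fun x : ℝ => {b : UnitAddCircle | zak g x b ≠ 0})
    (fun x => isOpen_ne_fun (zak g x).continuous continuous_const)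
    (fun b _ => by
      obtain ⟨x, hx⟩ := exists_zak_ne_zero hg hV b
      exact Set.mem_iUnion.mpr ⟨x, hx⟩)
  have hcont : Continuous fun b : UnitAddCircle => ∑ x ∈ X, ‖zak g x b‖ ^ 2 := by fun_prop
  obtain ⟨b₀, -, hb₀⟩ := isCompact_univ.exists_isMinOn Set.univ_nonempty hcont.continuousOn
  refine ⟨X, _, ?_, fun b => hb₀ (Set.mem_univ b)⟩
  obtain ⟨x, hx⟩ := Set.mem_iUnion.mp (hX (Set.mem_univ b₀))
  obtain ⟨hxX, hx⟩ := Set.mem_iUnion.mp hx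
  refine lt_of_lt_of_le ?_ (Finset.single_le_sum (fun _ _ => by positivity) hxX)
  have : 0 < ‖zak g x b₀‖ := norm_pos_iff.mpr hx
  positivity

theorem exists_lp_fourierCoeff {c : ℤ → ℂ} (hc : ∑' k : ℤ, ‖c k‖ₑ ^ 2 ≠ ⊤) :
    ∃ F : Lp ℂ 2 (AddCircle.haarAddCircle : Measure UnitAddCircle), ∀ n, fourierCoeff F n = c n := by
  have hmem : Memℓp c 2 := by
    apply memℓp_gen
    have := (summable_norm_sq_iff c).mpr hc
    simpa using this
  refine ⟨fourierBasis.repr.symm ⟨c, hmem⟩, fun n => ?_⟩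
  rw [← fourierBasis_repr, LinearIsometryEquiv.apply_symm_apply]

theorem tsum_enorm_sq_fourierCoeff {h : UnitAddCircle → ℂ}
    (hh : MemLp h 2 (AddCircle.haarAddCircle : Measure UnitAddCircle)) :
    ∑' n : ℤ, ‖fourierCoeff h n‖ₑ ^ 2 = ∫⁻ b, ‖h b‖ₑ ^ 2 ∂AddCircle.haarAddCircle := by
  have h1 := hasSum_sq_fourierCoeff hh.toLp
  have h2 : ∀ n, fourierCoeff hh.toLp n = fourierCoeff h n := fun n =>
    congrFun (fourierCoeff_congr_ae hh.coeFn_toLp) n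
  simp_rw [h2] at h1
  have h3 : ∫ t : UnitAddCircle, ‖(hh.toLp h) t‖ ^ 2 ∂AddCircle.haarAddCircle =
      ∫ t, ‖h t‖ ^ 2 ∂AddCircle.haarAddCircle := by
    apply integral_congr_ae
    filter_upwards [hh.coeFn_toLp] with t ht
    rw [ht]
  have hint : Integrable (fun x => ‖h x‖ ^ 2) AddCircle.haarAddCircle :=
    (memLp_two_iff_integrable_sq_norm hh.1).mp hh
  calc _ = ∑' n : ℤ, ENNReal.ofReal (‖fourierCoeff h n‖ ^ 2) := by simp_rw [ofReal_norm_sq]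
    _ = ENNReal.ofReal (∫ x, ‖h x‖ ^ 2 ∂AddCircle.haarAddCircle) := by
        rw [← ENNReal.ofReal_tsum_of_nonneg (fun _ => by positivity) h1.summable, h1.tsum_eq, h3]
    _ = ∫⁻ x, ENNReal.ofReal (‖h x‖ ^ 2) ∂AddCircle.haarAddCircle :=
        ofReal_integral_eq_lintegral_ofReal hint (ae_of_all _ fun x => by positivity)
    _ = _ := by simp_rw [ofReal_norm_sq]

/-- Multiplication by Z(x, ·) on the circle is convolution of Fourier coefficients with the samples
of g on x + ℤ. Parseval can therefore compare the sample sequences with c. -/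
theorem fourierCoeff_zak_mul {g : ℝ → ℂ} (hg : ExpDecay g) {c : ℤ → ℂ}
    (F : Lp ℂ 2 (AddCircle.haarAddCircle : Measure UnitAddCircle))
    (hF : ∀ n, fourierCoeff F n = c n) (x : ℝ) (n : ℤ) :
    fourierCoeff (fun b => zak g x b * F b) n = shiftSum g c (x - n) := by
  have hFi : Integrable F AddCircle.haarAddCircle :=
    (Lp.memLp F).integrable one_le_two
  have hI : ∀ m : ℤ, Integrable (fun b : UnitAddCircle => (fourier (-(n + m)) b) * F b)
      AddCircle.haarAddCircle := fun m =>
    hFi.bdd_mul (c := 1) (fourier (-(n + m))).continuous.aestronglyMeasurable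
      (ae_of_all _ fun b => by
        exact ((fourier (-(n + m))).norm_coe_le_norm b).trans (fourier_norm _).le)
  have hnorm : ∀ (m : ℤ) (b : UnitAddCircle), ‖fourier m b‖ = 1 := fun m b => by
    rw [fourier_apply]; exact Circle.norm_coe _
  have h1 := hasSum_integral_of_summable_integral_norm
    (F := fun (m : ℤ) (b : UnitAddCircle) => g (x + m) * ((fourier (-(n + m)) b) * F b))
    (μ := AddCircle.haarAddCircle) (fun m => (hI m).const_mul _) (by
      simp_rw [norm_mul, hnorm, one_mul]
      simp_rw [integral_const_mul]
      exact (hg.summable_norm x).mul_right _)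
  have h2 : fourierCoeff (fun b => zak g x b * F b) n =
      ∫ b : UnitAddCircle, ∑' m : ℤ, g (x + m) * ((fourier (-(n + m)) b) * F b)
        ∂AddCircle.haarAddCircle := by
    rw [fourierCoeff]
    congr 1; ext b
    rw [← (zak_apply hg x b).tsum_eq, smul_eq_mul, ← tsum_mul_right, ← tsum_mul_left]
    congr 1; ext m
    rw [neg_add, fourier_add]
    ring
  rw [h2, ← h1.tsum_eq, shiftSum, ← (Equiv.addLeft n).tsum_eq (fun k : ℤ => c k * g (x - n + k))]
  congr 1; ext m
  rw [integral_const_mul, mul_comm]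
  simp only [Equiv.coe_addLeft]
  rw [← hF (n + m), fourierCoeff]
  simp only [smul_eq_mul]
  congr 2
  push_cast; ring

/-- Stability of the integer shifts: the `ℓ²` norm of the coefficients is controlled by finitely
many sample sequences. -/
theorem exists_stable_samples {g : ℝ → ℂ} (hg : ExpDecay g) (hV : FourierNonvanishing g) :
    ∃ (X : Finset ℝ) (A : NNReal), 0 < A ∧ ∀ c : ℤ → ℂ, ∑' k : ℤ, ‖c k‖ₑ ^ 2 ≠ ⊤ →
      A * ∑' k : ℤ, ‖c k‖ₑ ^ 2 ≤ ∑' n : ℤ, ∑ x ∈ X, ‖shiftSum g c (x - n)‖ₑ ^ 2 := by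
  obtain ⟨X, A, hA, hX⟩ := exists_zak_lower hg hV
  refine ⟨X, A.toNNReal, by simpa using hA, fun c hc => ?_⟩
  obtain ⟨F, hF⟩ := exists_lp_fourierCoeff hc
  have hmem : ∀ x : ℝ, MemLp (fun b => zak g x b * F b) 2 AddCircle.haarAddCircle := by
    intro x
    have : MemLp (fun b => F b * zak g x b) 2 AddCircle.haarAddCircle := by
      refine MemLp.of_le_mul (c := ‖zak g x‖) (Lp.memLp F)
        ((Lp.memLp F).1.mul (zak g x).continuous.aestronglyMeasurable) (ae_of_all _ fun b => ?_)
      rw [norm_mul, mul_comm]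
      gcongr
      exact (zak g x).norm_coe_le_norm b
    simpa [mul_comm] using this
  have hFsq : ∑' k : ℤ, ‖c k‖ₑ ^ 2 = ∫⁻ b, ‖F b‖ₑ ^ 2 ∂AddCircle.haarAddCircle := by
    rw [← tsum_enorm_sq_fourierCoeff (Lp.memLp F)]
    simp_rw [hF]
  have hFm : AEMeasurable (fun b => ‖F b‖ₑ ^ 2) AddCircle.haarAddCircle :=
    (Lp.memLp F).1.enorm.pow_const 2
  calc (A.toNNReal : ENNReal) * ∑' k : ℤ, ‖c k‖ₑ ^ 2
      = ∫⁻ b, A.toNNReal * ‖F b‖ₑ ^ 2 ∂AddCircle.haarAddCircle := by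
        rw [hFsq, lintegral_const_mul'' _ hFm]
    _ ≤ ∫⁻ b, ∑ x ∈ X, ‖zak g x b * F b‖ₑ ^ 2 ∂AddCircle.haarAddCircle := by
        apply lintegral_mono
        intro b
        simp only [enorm_mul, mul_pow]
        rw [← Finset.sum_mul]
        gcongr
        calc (A.toNNReal : ENNReal) ≤ ENNReal.ofReal (∑ x ∈ X, ‖zak g x b‖ ^ 2) :=
              ENNReal.ofReal_le_ofReal (hX b)
          _ = _ := by
            rw [ENNReal.ofReal_sum_of_nonneg (fun _ _ => by positivity)]
            simp_rw [ofReal_norm_sq]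
    _ = ∑ x ∈ X, ∫⁻ b, ‖zak g x b * F b‖ₑ ^ 2 ∂AddCircle.haarAddCircle :=
        lintegral_finsetSum' _ fun x _ => (hmem x).1.enorm.pow_const 2
    _ = ∑ x ∈ X, ∑' n : ℤ, ‖shiftSum g c (x - n)‖ₑ ^ 2 := by
        congr 1; ext x
        rw [← tsum_enorm_sq_fourierCoeff (hmem x)]
        simp_rw [fourierCoeff_zak_mul hg F hF]
    _ = _ := by
        rw [Summable.tsum_finsetSum]
        exact fun _ _ => ENNReal.summable


/-! ### From uniqueness to stable sampling -/

/-- Quantitative consequence of the lower density: every interval of length `L - 1` contains at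
least `N` points, with `N / L` larger than a given `D₀ < D`. -/
theorem HasLowerDensity.exists_blocks {Λ : Set ℝ} {D D₀ : ℝ} (h : HasLowerDensity Λ D)
    (hD : D₀ < D) : ∃ L N : ℕ, 0 < L ∧ D₀ * L < N ∧
      ∀ y : ℝ, ∃ S : Finset ℝ, S.card = N ∧ ∀ x ∈ S, x ∈ Λ ∧ y ≤ x ∧ x ≤ y + (L - 1) := by
  obtain ⟨D₁, h01, h1D⟩ := exists_between hD
  have h1 := h.comp tendsto_natCast_atTop_atTop
  -- The points are counted in a window of length 2R, but the blocks have period L = 2R + 1. This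
  -- choice of R makes the lost unit harmless: D₁ · 2R > D₀ (2R + 1).
  have h2 : ∀ᶠ R : ℕ in atTop, D₀ < (D₁ - D₀) * (2 * (R : ℝ)) := by
    have : Tendsto (fun R : ℕ => (D₁ - D₀) * (2 * (R : ℝ))) atTop atTop :=
      (tendsto_natCast_atTop_atTop.const_mul_atTop two_pos).const_mul_atTop (sub_pos.mpr h01)
    exact this.eventually_gt_atTop _
  obtain ⟨R, ⟨hR1, hR2⟩, hR3⟩ :=
    (((h1.eventually (lt_mem_nhds h1D)).and h2).and (eventually_gt_atTop 0)).exists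
  have hR0 : (0 : ℝ) < R := by exact_mod_cast hR3
  refine ⟨2 * R + 1, ⌈D₁ * (2 * R)⌉₊, by omega, ?_, fun y => ?_⟩
  · refine lt_of_lt_of_le ?_ (Nat.le_ceil _)
    push_cast
    linarith
  · set s := Λ ∩ Set.Icc (y + R - R) (y + R + R) with hs
    have hb : BddBelow (Set.range fun x : ℝ =>
        ((Λ ∩ Set.Icc (x - R) (x + R)).ncard : ℝ) / (2 * R)) :=
      ⟨0, by rintro _ ⟨x, rfl⟩; positivity⟩
    have h3 : D₁ < (s.ncard : ℝ) / (2 * R) := hR1.trans_le (ciInf_le hb (y + R))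
    rw [lt_div_iff₀ (by positivity)] at h3
    have h4 : ⌈D₁ * (2 * R)⌉₊ ≤ s.ncard := Nat.ceil_le.mpr h3.le
    rcases Nat.eq_zero_or_pos ⌈D₁ * (2 * R)⌉₊ with h0 | h0
    · exact ⟨∅, by simp [h0], by simp⟩
    obtain ⟨t, hts, htc⟩ := Set.exists_subset_card_eq h4
    -- An infinite set has `ncard` equal to 0, so a positive count entails finiteness.
    have htf : t.Finite := Set.finite_of_ncard_pos (by omega)
    refine ⟨htf.toFinset, by rw [← htc, Set.ncard_eq_toFinset_card t htf], fun x hx => ?_⟩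
    have hx' := hts (htf.mem_toFinset.mp hx)
    refine ⟨hx'.1, by simpa using hx'.2.1, ?_⟩
    have := hx'.2.2
    push_cast
    linarith

theorem shiftSum_smul_shift (g : ℝ → ℂ) (c : ℤ → ℂ) (ρ : ℂ) (n : ℤ) (t : ℝ) :
    shiftSum g (fun m => ρ * c (m + n)) (t + n) = ρ * shiftSum g c t := by
  rw [shiftSum, shiftSum, ← (Equiv.addRight n).tsum_eq (fun k : ℤ => c k * g (t + k)),
    ← tsum_mul_left]
  congr 1; ext m
  simp only [Equiv.coe_addRight]
  rw [mul_assoc]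
  congr 3
  push_cast; ring

/-- Dominated convergence: the exponential decay of g absorbs linear growth of the coefficients. The
limit coefficients need not be square-summable, which is why uniqueness is required for linear
growth. -/
theorem tendsto_shiftSum {g : ℝ → ℂ} (hg : ExpDecay g) {l : Filter ℕ} {c : ℕ → ℤ → ℂ}
    {c' : ℤ → ℂ} {K : ℝ} (hc : ∀ j m, ‖c j m‖ ≤ K * (1 + |(m : ℝ)|))
    (hlim : ∀ m, Tendsto (fun j => c j m) l (𝓝 (c' m))) {t : ℕ → ℝ} {t' r : ℝ}
    (ht : Tendsto t l (𝓝 t')) (hr : ∀ j, |t j| ≤ r) :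
    Tendsto (fun j => shiftSum g (c j) (t j)) l (𝓝 (shiftSum g c' t')) := by
  obtain ⟨u, hu, -, hu0, hb⟩ := hg.exists_bound r
  refine tendsto_tsum_of_dominated_convergence (hu.mul_left K) (fun k => ?_)
    (Eventually.of_forall fun j k => ?_)
  · exact (hlim k).mul ((hg.1.tendsto _).comp (ht.add_const _))
  · rw [norm_mul, ← mul_assoc]
    exact mul_le_mul (hc j k) (hb _ (hr j) k) (norm_nonneg _)
      ((norm_nonneg _).trans (hc j k))

theorem summable_inv_one_add_sq : Summable fun m : ℤ => (1 + (m : ℝ) ^ 2)⁻¹ := by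
  have h : Summable fun n : ℕ => (1 + (n : ℝ) ^ 2)⁻¹ := by
    refine Summable.of_norm_bounded_eventually_nat
      (Real.summable_nat_pow_inv.mpr (one_lt_two)) ?_
    filter_upwards [eventually_gt_atTop 0] with n hn
    have : (0 : ℝ) < n := by exact_mod_cast hn
    rw [Real.norm_of_nonneg (by positivity)]
    gcongr
    linarith
  apply Summable.of_nat_of_neg <;> simpa using h

/-- The polynomial weight used to localize. -/
noncomputable def wt (m : ℤ) : ENNReal := ENNReal.ofReal (1 + (m : ℝ) ^ 2)⁻¹

theorem tsum_wt_ne_top : ∑' m, wt m ≠ ⊤ := by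
  simp_rw [wt]
  rw [← ENNReal.ofReal_tsum_of_nonneg (fun m => by positivity) summable_inv_one_add_sq]
  exact ENNReal.ofReal_ne_top

/-- Over all translations n, each index i receives the same total weight ∑ wt. -/
theorem tsum_tsum_wt {ι : Type*} (s : ι → ℤ) (u : ι → ENNReal) :
    ∑' n : ℤ, ∑' i, wt (s i + n) * u i = (∑' m, wt m) * ∑' i, u i := by
  rw [ENNReal.tsum_comm, ← ENNReal.tsum_mul_left]
  congr 1; ext i
  rw [ENNReal.tsum_mul_right]
  exact congrArg (· * u i) ((Equiv.addLeft (s i)).tsum_eq wt)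

theorem le_of_wt_mul_le {m : ℤ} {z : ℂ} {κ M v : ℝ} (hκ : 0 < κ) (hv : 0 < v) (hM : 0 < M)
    (h : ENNReal.ofReal κ * (ENNReal.ofReal M * (wt m * ‖z‖ₑ ^ 2)) ≤ ENNReal.ofReal v) :
    M * ‖((Real.sqrt v)⁻¹ : ℝ) * z‖ ^ 2 ≤ κ⁻¹ * (1 + (m : ℝ) ^ 2) := by
  rw [wt, ← ofReal_norm_sq, ← ENNReal.ofReal_mul (by positivity),
    ← ENNReal.ofReal_mul hM.le, ← ENNReal.ofReal_mul hκ.le,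
    ENNReal.ofReal_le_ofReal_iff hv.le] at h
  rw [norm_mul, mul_pow, Complex.norm_real, Real.norm_of_nonneg (by positivity), inv_pow,
    Real.sq_sqrt hv.le]
  field_simp at h ⊢
  nlinarith

/-- A pigeonhole over integer translations. The weighted energy of c around n (`a n`), M times the
weighted sample energy (`b n`) and the energy on X (`v n`) are summed over n. The totals yield one n
at which `v n` dominates the other two. Translating by this n and dividing by the square root of `v
n` gives c', and the bounds left by the weight are those of linear growth. -/
theorem exists_localized {g : ℝ → ℂ} {X : Finset ℝ} {A : NNReal} (hA : 0 < A)
    (hX : ∀ c : ℤ → ℂ, ∑' k : ℤ, ‖c k‖ₑ ^ 2 ≠ ⊤ →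
      A * ∑' k : ℤ, ‖c k‖ₑ ^ 2 ≤ ∑' n : ℤ, ∑ x ∈ X, ‖shiftSum g c (x - n)‖ₑ ^ 2) :
    ∃ K : ℝ, 0 < K ∧ ∀ (c : ℤ → ℂ), ∑' k : ℤ, ‖c k‖ₑ ^ 2 ≠ ⊤ → ∑' k : ℤ, ‖c k‖ₑ ^ 2 ≠ 0 →
      ∀ (Λ : Set ℝ) (x : ℝ) (M : ℝ), 0 < M →
        ENNReal.ofReal M * ∑' l : Λ, ‖shiftSum g c (x - l)‖ₑ ^ 2 ≤ ∑' k : ℤ, ‖c k‖ₑ ^ 2 →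
      ∃ (c' : ℤ → ℂ) (y : ℝ), (∀ m, ‖c' m‖ ≤ K * (1 + |(m : ℝ)|)) ∧
        (∀ l ∈ Λ, M * ‖shiftSum g c' (y - l)‖ ^ 2 ≤ K ^ 2 * (2 + |y - l|) ^ 2) ∧
        ∑ x ∈ X, ‖shiftSum g c' x‖ ^ 2 = 1 := by
  set W := ∑' m, wt m with hW
  have hWt : W ≠ ⊤ := tsum_wt_ne_top
  -- Chosen so that κ · 2W < A: the two weighted energies total at most 2W‖c‖², while the samples on
  -- X total at least A‖c‖².
  set κ : ℝ := A / (2 * W.toReal + 1) with hκdef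
  have hW0 : 0 ≤ W.toReal := ENNReal.toReal_nonneg
  have hA' : (0 : ℝ) < A := hA
  have hκ : 0 < κ := by positivity
  have hκA : ENNReal.ofReal κ * (2 * W) < A := by
    rw [← ENNReal.ofReal_toReal hWt, ← ENNReal.ofReal_ofNat 2,
      ← ENNReal.ofReal_mul (by norm_num), ← ENNReal.ofReal_mul hκ.le,
      ← ENNReal.ofReal_coe_nnreal, ENNReal.ofReal_lt_ofReal_iff hA', hκdef, div_mul_eq_mul_div,
      div_lt_iff₀ (by positivity)]
    nlinarith
  refine ⟨Real.sqrt κ⁻¹, by positivity, fun c hc hc0 Λ x M hM hsm => ?_⟩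
  have hK2 : Real.sqrt κ⁻¹ ^ 2 = κ⁻¹ := Real.sq_sqrt (by positivity)
  set v : ℤ → ENNReal := fun n => ∑ x ∈ X, ‖shiftSum g c (x - n)‖ₑ ^ 2 with hv
  set a : ℤ → ENNReal := fun n => ∑' m : ℤ, wt m * ‖c (m + n)‖ₑ ^ 2 with ha
  set b : ℤ → ENNReal := fun n => ∑' l : Λ, wt (⌊x - l⌋ + n) * ‖shiftSum g c (x - l)‖ₑ ^ 2 with hb
  have hasum : ∑' n, a n = W * ∑' k, ‖c k‖ₑ ^ 2 := by
    rw [ha, ENNReal.tsum_comm, hW, ← ENNReal.tsum_mul_right]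
    congr 1; ext m
    rw [ENNReal.tsum_mul_left]
    exact congrArg (wt m * ·) ((Equiv.addLeft m).tsum_eq (fun k => ‖c k‖ₑ ^ 2))
  have hbsum : ∑' n, b n = W * ∑' l : Λ, ‖shiftSum g c (x - l)‖ₑ ^ 2 := tsum_tsum_wt _ _
  obtain ⟨n, hn⟩ : ∃ n, ENNReal.ofReal κ * (a n + ENNReal.ofReal M * b n) < v n := by
    by_contra! hcon
    have h1 := ENNReal.tsum_le_tsum hcon
    rw [ENNReal.tsum_mul_left, ENNReal.tsum_add, ENNReal.tsum_mul_left, hasum, hbsum] at h1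
    have h2 := (hX c hc).trans h1
    have h3 : W * ∑' k, ‖c k‖ₑ ^ 2 +
        ENNReal.ofReal M * (W * ∑' l : Λ, ‖shiftSum g c (x - l)‖ₑ ^ 2) ≤
        2 * W * ∑' k, ‖c k‖ₑ ^ 2 := by
      calc _ = W * ∑' k, ‖c k‖ₑ ^ 2 +
            W * (ENNReal.ofReal M * ∑' l : Λ, ‖shiftSum g c (x - l)‖ₑ ^ 2) := by ring
        _ ≤ W * ∑' k, ‖c k‖ₑ ^ 2 + W * ∑' k, ‖c k‖ₑ ^ 2 := by gcongr
        _ = _ := by ring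
    have h4 : A * ∑' k, ‖c k‖ₑ ^ 2 ≤ (ENNReal.ofReal κ * (2 * W)) * ∑' k, ‖c k‖ₑ ^ 2 :=
      h2.trans (by rw [mul_assoc]; gcongr)
    exact absurd (ENNReal.mul_lt_mul_left hc0 hc hκA) (not_lt.mpr h4)
  have hvtop : v n ≠ ⊤ := by
    rw [hv]
    simp only [ne_eq, ENNReal.sum_eq_top, not_exists, not_and]
    intro _ _; simp
  set V := (v n).toReal with hV
  have hvV : v n = ENNReal.ofReal V := (ENNReal.ofReal_toReal hvtop).symm
  have hV0 : 0 < V := ENNReal.toReal_pos (ne_bot_of_gt hn) hvtop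
  have key : ∀ (x : ℝ) , shiftSum g (fun m => ((Real.sqrt V)⁻¹ : ℝ) * c (m + n)) x =
      ((Real.sqrt V)⁻¹ : ℝ) * shiftSum g c (x - n) := by
    intro x
    rw [← shiftSum_smul_shift g c _ n, sub_add_cancel]
  refine ⟨fun m => ((Real.sqrt V)⁻¹ : ℝ) * c (m + n), x + n, fun m => ?_, fun l hl => ?_, ?_⟩
  · have h1 : ENNReal.ofReal κ * (ENNReal.ofReal 1 * (wt m * ‖c (m + n)‖ₑ ^ 2)) ≤
        ENNReal.ofReal V := by
      rw [← hvV, ENNReal.ofReal_one, one_mul]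
      refine le_trans ?_ hn.le
      gcongr
      exact (ENNReal.le_tsum (f := fun m : ℤ => wt m * ‖c (m + n)‖ₑ ^ 2) m).trans le_self_add
    have h2 := le_of_wt_mul_le hκ hV0 one_pos h1
    apply le_of_sq_le_sq ?_ (by positivity)
    rw [mul_pow, hK2]
    rw [one_mul] at h2
    refine h2.trans ?_
    gcongr
    nlinarith [abs_nonneg (m : ℝ), sq_abs (m : ℝ)]
  · have h1 : ENNReal.ofReal κ * (ENNReal.ofReal M *
        (wt (⌊x - l⌋ + n) * ‖shiftSum g c (x - l)‖ₑ ^ 2)) ≤ ENNReal.ofReal V := by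
      rw [← hvV]
      refine le_trans ?_ hn.le
      gcongr
      refine le_trans ?_ le_add_self
      gcongr
      exact ENNReal.le_tsum
        (f := fun l : Λ => wt (⌊x - l⌋ + n) * ‖shiftSum g c (x - l)‖ₑ ^ 2) ⟨l, hl⟩
    have h2 := le_of_wt_mul_le hκ hV0 hM h1
    rw [key, show x + n - l - n = x - l by ring]
    refine h2.trans ?_
    rw [hK2]
    gcongr
    -- The weight sits at an integer, at distance less than 1 from y - l; this rounding accounts for
    -- the 2 in 2 + |y - l|.
    have h3 : ((⌊x - l⌋ + n : ℤ) : ℝ) = (x + n - l) - Int.fract (x - l) := by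
      rw [Int.fract]; push_cast; ring
    have h4 : |((⌊x - l⌋ + n : ℤ) : ℝ)| ≤ |x + n - l| + 1 := by
      rw [h3]
      refine (abs_sub _ _).trans ?_
      rw [abs_of_nonneg (Int.fract_nonneg (x - l))]
      linarith [(Int.fract_lt_one (x - l)).le]
    rw [← sq_abs]
    nlinarith [abs_nonneg ((⌊x - l⌋ + n : ℤ) : ℝ), abs_nonneg (x + n - l)]
  · simp_rw [key, norm_mul, mul_pow]
    rw [← Finset.mul_sum, Complex.norm_real, Real.norm_of_nonneg (by positivity), inv_pow,
      Real.sq_sqrt hV0.le]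
    have : V = ∑ x ∈ X, ‖shiftSum g c (x - n)‖ ^ 2 := by
      rw [hV, hv, ENNReal.toReal_sum (fun _ _ => by simp)]
      simp
    rw [← this]
    exact inv_mul_cancel₀ hV0.ne'

theorem exists_tendsto_of_bounded {E : Type*} [PseudoMetricSpace E] [ProperSpace E]
    (U : Ultrafilter ℕ) {s : Set E} (hs : IsCompact s) {f : ℕ → E} (hf : ∀ j, f j ∈ s) :
    ∃ z ∈ s, Tendsto f U (𝓝 z) := by
  obtain ⟨z, hz, h⟩ := isCompact_iff_ultrafilter_le_nhds.mp hs (U.map f) (by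
    rw [le_principal_iff]
    exact Filter.mem_map.mpr (Filter.univ_mem' hf))
  exact ⟨z, hz, h⟩

/-- If functions `∑ c_k g(x + k)` with coefficients of linear growth are determined by zero sets
of density larger than `D₀`, then separated sets of lower density larger than `D₀` yield frames. -/
theorem isGaborFrame_of_uniqueness {g : ℝ → ℂ} (hg : ExpDecay g) (hV : FourierNonvanishing g)
    {Λ : Set ℝ} (hΛ : IsSeparatedSet Λ) {D D₀ : ℝ} (hD : HasLowerDensity Λ D) (hDD : D₀ < D)
    (huniq : ∀ (c : ℤ → ℂ) (K : ℝ), (∀ k, ‖c k‖ ≤ K * (1 + |(k : ℝ)|)) →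
      ∀ L N : ℕ, 0 < L → D₀ * L < N →
      (∀ m : ℤ, ∃ S : Finset ℝ, S.card = N ∧
        ∀ x ∈ S, m * L ≤ x ∧ x ≤ m * L + (L - 1) ∧ shiftSum g c x = 0) →
      ∀ x, shiftSum g c x = 0) :
    IsGaborFrame g Λ intSet := by
  obtain ⟨L, N, hL, hLN, hblock⟩ := hD.exists_blocks hDD
  obtain ⟨X, A, hA, hX⟩ := exists_stable_samples hg hV
  obtain ⟨K, hK, hloc⟩ := exists_localized hA hX
  suffices h : ∃ j : ℕ, ∀ (x : ℝ) (c : ℤ → ℂ), ∑' k : ℤ, ‖c k‖ₑ ^ 2 ≠ ⊤ →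
      ∑' k : ℤ, ‖c k‖ₑ ^ 2 ≤
        ENNReal.ofReal (j + 1) * ∑' l : Λ, ‖shiftSum g c (x - l)‖ₑ ^ 2 by
    obtain ⟨j, hj⟩ := h
    refine isGaborFrame_of_sampling hΛ hg (A := ((j : NNReal) + 1)⁻¹) (by positivity) ?_
    intro x c hc
    have h1 := hj x c hc
    have h2 : ENNReal.ofReal ((j : ℝ) + 1) = (((j : NNReal) + 1 : NNReal) : ENNReal) := by
      rw [← ENNReal.ofReal_coe_nnreal]; simp
    rw [h2] at h1
    rw [ENNReal.coe_inv (by positivity), mul_comm, ← div_eq_mul_inv]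
    exact ENNReal.div_le_of_le_mul' h1
  by_contra! hcon
  choose x c hc hlt using hcon
  have hex := fun j => hloc (c j) (hc j) (ne_bot_of_gt (hlt j)) Λ (x j) ((j : ℝ) + 1)
    (by positivity) (hlt j).le
  choose c' y hc' hsmall hone using hex
  obtain ⟨δ, hδ, hsep⟩ := hΛ
  -- Along an ultrafilter every bounded sequence converges, so all coefficients and all zeros pass
  -- to the limit at once without diagonal subsequences.
  set U : Ultrafilter ℕ := hyperfilter ℕ with hU
  have hUtop : (U : Filter ℕ) ≤ atTop := by
    rw [← Nat.cofinite_eq_atTop]; exact hyperfilter_le_cofinite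
  have hclim : ∀ m : ℤ, ∃ z : ℂ, Tendsto (fun j => c' j m) U (𝓝 z) := by
    intro m
    obtain ⟨z, -, hz⟩ := exists_tendsto_of_bounded U
      (isCompact_closedBall (0 : ℂ) (K * (1 + |(m : ℝ)|))) (f := fun j => c' j m)
      (fun j => by simpa using hc' j m)
    exact ⟨z, hz⟩
  choose z hz using hclim
  have hzb : ∀ m, ‖z m‖ ≤ K * (1 + |(m : ℝ)|) := fun m =>
    le_of_tendsto (hz m).norm (Eventually.of_forall fun j => hc' j m)
  have hzero : ∀ m : ℤ, ∃ S : Finset ℝ, S.card = N ∧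
        ∀ x ∈ S, m * L ≤ x ∧ x ≤ m * L + (L - 1) ∧ shiftSum g z x = 0 := by
    intro m
    -- The reflection l ↦ y j - l carries this block onto [mL, mL + L - 1].
    choose S hScard hS using fun j => hblock (y j - m * L - (L - 1))
    set p : ∀ j, Fin N → ℝ := fun j i =>
      y j - ((S j).equivFinOfCardEq (hScard j)).symm i with hp
    have hmem : ∀ j i, p j i ∈ Set.Icc ((m : ℝ) * L) (m * L + (L - 1)) := by
      intro j i
      have := hS j _ (((S j).equivFinOfCardEq (hScard j)).symm i).2
      constructor <;> simp only [hp] <;> linarith [this.2.1, this.2.2]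
    have hΛp : ∀ j i, ∃ l ∈ Λ, p j i = y j - l := fun j i =>
      ⟨_, (hS j _ (((S j).equivFinOfCardEq (hScard j)).symm i).2).1, rfl⟩
    have hpsep : ∀ j i i', i ≠ i' → δ ≤ |p j i - p j i'| := by
      intro j i i' hne
      have := hsep _ (hS j _ (((S j).equivFinOfCardEq (hScard j)).symm i').2).1
        _ (hS j _ (((S j).equivFinOfCardEq (hScard j)).symm i).2).1
        (fun h => hne (((S j).equivFinOfCardEq (hScard j)).symm.injective (Subtype.ext h.symm)))
      simp only [hp]
      rwa [sub_sub_sub_cancel_left]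
    have hlim : ∀ i, ∃ q ∈ Set.Icc ((m : ℝ) * L) (m * L + (L - 1)),
        Tendsto (fun j => p j i) U (𝓝 q) := fun i =>
      exists_tendsto_of_bounded U isCompact_Icc (fun j => hmem j i)
    choose q hqmem hq using hlim
    -- Separation survives the limit, so the N zeros of a block cannot merge.
    have hqsep : ∀ i i', i ≠ i' → δ ≤ |q i - q i'| := fun i i' hne =>
      ge_of_tendsto ((hq i).sub (hq i')).abs (Eventually.of_forall fun j => hpsep j i i' hne)
    have hqinj : Function.Injective q := by
      intro i i' h
      by_contra hne
      have := hqsep i i' hne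
      rw [h, sub_self, abs_zero] at this
      linarith
    refine ⟨Finset.univ.image q, by rw [Finset.card_image_of_injective _ hqinj]; simp, ?_⟩
    intro x hx
    obtain ⟨i, -, rfl⟩ := Finset.mem_image.mp hx
    refine ⟨(hqmem i).1, (hqmem i).2, ?_⟩
    set r := |(m : ℝ) * L| + |(m : ℝ) * L + (L - 1)| with hr
    have hrb : ∀ j, |p j i| ≤ r := by
      intro j
      have h1 := hmem j i
      rw [abs_le]
      constructor
      · have := neg_abs_le ((m : ℝ) * L)
        have h2 := abs_nonneg ((m : ℝ) * L + (L - 1))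
        linarith [h1.1]
      · have := le_abs_self ((m : ℝ) * L + (L - 1))
        have h2 := abs_nonneg ((m : ℝ) * L)
        linarith [h1.2]
    have hT := tendsto_shiftSum hg hc' hz (hq i) hrb
    have hT0 : Tendsto (fun j => shiftSum g (c' j) (p j i)) U (𝓝 0) := by
      have h1 : ∀ j : ℕ, ‖shiftSum g (c' j) (p j i)‖ ^ 2 ≤ K ^ 2 * (2 + r) ^ 2 * (1 / ((j : ℝ) + 1)) := by
        intro j
        obtain ⟨l, hl, hpl⟩ := hΛp j i
        have h2 := hsmall j l hl
        rw [← hpl] at h2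
        rw [mul_one_div, le_div_iff₀ (by positivity), mul_comm]
        refine h2.trans ?_
        gcongr
        exact hrb j
      have h2 : Tendsto (fun j : ℕ => K ^ 2 * (2 + r) ^ 2 * (1 / ((j : ℝ) + 1))) U (𝓝 0) := by
        have := (tendsto_one_div_add_atTop_nhds_zero_nat (𝕜 := ℝ)).const_mul (K ^ 2 * (2 + r) ^ 2)
        rw [mul_zero] at this
        exact this.mono_left hUtop
      have h3 := squeeze_zero (fun j => by positivity) h1 h2
      have h4 := h3.sqrt
      simp only [Real.sqrt_zero, Real.sqrt_sq (norm_nonneg _)] at h4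
      exact tendsto_zero_iff_norm_tendsto_zero.mpr h4
    exact tendsto_nhds_unique hT hT0
  -- The limit vanishes identically, whereas its energy on X is the limit of a sequence constantly
  -- equal to 1.
  have hall := huniq z K hzb L N hL hLN hzero
  have h1 : Tendsto (fun j => ∑ x ∈ X, ‖shiftSum g (c' j) x‖ ^ 2) U
      (𝓝 (∑ x ∈ X, ‖shiftSum g z x‖ ^ 2)) := by
    refine tendsto_finsetSum _ fun x _ => ?_
    exact ((tendsto_shiftSum hg hc' hz tendsto_const_nhds (fun _ => le_rfl)).norm).pow 2
  simp only [hone, hall] at h1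
  have := tendsto_nhds_unique h1 tendsto_const_nhds
  simp at this


/-! ### A Schwarz lemma for periodic functions in a vertical strip -/

/-- Division of a holomorphic function by an entire function with simple zeros. -/
theorem exists_holomorphic_quotient {U : Set ℂ} (hU : IsOpen U) {f e : ℂ → ℂ} {ω : ℂ}
    (hf : DifferentiableOn ℂ f U) (he : Differentiable ℂ e)
    (hz : ∀ z ∈ U, e z = 0 → f z = 0) (hsimple : ∀ z, e z = 0 → deriv e z ≠ 0)
    (hfp : ∀ z, f (z + ω) = f z) (hep : ∀ z, e (z + ω) = e z) :
    ∃ h : ℂ → ℂ, DifferentiableOn ℂ h U ∧ (∀ z, h (z + ω) = h z) ∧ ∀ z ∈ U, f z = e z * h z := by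
  have hderiv : ∀ u : ℂ → ℂ, (∀ z, u (z + ω) = u z) → ∀ z, deriv u (z + ω) = deriv u z := by
    intro u hu z
    rw [← deriv_comp_add_const]
    congr 1
    ext w
    exact hu w
  classical
  -- The removable singularities are filled with the explicit value f'/e', which makes periodicity
  -- immediate. Near a zero of e the function is a quotient of two `dslope`s, hence holomorphic.
  refine ⟨fun z => if e z = 0 then deriv f z / deriv e z else f z / e z, ?_, ?_, ?_⟩
  · intro z₀ hz₀
    apply DifferentiableAt.differentiableWithinAt
    have hUz : U ∈ 𝓝 z₀ := hU.mem_nhds hz₀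
    by_cases h0 : e z₀ = 0
    · have hd1 : DifferentiableAt ℂ (dslope f z₀) z₀ :=
        ((Complex.differentiableOn_dslope hUz).mpr hf).differentiableAt hUz
      have hd2 : DifferentiableAt ℂ (dslope e z₀) z₀ :=
        ((Complex.differentiableOn_dslope univ_mem).mpr he.differentiableOn).differentiableAt
          univ_mem
      have hne : dslope e z₀ z₀ ≠ 0 := by rw [dslope_same]; exact hsimple z₀ h0
      refine (hd1.div hd2 hne).congr_of_eventuallyEq ?_
      have h1 : ∀ᶠ z in 𝓝[≠] z₀, e z ≠ 0 := by
        have := (he z₀).hasDerivAt.eventually_ne (c := 0) (hsimple z₀ h0)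
        exact this
      rw [eventually_nhdsWithin_iff] at h1
      filter_upwards [h1] with z hz1
      by_cases hzz : z = z₀
      · subst hzz
        simp [h0]
      · have hze := hz1 hzz
        simp only [hze, if_false, Pi.div_apply]
        rw [dslope_of_ne _ hzz, dslope_of_ne _ hzz, slope_def_field, slope_def_field, h0,
          hz z₀ hz₀ h0, sub_zero, sub_zero]
        have : z - z₀ ≠ 0 := sub_ne_zero.mpr hzz
        field_simp
    · have hd := ((hf.differentiableAt hUz).div (he z₀) h0)
      refine hd.congr_of_eventuallyEq ?_
      filter_upwards [(he z₀).continuousAt.eventually_ne h0] with z hz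
      simp [hz]
  · intro z
    simp only [hep z, hfp z, hderiv f hfp z, hderiv e hep z]
  · intro z hzU
    by_cases h0 : e z = 0
    · rw [h0, zero_mul, hz z hzU h0]
    · simp only [h0, if_false]
      field_simp

theorem exists_holomorphic_quotient_prod {ι : Type*} {U : Set ℂ} (hU : IsOpen U) {f : ℂ → ℂ}
    {e : ι → ℂ → ℂ} {ω : ℂ} (hf : DifferentiableOn ℂ f U) (he : ∀ i, Differentiable ℂ (e i))
    (hsimple : ∀ i z, e i z = 0 → deriv (e i) z ≠ 0)
    (hdisj : ∀ i j, i ≠ j → ∀ z, e i z = 0 → e j z ≠ 0)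
    (hfp : ∀ z, f (z + ω) = f z) (hep : ∀ i z, e i (z + ω) = e i z) (S : Finset ι)
    (hz : ∀ i ∈ S, ∀ z ∈ U, e i z = 0 → f z = 0) :
    ∃ h : ℂ → ℂ, DifferentiableOn ℂ h U ∧ (∀ z, h (z + ω) = h z) ∧
      ∀ z ∈ U, f z = (∏ i ∈ S, e i z) * h z := by
  classical
  induction S using Finset.induction_on with
  | empty => exact ⟨f, hf, hfp, by simp⟩
  | insert i S hi ih =>
    obtain ⟨h, hh, hhp, hfh⟩ := ih fun j hj => hz j (Finset.mem_insert_of_mem hj)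
    -- The factors have disjoint zero sets, so dividing by the earlier ones leaves the zeros of e i
    -- in the quotient.
    have hz' : ∀ z ∈ U, e i z = 0 → h z = 0 := by
      intro z hzU h0
      have h1 := hz i (Finset.mem_insert_self i S) z hzU h0
      rw [hfh z hzU] at h1
      refine (mul_eq_zero.mp h1).resolve_left (Finset.prod_ne_zero_iff.mpr fun j hj => ?_)
      exact hdisj i j (fun hij => hi (hij ▸ hj)) z h0
    obtain ⟨k, hk, hkp, hhk⟩ := exists_holomorphic_quotient hU hh (he i) hz' (hsimple i) hhp (hep i)
    refine ⟨k, hk, hkp, fun z hzU => ?_⟩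
    rw [Finset.prod_insert hi, hfh z hzU, hhk z hzU]
    ring

/-- Maximum principle for periodic functions in a vertical strip. -/
theorem norm_le_of_periodic_strip {h : ℂ → ℂ} {R r τ B : ℝ} (hτ : 0 < τ) (hR : 0 < R) (hRr : R < r)
    (hh : DifferentiableOn ℂ h (Complex.re ⁻¹' Set.Ioo (-r) r))
    (hp : ∀ z, h (z + τ * Complex.I) = h z)
    (hB : ∀ z : ℂ, |z.re| = R → ‖h z‖ ≤ B) {z : ℂ} (hz : |z.re| ≤ R) : ‖h z‖ ≤ B := by
  have hsub : Complex.re ⁻¹' Set.Icc (-R) R ⊆ Complex.re ⁻¹' Set.Ioo (-r) r := by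
    intro w hw
    exact ⟨by linarith [hw.1], by linarith [hw.2]⟩
  have hd : DifferentiableOn ℂ h (Complex.re ⁻¹' Set.Icc (-R) R) := hh.mono hsub
  have hcl : closure (Complex.re ⁻¹' Set.Ioo (-R) R) = Complex.re ⁻¹' Set.Icc (-R) R := by
    rw [Complex.closure_preimage_re, closure_Ioo (by linarith)]
  have hdc : DiffContOnCl ℂ h (Complex.re ⁻¹' Set.Ioo (-R) R) := by
    apply DifferentiableOn.diffContOnCl
    rwa [hcl]
  have hperZ : ∀ (n : ℤ) z, h (z + n * (τ * Complex.I)) = h z := fun n z => by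
    have hper : Function.Periodic h (τ * Complex.I) := hp
    simpa using (hper.int_mul n) z
  obtain ⟨M, hM⟩ := ((isCompact_Icc (a := -R) (b := R)).reProdIm
    (isCompact_Icc (a := (0 : ℝ)) (b := τ))).exists_bound_of_continuousOn
    (hd.continuousOn.mono (fun w hw => (Complex.mem_reProdIm.mp hw).1))
  -- Periodicity reduces the strip to a compact rectangle. The resulting boundedness is the growth
  -- condition for Phragmén–Lindelöf.
  have hbound : ∀ w : ℂ, w.re ∈ Set.Icc (-R) R → ‖h w‖ ≤ M := by
    intro w hw
    rw [← hperZ (-⌊w.im / τ⌋) w]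
    apply hM
    rw [Complex.mem_reProdIm]
    refine ⟨by simpa using hw, ?_⟩
    have h1 : (w + ((-⌊w.im / τ⌋ : ℤ) : ℂ) * (τ * Complex.I)).im = τ * Int.fract (w.im / τ) := by
      have h2 : w.im = τ * (w.im / τ) := by field_simp
      have h3 := Int.floor_add_fract (w.im / τ)
      simp
      linear_combination h2 - τ * h3
    rw [h1]
    exact ⟨mul_nonneg hτ.le (Int.fract_nonneg _),
      mul_le_of_le_one_right hτ.le (Int.fract_lt_one _).le⟩
  refine PhragmenLindelof.vertical_strip hdc ⟨0, by
    have := Real.pi_pos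
    apply div_pos this; linarith, 0, ?_⟩ (fun w hw => hB w ?_) (fun w hw => hB w ?_)
    (abs_le.mp hz).1 (abs_le.mp hz).2
  · refine Asymptotics.IsBigO.of_bound M ?_
    refine eventually_inf_principal.mpr (Eventually.of_forall fun w hw => ?_)
    simpa using hbound w ⟨hw.1.le, hw.2.le⟩
  · rw [hw, abs_neg, abs_of_pos hR]
  · rw [hw, abs_of_pos hR]

/-- The elementary factor `1 - exp(±β(z - x))` with zeros at `x + (2πi/β)ℤ`. -/
noncomputable def zeroFactor (β x : ℝ) (z : ℂ) : ℂ :=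
  1 - Complex.exp ((if 0 ≤ x then β else -β : ℝ) * (z - x))

theorem zeroFactor_differentiable (β x : ℝ) : Differentiable ℂ (zeroFactor β x) := by
  unfold zeroFactor; fun_prop

theorem zeroFactor_eq_zero {β x : ℝ} (hβ : 0 < β) {z : ℂ} (h : zeroFactor β x z = 0) :
    ∃ j : ℤ, z = x + 2 * Real.pi * Complex.I * j / β := by
  rw [zeroFactor, sub_eq_zero, eq_comm, Complex.exp_eq_one_iff] at h
  obtain ⟨n, hn⟩ := h
  have hβ' : (β : ℂ) ≠ 0 := by exact_mod_cast hβ.ne'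
  split_ifs at hn
  · refine ⟨n, ?_⟩
    field_simp
    linear_combination hn
  · refine ⟨-n, ?_⟩
    push_cast at hn ⊢
    field_simp
    linear_combination -hn

theorem zeroFactor_deriv {β x : ℝ} (hβ : 0 < β) (z : ℂ) : deriv (zeroFactor β x) z ≠ 0 := by
  set s : ℝ := if 0 ≤ x then β else -β with hs
  have hs0 : s ≠ 0 := by
    rw [hs]; split_ifs <;> simp [hβ.ne']
  have h1 : HasDerivAt (zeroFactor β x) (0 - Complex.exp (s * (z - x)) * (s * 1)) z := by
    unfold zeroFactor
    refine (hasDerivAt_const z (1 : ℂ)).sub ?_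
    exact (((hasDerivAt_id z).sub_const (x : ℂ)).const_mul (s : ℂ)).cexp
  rw [h1.deriv, zero_sub, mul_one, neg_ne_zero]
  exact mul_ne_zero (Complex.exp_ne_zero _) (by exact_mod_cast hs0)

theorem zeroFactor_add {β x : ℝ} {ω : ℂ} (hω : Complex.exp (β * ω) = 1) (z : ℂ) :
    zeroFactor β x (z + ω) = zeroFactor β x z := by
  unfold zeroFactor
  congr 1
  have h2 : Complex.exp ((if 0 ≤ x then β else -β : ℝ) * ω) = 1 := by
    split_ifs
    · exact hω
    · rw [Complex.ofReal_neg, neg_mul, Complex.exp_neg, hω, inv_one]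
  rw [show ((if 0 ≤ x then β else -β : ℝ) : ℂ) * (z + ω - x) =
    (if 0 ≤ x then β else -β : ℝ) * (z - x) + (if 0 ≤ x then β else -β : ℝ) * ω by ring,
    Complex.exp_add, h2, mul_one]

theorem norm_zeroFactor_le {β x : ℝ} (hβ : 0 < β) (y : ℝ) :
    ‖zeroFactor β x y‖ ≤ 1 + Real.exp (β * |y|) := by
  unfold zeroFactor
  refine (norm_sub_le _ _).trans ?_
  rw [norm_one, Complex.norm_exp]
  gcongr
  split_ifs with h
  · simp
    nlinarith [le_abs_self y]
  · simp
    nlinarith [neg_abs_le y]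

/-- Far to the right |exp w| dominates 1, and e^{β+s} - 1 ≥ (1 - e^{-β}) e^s since e^β + e^{-β} ≥ 2.
Far to the left 1 dominates, without gain, whence s = 0 there. -/
theorem le_norm_one_sub_exp {t : ℝ} {w : ℂ} (hw : w.re = t) {β s : ℝ} (h : β + s ≤ |t|) (hs : 0 ≤ s)
    (hts : 0 ≤ t ∨ s = 0) :
    (1 - Real.exp (-β)) * Real.exp s ≤ ‖1 - Complex.exp w‖ := by
  have h1 : ‖Complex.exp w‖ = Real.exp t := by rw [Complex.norm_exp, hw]
  rcases le_or_gt 0 t with ht | ht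
  · rw [abs_of_nonneg ht] at h
    have h2 := norm_sub_norm_le (Complex.exp w) 1
    rw [norm_sub_rev, h1, norm_one] at h2
    have h3 : Real.exp (β + s) ≤ Real.exp t := Real.exp_le_exp.mpr h
    rcases le_or_gt β 0 with hβ | hβ
    · have : 1 ≤ Real.exp (-β) := Real.one_le_exp (by linarith)
      have h5 := Real.exp_pos s
      nlinarith [norm_nonneg (1 - Complex.exp w)]
    have h4 : 1 ≤ Real.exp s := Real.one_le_exp hs
    have h5 : Real.exp (-β) * Real.exp (β + s) = Real.exp s := by rw [← Real.exp_add]; ring_nf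
    have h6 : Real.exp (-β) ≤ 1 := Real.exp_le_one_iff.mpr (by linarith)
    have h7 : 1 ≤ Real.exp β := Real.one_le_exp hβ.le
    have h8 : Real.exp (β + s) = Real.exp β * Real.exp s := Real.exp_add _ _
    have h9 : Real.exp (-β) * Real.exp β = 1 := by rw [← Real.exp_add]; simp
    nlinarith [Real.exp_pos (-β), Real.exp_pos s, mul_nonneg (sub_nonneg.mpr h7) (sub_nonneg.mpr h4),
      mul_nonneg (sub_nonneg.mpr h7) (sub_nonneg.mpr h6),
      mul_nonneg (mul_nonneg (sub_nonneg.mpr h7) (sub_nonneg.mpr h6)) (Real.exp_pos s).le]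
  · have hs0 : s = 0 := hts.resolve_left (not_le.mpr ht)
    rw [abs_of_neg ht, hs0, add_zero] at h
    have h2 := norm_sub_norm_le 1 (Complex.exp w)
    rw [h1, norm_one] at h2
    have h3 : Real.exp t ≤ Real.exp (-β) := Real.exp_le_exp.mpr (by linarith)
    rw [hs0, Real.exp_zero, mul_one]
    linarith

/-- Schwarz-type estimate: a periodic function in a strip that vanishes on `N` points (and their
translates by `2πi/β`) in each block of length `L` is small on the real line. -/
theorem norm_le_of_zeros_in_strip {H : ℂ → ℂ} {β τ B r : ℝ} (hβ : 0 < β) (hτ : 0 < τ)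
    (hβτ : Complex.exp (β * (τ * Complex.I)) = 1) {L N n : ℕ} (hL : 0 < L)
    (hr : ((n : ℝ) + 1) * L + 1 < r)
    (hH : DifferentiableOn ℂ H (Complex.re ⁻¹' Set.Ioo (-r) r))
    (hp : ∀ z, H (z + τ * Complex.I) = H z)
    (hB : ∀ z : ℂ, |z.re| = ((n : ℝ) + 1) * L + 1 → ‖H z‖ ≤ B) {S : ℤ → Finset ℝ}
    (hScard : ∀ m, (S m).card = N)
    (hS : ∀ m, ∀ x ∈ S m, (m : ℝ) * L ≤ x ∧ x ≤ m * L + (L - 1))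
    (hzero : ∀ m, ∀ x ∈ S m, |x| < r → ∀ j : ℤ, H (x + 2 * Real.pi * Complex.I * j / β) = 0)
    {y : ℝ} (hy : |y| ≤ ((n : ℝ) + 1) * L + 1) :
    ‖H y‖ ≤ B * ((1 + Real.exp (β * |y|)) / (1 - Real.exp (-β))) ^ (2 * N * n) *
      Real.exp (-(β * L * N * (n * (n + 1) / 2))) := by
  classical
  set R : ℝ := ((n : ℝ) + 1) * L + 1 with hR
  have hL1 : (1 : ℝ) ≤ L := by exact_mod_cast hL
  have hn0 : (0 : ℝ) ≤ n := Nat.cast_nonneg n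
  have hR1 : 1 ≤ R := by rw [hR]; nlinarith
  set η : ℝ := 1 - Real.exp (-β) with hη
  have hη0 : 0 < η := by
    rw [hη, sub_pos]; exact Real.exp_lt_one_iff.mpr (by linarith)
  have hSdisj : ∀ m m', m ≠ m' → Disjoint (S m) (S m') := by
    have aux : ∀ m m', m < m' → Disjoint (S m) (S m') := by
      intro m m' hmm
      rw [Finset.disjoint_left]
      intro x hx hx'
      have h1 := (hS m x hx).2
      have h2 := (hS m' x hx').1
      have h3 : (m : ℝ) + 1 ≤ m' := by exact_mod_cast hmm
      nlinarith
    intro m m' hmm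
    rcases lt_or_gt_of_ne hmm with h | h
    · exact aux m m' h
    · exact (aux m' m h).symm
  -- The i-th blocks on the two sides of the origin, both within (i + 1)L of 0, are grouped
  -- together.
  set Z : ℕ → Finset ℝ := fun i => S i ∪ S (-((i : ℤ) + 1)) with hZ
  have hZdisj : Set.PairwiseDisjoint (Finset.range n : Set ℕ) Z := by
    intro i _ j _ hij
    simp only [Function.onFun, hZ]
    rw [Finset.disjoint_union_left, Finset.disjoint_union_right, Finset.disjoint_union_right]
    refine ⟨⟨hSdisj _ _ (by omega), hSdisj _ _ (by omega)⟩,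
      ⟨hSdisj _ _ (by omega), hSdisj _ _ (by omega)⟩⟩
  have hpos : ∀ (i : ℕ), ∀ x ∈ S i, 0 ≤ x ∧ x ≤ i * L + (L - 1) := by
    intro i x hx
    have := hS i x hx
    push_cast at this
    exact ⟨le_trans (by positivity) this.1, this.2⟩
  have hneg : ∀ (i : ℕ), ∀ x ∈ S (-((i : ℤ) + 1)), x < 0 ∧ -((i + 1) * L) ≤ x := by
    intro i x hx
    have := hS _ x hx
    push_cast at this
    have hi : (0 : ℝ) ≤ i := Nat.cast_nonneg i
    constructor
    · nlinarith [this.2]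
    · nlinarith [this.1]
  have hprod : ∀ z, ∏ x ∈ (Finset.range n).biUnion Z, zeroFactor β x z =
      ∏ i ∈ Finset.range n, ((∏ x ∈ S i, zeroFactor β x z) *
        ∏ x ∈ S (-((i : ℤ) + 1)), zeroFactor β x z) := by
    intro z
    rw [Finset.prod_biUnion hZdisj]
    refine Finset.prod_congr rfl fun i _ => ?_
    exact Finset.prod_union (hSdisj _ _ (by omega))
  have hlt : ∀ i ∈ Finset.range n, (i : ℝ) + 1 ≤ n := by
    intro i hi
    exact_mod_cast Finset.mem_range.mp hi
  obtain ⟨h, hh, hhp, hfh⟩ := exists_holomorphic_quotient_prod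
    (isOpen_Ioo.preimage Complex.continuous_re) hH (e := zeroFactor β)
    (fun x => zeroFactor_differentiable β x) (fun x z _ => zeroFactor_deriv hβ z)
    (fun x x' hne z h1 h2 => by
      obtain ⟨j, hj⟩ := zeroFactor_eq_zero hβ h1
      obtain ⟨j', hj'⟩ := zeroFactor_eq_zero hβ h2
      apply hne
      have e1 : ∀ (x : ℝ) (j : ℤ), ((x : ℂ) + 2 * Real.pi * Complex.I * j / β).re = x := by
        intro x j
        rw [show (x : ℂ) + 2 * Real.pi * Complex.I * j / β =
          (x : ℂ) + ((2 * Real.pi * j / β : ℝ) : ℂ) * Complex.I by push_cast; ring]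
        simp
      rw [← e1 x j, ← e1 x' j', ← hj, ← hj'])
    hp (fun x z => zeroFactor_add hβτ z) ((Finset.range n).biUnion Z)
    (fun x hx z hz h1 => by
      obtain ⟨j, rfl⟩ := zeroFactor_eq_zero hβ h1
      rw [Finset.mem_biUnion] at hx
      obtain ⟨i, hi, hx⟩ := hx
      have hi' := hlt i hi
      rcases Finset.mem_union.mp hx with hx | hx
      · refine hzero _ x hx ?_ j
        have h2 := hpos i x hx
        rw [abs_of_nonneg h2.1]
        nlinarith
      · refine hzero _ x hx ?_ j
        have h2 := hneg i x hx
        rw [abs_of_neg h2.1]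
        nlinarith)
  -- On each boundary line, the zeros on the same side of the origin contribute exponential growth
  -- and the others at least η. The i-th block gives exp(βL(n - i)) for each of its N points, and ∑
  -- (n - i) = n(n + 1)/2.
  have hlow : ∀ z : ℂ, |z.re| = R → η ^ (2 * N * n) * Real.exp (β * L * N * (n * (n + 1) / 2)) ≤
      ‖∏ x ∈ (Finset.range n).biUnion Z, zeroFactor β x z‖ := by
    intro z hz
    rw [hprod, norm_prod]
    have hsum : ∀ k : ℕ, ∑ i ∈ Finset.range k, ((k : ℝ) - i) = k * (k + 1) / 2 := by
      intro k
      induction k with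
      | zero => simp
      | succ k ih =>
        have : ∑ i ∈ Finset.range k, (((k + 1 : ℕ) : ℝ) - i) =
            ∑ i ∈ Finset.range k, (((k : ℝ) - i) + 1) :=
          Finset.sum_congr rfl fun i _ => by push_cast; ring
        rw [Finset.sum_range_succ, this, Finset.sum_add_distrib, ih]
        simp
        ring
    have hconst : η ^ (2 * N * n) * Real.exp (β * L * N * (n * (n + 1) / 2)) =
        ∏ i ∈ Finset.range n, (η ^ N * (η * Real.exp (β * L * ((n : ℝ) - i))) ^ N) := by
      have : ∀ i ∈ Finset.range n, η ^ N * (η * Real.exp (β * L * ((n : ℝ) - i))) ^ N =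
          η ^ (2 * N) * Real.exp (β * L * N * ((n : ℝ) - i)) := by
        intro i _
        rw [mul_pow, ← Real.exp_nat_mul, ← mul_assoc, ← pow_add]
        congr 2
        · ring
        · ring
      rw [Finset.prod_congr rfl this, Finset.prod_mul_distrib, Finset.prod_const,
        Finset.card_range, ← Real.exp_sum, ← Finset.mul_sum, hsum, ← pow_mul]
    rw [hconst]
    have hcard : ∀ (m : ℤ) (c : ℝ), 0 ≤ c → (∀ x ∈ S m, c ≤ ‖zeroFactor β x z‖) →
        c ^ N ≤ ‖∏ x ∈ S m, zeroFactor β x z‖ := by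
      intro m c hc h
      rw [norm_prod, ← hScard m, ← Finset.prod_const]
      exact Finset.prod_le_prod (fun _ _ => hc) h
    apply Finset.prod_le_prod (fun _ _ => by positivity)
    intro i hi
    have hi' := hlt i hi
    have hre : ∀ x s : ℝ, ((s : ℂ) * (z - x)).re = s * (z.re - x) := by
      intro x s; simp
    rw [norm_mul]
    have hLi : 0 ≤ (L : ℝ) * ((n : ℝ) - i) := by
      apply mul_nonneg (by positivity); linarith
    have hs0 : 0 ≤ β * L * ((n : ℝ) - i) := by
      rw [mul_assoc]; exact mul_nonneg hβ.le hLi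
    -- The sign in `zeroFactor` makes a factor grow towards the side on which its zero lies, so the
    -- two boundary lines are treated symmetrically.
    rcases (abs_eq (by linarith)).mp hz with hz | hz
    · rw [mul_comm (η ^ N)]
      refine mul_le_mul (hcard _ _ (by positivity) fun x hx => ?_)
        (hcard _ _ hη0.le fun x hx => ?_) (by positivity) (norm_nonneg _)
      · have h2 := hpos i x hx
        unfold zeroFactor
        rw [if_pos h2.1]
        have h3 : β * 1 + β * ((L : ℝ) * ((n : ℝ) - i)) ≤ β * (z.re - x) := by
          rw [← mul_add]
          apply mul_le_mul_of_nonneg_left _ hβ.le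
          rw [hz, hR]; linarith
        have h4 : 0 ≤ β * (z.re - x) := by nlinarith
        refine le_norm_one_sub_exp (hre x β) ?_ hs0 (Or.inl h4)
        rw [abs_of_nonneg h4]; linarith
      · have h2 := hneg i x hx
        unfold zeroFactor
        rw [if_neg (not_le.mpr h2.1)]
        have h4 : -β * (z.re - x) ≤ -β := by nlinarith
        have := le_norm_one_sub_exp (hre x (-β)) (β := β) (s := 0)
          (by rw [abs_of_nonpos (by linarith)]; linarith) le_rfl (Or.inr rfl)
        rwa [Real.exp_zero, mul_one] at this
    · refine mul_le_mul (hcard _ _ hη0.le fun x hx => ?_)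
        (hcard _ _ (by positivity) fun x hx => ?_) (by positivity) (norm_nonneg _)
      · have h2 := hpos i x hx
        unfold zeroFactor
        rw [if_pos h2.1]
        have h4 : β * (z.re - x) ≤ -β := by nlinarith [h2.1]
        have := le_norm_one_sub_exp (hre x β) (β := β) (s := 0)
          (by rw [abs_of_nonpos (by linarith)]; linarith) le_rfl (Or.inr rfl)
        rwa [Real.exp_zero, mul_one] at this
      · have h2 := hneg i x hx
        unfold zeroFactor
        rw [if_neg (not_le.mpr h2.1)]
        have h3 : β * 1 + β * ((L : ℝ) * ((n : ℝ) - i)) ≤ -β * (z.re - x) := by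
          rw [← mul_add, neg_mul_comm]
          apply mul_le_mul_of_nonneg_left _ hβ.le
          rw [hz, hR]; linarith [h2.2]
        have h4 : 0 ≤ -β * (z.re - x) := by nlinarith
        refine le_norm_one_sub_exp (hre x (-β)) ?_ hs0 (Or.inl h4)
        rw [abs_of_nonneg h4]; linarith
  have hc0 : 0 < η ^ (2 * N * n) * Real.exp (β * L * N * (n * (n + 1) / 2)) := by positivity
  have hmem : ∀ z : ℂ, |z.re| ≤ R → z ∈ Complex.re ⁻¹' Set.Ioo (-r) r := by
    intro z hz
    have := abs_le.mp hz
    exact ⟨by linarith [this.1], by linarith [this.2]⟩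
  have hhB : ∀ z : ℂ, |z.re| = R →
      ‖h z‖ ≤ B / (η ^ (2 * N * n) * Real.exp (β * L * N * (n * (n + 1) / 2))) := by
    intro z hz
    rw [le_div_iff₀ hc0, mul_comm]
    refine le_trans ?_ (hB z hz)
    rw [hfh z (hmem z hz.le), norm_mul]
    gcongr
    exact hlow z hz
  have hfin := norm_le_of_periodic_strip hτ (by linarith) hr hh hhp hhB (z := (y : ℂ)) (by simpa using hy)
  have hEy : ‖∏ x ∈ (Finset.range n).biUnion Z, zeroFactor β x y‖ ≤
      (1 + Real.exp (β * |y|)) ^ (2 * N * n) := by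
    rw [norm_prod]
    have hcardZ : ((Finset.range n).biUnion Z).card = 2 * N * n := by
      rw [Finset.card_biUnion (fun i hi j hj hij => hZdisj hi hj hij)]
      have : ∀ i ∈ Finset.range n, (Z i).card = 2 * N := by
        intro i _
        simp only [hZ]
        rw [Finset.card_union_of_disjoint (hSdisj _ _ (by omega)), hScard, hScard]
        ring
      rw [Finset.sum_congr rfl this]
      simp
      ring
    rw [← hcardZ, ← Finset.prod_const]
    exact Finset.prod_le_prod (fun _ _ => norm_nonneg _) fun x _ => norm_zeroFactor_le hβ y
  rw [hfh y (hmem y (by simpa using hy)), norm_mul]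
  calc _ ≤ (1 + Real.exp (β * |y|)) ^ (2 * N * n) *
        (B / (η ^ (2 * N * n) * Real.exp (β * L * N * (n * (n + 1) / 2)))) := by
        gcongr
    _ = _ := by
        rw [div_pow, Real.exp_neg]
        field_simp


/-! ### Polynomials in an exponential -/

theorem max_one_exp_pow (d : ℕ) (t : ℝ) : (max 1 (Real.exp t)) ^ d = Real.exp (d * max 0 t) := by
  rw [Real.exp_nat_mul]
  congr 1
  rcases le_total 0 t with h | h
  · rw [max_eq_right h, max_eq_right (Real.one_le_exp h)]
  · rw [max_eq_left h, max_eq_left (Real.exp_le_one_iff.mpr h), Real.exp_zero]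

theorem exists_norm_eval_exp_le (P : ℂ[X]) {d : ℕ} (hd : P.natDegree ≤ d) :
    ∃ K : ℝ, 1 ≤ K ∧ ∀ ξ : ℂ, ‖P.eval (Complex.exp ξ)‖ ≤ K * Real.exp (d * max 0 ξ.re) := by
  refine ⟨1 + ∑ i ∈ Finset.range (P.natDegree + 1), ‖P.coeff i‖,
    by linarith [Finset.sum_nonneg fun i (_ : i ∈ Finset.range (P.natDegree + 1)) =>
      norm_nonneg (P.coeff i)], fun ξ => ?_⟩
  rw [eval_eq_sum_range, ← max_one_exp_pow, ← Complex.norm_exp]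
  refine (norm_sum_le _ _).trans ?_
  rw [add_mul, Finset.sum_mul]
  refine le_trans (Finset.sum_le_sum fun i hi => ?_) (le_add_of_nonneg_left (by positivity))
  rw [norm_mul, norm_pow]
  gcongr
  calc ‖Complex.exp ξ‖ ^ i ≤ (max 1 ‖Complex.exp ξ‖) ^ i := by gcongr; exact le_max_right _ _
    _ ≤ _ := pow_le_pow_right₀ (le_max_left _ _) (by rw [Finset.mem_range] at hi; omega)

theorem eval_exp_eq_reverse (Q : ℂ[X]) (ξ : ℂ) :
    Q.eval (Complex.exp ξ) = Q.reverse.eval (Complex.exp (-ξ)) * Complex.exp ξ ^ Q.natDegree := by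
  let _ : Invertible (Complex.exp ξ) := invertibleOfNonzero (Complex.exp_ne_zero ξ)
  have := eval₂_reverse_mul_pow (RingHom.id ℂ) (Complex.exp ξ) Q
  rw [invOf_eq_inv, ← Complex.exp_neg] at this
  simpa [eval₂_id] using this.symm

/-- As Re ξ → -∞ the value tends to Q(0) ≠ 0. As Re ξ → +∞ the reversed polynomial, evaluated at
exp(-ξ), tends to the leading coefficient of Q. Zeros can occur only in the middle strip. -/
theorem exists_le_norm_eval_exp {Q : ℂ[X]} (hQ : Q ≠ 0) (hQ0 : Q.eval 0 ≠ 0) :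
    ∃ m ρ : ℝ, 0 < m ∧ 0 < ρ ∧ ∀ ξ : ℂ, ρ ≤ |ξ.re| →
      m * Real.exp (Q.natDegree * max 0 ξ.re) ≤ ‖Q.eval (Complex.exp ξ)‖ := by
  have aux : ∀ P : ℂ[X], P.eval 0 ≠ 0 → ∃ m ρ : ℝ, 0 < m ∧ 0 < ρ ∧ ∀ ξ : ℂ, ξ.re ≤ -ρ →
      m ≤ ‖P.eval (Complex.exp ξ)‖ := by
    intro P hP
    have h1 : ∀ᶠ w in 𝓝 (0 : ℂ), ‖P.eval 0‖ / 2 < ‖P.eval w‖ := by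
      have : ContinuousAt (fun w => ‖P.eval w‖) 0 := P.continuous.norm.continuousAt
      exact this.eventually (lt_mem_nhds (half_lt_self (norm_pos_iff.mpr hP)))
    obtain ⟨δ, hδ, h⟩ := Metric.eventually_nhds_iff.mp h1
    refine ⟨‖P.eval 0‖ / 2, max 1 (-Real.log δ + 1), half_pos (norm_pos_iff.mpr hP),
      lt_max_of_lt_left one_pos, fun ξ hξ => (h ?_).le⟩
    rw [dist_zero_right, Complex.norm_exp, ← Real.lt_log_iff_exp_lt hδ]
    linarith [le_max_right 1 (-Real.log δ + 1)]
  obtain ⟨m₁, ρ₁, hm₁, hρ₁, h₁⟩ := aux Q hQ0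
  obtain ⟨m₂, ρ₂, hm₂, hρ₂, h₂⟩ := aux Q.reverse (by
    rw [← coeff_zero_eq_eval_zero, coeff_zero_reverse]
    exact leadingCoeff_ne_zero.mpr hQ)
  refine ⟨min m₁ m₂, max ρ₁ ρ₂, lt_min hm₁ hm₂, lt_max_of_lt_left hρ₁, fun ξ hξ => ?_⟩
  rcases le_total 0 ξ.re with h | h
  · rw [abs_of_nonneg h] at hξ
    rw [eval_exp_eq_reverse, norm_mul, norm_pow, Complex.norm_exp, max_eq_right h,
      ← Real.exp_nat_mul]
    gcongr
    refine (min_le_right _ _).trans (h₂ _ ?_)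
    rw [Complex.neg_re]
    linarith [le_max_right ρ₁ ρ₂]
  · rw [abs_of_nonpos h] at hξ
    rw [max_eq_left h, mul_zero, Real.exp_zero, mul_one]
    refine (min_le_left _ _).trans (h₁ _ ?_)
    linarith [le_max_left ρ₁ ρ₂]

/-- On the real line the middle part is compact and exp x > 0 is never a zero of Q, so the bound
extends to all x. -/
theorem exists_le_norm_eval_exp_real {Q : ℂ[X]} (hQ : ∀ x : ℝ, 0 ≤ x → Q.eval (x : ℂ) ≠ 0) :
    ∃ m : ℝ, 0 < m ∧ ∀ x : ℝ,
      m * Real.exp (Q.natDegree * max 0 x) ≤ ‖Q.eval (Complex.exp (x : ℂ))‖ := by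
  have hQ0 : Q.eval 0 ≠ 0 := by simpa using hQ 0 le_rfl
  have hne : Q ≠ 0 := by rintro rfl; simp at hQ0
  obtain ⟨m, ρ, hm, hρ, h⟩ := exists_le_norm_eval_exp hne hQ0
  have hcont : Continuous fun x : ℝ => ‖Q.eval (Complex.exp (x : ℂ))‖ :=
    (Q.continuous.comp (Complex.continuous_exp.comp Complex.continuous_ofReal)).norm
  obtain ⟨x₀, -, hx₀⟩ := (isCompact_Icc (a := -ρ) (b := ρ)).exists_isMinOn
    ⟨0, by constructor <;> linarith⟩ hcont.continuousOn
  have hpos : 0 < ‖Q.eval (Complex.exp (x₀ : ℂ))‖ := by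
    rw [norm_pos_iff, ← Complex.ofReal_exp]
    exact hQ _ (Real.exp_pos _).le
  refine ⟨min m (‖Q.eval (Complex.exp (x₀ : ℂ))‖ / Real.exp (Q.natDegree * ρ)),
    lt_min hm (by positivity), fun x => ?_⟩
  by_cases hx : ρ ≤ |x|
  · refine le_trans ?_ (h x (by simpa using hx))
    rw [Complex.ofReal_re]
    gcongr
    exact min_le_left _ _
  · push Not at hx
    have hx' := abs_lt.mp hx
    calc _ ≤ (‖Q.eval (Complex.exp (x₀ : ℂ))‖ / Real.exp (Q.natDegree * ρ)) *
          Real.exp (Q.natDegree * ρ) := by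
          gcongr
          · exact min_le_right _ _
          · exact max_le hρ.le hx'.2.le
      _ = ‖Q.eval (Complex.exp (x₀ : ℂ))‖ := by field_simp
      _ ≤ _ := hx₀ ⟨hx'.1.le, hx'.2.le⟩

/-! ### Clearing the poles -/

/-- The exponent in the growth of `poleFactor`. -/
noncomputable def poleExponent (n : ℤ) (x : ℝ) : ℝ :=
  if n ≤ 0 then max 0 (x + n) else max 0 (-(x + n))

theorem poleExponent_nonneg (n : ℤ) (x : ℝ) : 0 ≤ poleExponent n x := by
  unfold poleExponent; split_ifs <;> exact le_max_left _ _

theorem sum_poleExponent_le (I : Finset ℤ) (R : ℕ) {x : ℝ} (hx : |x| = R) :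
    ∑ n ∈ I, poleExponent n x ≤ R * (R + 1) / 2 := by
  classical
  have hsum : ∀ k : ℕ, ∑ j ∈ Finset.range (k + 1), ((k : ℝ) - j) = k * (k + 1) / 2 := by
    intro k
    induction k with
    | zero => simp
    | succ k ih =>
      have : ∑ j ∈ Finset.range (k + 1), (((k + 1 : ℕ) : ℝ) - j) =
          ∑ j ∈ Finset.range (k + 1), (((k : ℝ) - j) + 1) :=
        Finset.sum_congr rfl fun j _ => by push_cast; ring
      rw [Finset.sum_range_succ, this, Finset.sum_add_distrib, ih]
      simp
      ring
  -- The function s enumerates the indices that can contribute: 0, -1, …, -R at x = R, and 0, 1, …,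
  -- R at x = -R. The bound is therefore independent of I.
  have main : ∀ s : ℕ → ℤ, Function.Injective s → (∀ n, poleExponent n x ≠ 0 →
      n ∈ (Finset.range (R + 1)).image s) →
      (∀ j ∈ Finset.range (R + 1), poleExponent (s j) x ≤ R - j) →
      ∑ n ∈ I, poleExponent n x ≤ R * (R + 1) / 2 := by
    intro s hs h1 h2
    calc ∑ n ∈ I, poleExponent n x
        ≤ ∑ n ∈ I ∪ (Finset.range (R + 1)).image s, poleExponent n x :=
          Finset.sum_le_sum_of_subset_of_nonneg Finset.subset_union_left
            fun n _ _ => poleExponent_nonneg n x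
      _ = ∑ n ∈ (Finset.range (R + 1)).image s, poleExponent n x := by
          symm
          apply Finset.sum_subset Finset.subset_union_right
          intro n _ hn
          by_contra h
          exact hn (h1 n h)
      _ = ∑ j ∈ Finset.range (R + 1), poleExponent (s j) x := Finset.sum_image hs.injOn
      _ ≤ ∑ j ∈ Finset.range (R + 1), ((R : ℝ) - j) := Finset.sum_le_sum h2
      _ = _ := hsum R
  have hR0 : (0 : ℝ) ≤ R := Nat.cast_nonneg R
  rcases (abs_eq hR0).mp hx with rfl | rfl
  · refine main (fun j => -(j : ℤ)) (fun a b h => by simpa using h) (fun n hn => ?_) (fun j hj => ?_)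
    · unfold poleExponent at hn
      split_ifs at hn with h
      · have h3 : (0 : ℝ) < R + n := by
          by_contra h4
          exact hn (max_eq_left (not_lt.mp h4))
        have h4 : (0 : ℤ) < R + n := by exact_mod_cast h3
        rw [Finset.mem_image]
        exact ⟨n.natAbs, by rw [Finset.mem_range]; omega, by omega⟩
      · exfalso
        apply hn
        have : (0 : ℝ) < n := by exact_mod_cast (not_le.mp h)
        exact max_eq_left (by linarith)
    · have hj' : (j : ℝ) ≤ R := by exact_mod_cast Nat.lt_succ_iff.mp (Finset.mem_range.mp hj)
      unfold poleExponent
      rw [if_pos (by omega)]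
      push_cast
      exact max_le (by linarith) (by linarith)
  · refine main (fun j => (j : ℤ)) (fun a b h => by simpa using h) (fun n hn => ?_) (fun j hj => ?_)
    · unfold poleExponent at hn
      split_ifs at hn with h
      · exfalso
        apply hn
        have : (n : ℝ) ≤ 0 := by exact_mod_cast h
        exact max_eq_left (by linarith)
      · have h3 : (0 : ℝ) < R - n := by
          by_contra h4
          exact hn (max_eq_left (by linarith))
        have h4 : (0 : ℤ) < R - n := by exact_mod_cast h3
        rw [Finset.mem_image]
        exact ⟨n.natAbs, by rw [Finset.mem_range]; omega, by omega⟩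
    · have hj' : (j : ℝ) ≤ R := by exact_mod_cast Nat.lt_succ_iff.mp (Finset.mem_range.mp hj)
      unfold poleExponent
      split_ifs with h
      · exact max_le (by linarith) (by push_cast; linarith)
      · push_cast
        exact max_le (by linarith) (by linarith)

/-- Normalizing factor: `1` for `n ≤ 0` and `exp(-qα(z + n))` for `n > 0`. -/
noncomputable def poleNormalizer (α : ℝ) (q : ℕ) (n : ℤ) (z : ℂ) : ℂ :=
  if n ≤ 0 then 1 else Complex.exp (-(α * (z + n))) ^ q

theorem poleNormalizer_differentiable (α : ℝ) (q : ℕ) (n : ℤ) :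
    Differentiable ℂ (poleNormalizer α q n) := by
  unfold poleNormalizer; split_ifs <;> fun_prop

/-- For n > 0 this is max(0, t) - t = max(0, -t): the normalizer moves the growth from the right
side to the left, away from the origin in both cases. -/
theorem exp_mul_norm_poleNormalizer {α : ℝ} (hα : 0 < α) (q : ℕ) (n : ℤ) (z : ℂ) :
    Real.exp (q * max 0 (α * (z.re + n))) * ‖poleNormalizer α q n z‖ =
      Real.exp (q * α * poleExponent n z.re) := by
  unfold poleNormalizer poleExponent
  split_ifs
  · rw [norm_one, mul_one, mul_assoc, mul_max_of_nonneg _ _ hα.le, mul_zero]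
  · rw [norm_pow, Complex.norm_exp, ← Real.exp_nat_mul, ← Real.exp_add]
    congr 1
    rw [mul_assoc, mul_max_of_nonneg _ _ hα.le, mul_zero, ← mul_add]
    congr 1
    have : (-(↑α * (z + ↑n)) : ℂ).re = -(α * (z.re + n)) := by simp
    rw [this]
    rcases le_total 0 (α * (z.re + n)) with h | h
    · rw [max_eq_right h, max_eq_left (by linarith)]; ring
    · rw [max_eq_left h, max_eq_right (by linarith)]; ring

/-- The normalized denominator of the `n`-th translate. -/
noncomputable def poleFactor (α : ℝ) (Q : ℂ[X]) (n : ℤ) (z : ℂ) : ℂ :=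
  Q.eval (Complex.exp (α * (z + n))) * poleNormalizer α Q.natDegree n z

theorem poleFactor_differentiable (α : ℝ) (Q : ℂ[X]) (n : ℤ) :
    Differentiable ℂ (poleFactor α Q n) := by
  unfold poleFactor
  refine Differentiable.mul ?_ (poleNormalizer_differentiable _ _ _)
  exact Q.differentiable.comp (by fun_prop)

theorem exp_add_period {α : ℝ} (hα : 0 < α) (z : ℂ) (n : ℤ) :
    Complex.exp (α * (z + ((2 * Real.pi / α : ℝ) : ℂ) * Complex.I + n)) =
      Complex.exp (α * (z + n)) := by
  have hα' : (α : ℂ) ≠ 0 := by exact_mod_cast hα.ne'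
  rw [← Complex.exp_periodic (α * (z + n))]
  congr 1
  push_cast
  field_simp
  ring

theorem poleNormalizer_add_period {α : ℝ} (hα : 0 < α) (q : ℕ) (n : ℤ) (z : ℂ) :
    poleNormalizer α q n (z + ((2 * Real.pi / α : ℝ) : ℂ) * Complex.I) = poleNormalizer α q n z := by
  unfold poleNormalizer
  rw [Complex.exp_neg, Complex.exp_neg, exp_add_period hα]

theorem poleFactor_add_period {α : ℝ} (hα : 0 < α) (Q : ℂ[X]) (n : ℤ) (z : ℂ) :
    poleFactor α Q n (z + ((2 * Real.pi / α : ℝ) : ℂ) * Complex.I) = poleFactor α Q n z := by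
  unfold poleFactor
  rw [poleNormalizer_add_period hα, exp_add_period hα]


/-! ### Counting zeros of series of translates -/

/-- Entire periodic numerators `p k` such that `p k z / Q(exp(α(z + k)))` decays exponentially
in `Re z + k` and grows at most like `exp(E (Re z)² / 2)`. -/
structure NumeratorBound (α K E : ℝ) (q : ℕ) (p : ℤ → ℂ → ℂ) : Prop where
  differentiable : ∀ k, Differentiable ℂ (p k)
  periodic : ∀ k z, p k (z + ((2 * Real.pi / α : ℝ) : ℂ) * Complex.I) = p k z
  bound : ∀ k z, ‖p k z‖ ≤
    K * Real.exp (E * z.re ^ 2 / 2 + (q * max 0 (α * (z.re + k)) - α * |z.re + k|))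

/-- The term `p k z / Q(exp(α(z + k)))`. -/
noncomputable def ratTerm (α : ℝ) (Q : ℂ[X]) (p : ℤ → ℂ → ℂ) (k : ℤ) (z : ℂ) : ℂ :=
  p k z / Q.eval (Complex.exp (α * (z + k)))

/-- The part of the series whose poles are far away. -/
noncomputable def tailTerm (α : ℝ) (Q : ℂ[X]) (p : ℤ → ℂ → ℂ) (c : ℤ → ℂ) (M : ℕ) (k : ℤ)
    (z : ℂ) : ℂ :=
  if k ∈ Finset.Icc (-(M : ℤ)) M then 0 else c k * ratTerm α Q p k z

/-- The product of the pole factors with index at most `M`. -/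
noncomputable def poleProd (α : ℝ) (Q : ℂ[X]) (M : ℕ) (z : ℂ) : ℂ :=
  ∏ n ∈ Finset.Icc (-(M : ℤ)) M, poleFactor α Q n z

/-- The series `∑ c k * ratTerm k` multiplied by `poleProd`, with the cancellations carried out. -/
noncomputable def clearedSum (α : ℝ) (Q : ℂ[X]) (p : ℤ → ℂ → ℂ) (c : ℤ → ℂ) (M : ℕ) (z : ℂ) : ℂ :=
  ∑ k ∈ Finset.Icc (-(M : ℤ)) M, c k * (p k z * poleNormalizer α Q.natDegree k z) *
      ∏ n ∈ (Finset.Icc (-(M : ℤ)) M).erase k, poleFactor α Q n z +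
    poleProd α Q M z * ∑' k, tailTerm α Q p c M k z

section

variable {α K E m ρ K₀ : ℝ} {Q : ℂ[X]} {p : ℤ → ℂ → ℂ} {c : ℤ → ℂ}

theorem abs_of_notMem_Icc {M : ℕ} {k : ℤ} (hk : k ∉ Finset.Icc (-(M : ℤ)) M) :
    (M : ℝ) + 1 ≤ |(k : ℝ)| := by
  have : (M : ℤ) + 1 ≤ |k| := by
    rw [Finset.mem_Icc] at hk
    by_contra h
    apply hk
    exact abs_le.mp (by omega)
  exact_mod_cast this

theorem le_abs_of_far {r : ℝ} {M : ℕ} (hα : 0 < α) (hM : r + ρ / α ≤ (M : ℝ) + 1) {k : ℤ}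
    (hk : k ∉ Finset.Icc (-(M : ℤ)) M) {z : ℂ} (hz : |z.re| ≤ r) :
    ρ ≤ |(α * (z + k) : ℂ).re| := by
  have h1 := abs_of_notMem_Icc hk
  have h2 : |(k : ℝ)| ≤ |z.re + k| + |z.re| := by
    calc |(k : ℝ)| = |(z.re + k) - z.re| := by ring_nf
      _ ≤ _ := abs_sub _ _
  have h3 : (α * (z + k) : ℂ).re = α * (z.re + k) := by simp
  rw [h3, abs_mul, abs_of_pos hα, ← div_le_iff₀' hα]
  linarith

/-- For |k| > M the denominator stays in the region where Q(exp ξ) is bounded below, so these terms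
have no poles in the strip. The decay exp(-α|k|) absorbs the linear growth of c. -/
theorem norm_tailTerm_le (hα : 0 < α) (hE : 0 ≤ E) (hm : 0 < m)
    (hQ : ∀ ξ : ℂ, ρ ≤ |ξ.re| →
      m * Real.exp (Q.natDegree * max 0 ξ.re) ≤ ‖Q.eval (Complex.exp ξ)‖)
    (hp : NumeratorBound α K E Q.natDegree p) (hc : ∀ k, ‖c k‖ ≤ K₀ * (1 + |(k : ℝ)|))
    {r : ℝ} {M : ℕ} (hM : r + ρ / α ≤ (M : ℝ) + 1) {z : ℂ} (hz : |z.re| ≤ r) (k : ℤ) :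
    ‖tailTerm α Q p c M k z‖ ≤ K₀ * (K / m) * Real.exp (E * r ^ 2 / 2 + α * r) *
      ((1 + |(k : ℝ)|) * Real.exp (-α * |(k : ℝ)|)) := by
  have hK₀ : 0 ≤ K₀ := by simpa using (norm_nonneg _).trans (hc 0)
  have hK : 0 ≤ K := by
    have h1 := (norm_nonneg _).trans (hp.bound 0 0)
    exact nonneg_of_mul_nonneg_left h1 (Real.exp_pos _)
  unfold tailTerm
  split_ifs with hk
  · rw [norm_zero]; positivity
  have h3 : (α * (z + k) : ℂ).re = α * (z.re + k) := by simp
  have hlow := hQ (α * (z + k)) (le_abs_of_far hα hM hk hz)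
  rw [h3] at hlow
  have hden : 0 < m * Real.exp (Q.natDegree * max 0 (α * (z.re + k))) := by positivity
  have hrat : ‖ratTerm α Q p k z‖ ≤
      K / m * (Real.exp (E * z.re ^ 2 / 2) * Real.exp (-α * |z.re + k|)) := by
    unfold ratTerm
    rw [norm_div]
    calc _ ≤ K * Real.exp (E * z.re ^ 2 / 2 +
          (Q.natDegree * max 0 (α * (z.re + k)) - α * |z.re + k|)) /
          (m * Real.exp (Q.natDegree * max 0 (α * (z.re + k)))) :=
          div_le_div₀ (by positivity) (hp.bound k z) hden hlow
      _ = _ := by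
          rw [← Real.exp_add, mul_div_mul_comm, ← Real.exp_sub]
          congr 2; ring
  rw [norm_mul]
  calc ‖c k‖ * ‖ratTerm α Q p k z‖ ≤ K₀ * (1 + |(k : ℝ)|) *
        (K / m * (Real.exp (E * z.re ^ 2 / 2) * Real.exp (-α * |z.re + k|))) :=
        mul_le_mul (hc k) hrat (norm_nonneg _) (by positivity)
    _ ≤ K₀ * (1 + |(k : ℝ)|) *
        (K / m * (Real.exp (E * r ^ 2 / 2) * (Real.exp (α * r) * Real.exp (-α * |(k : ℝ)|)))) := by
        gcongr ?_ * (?_ * (Real.exp (E * ?_ / 2) * ?_))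
        · rw [← sq_abs]; gcongr
        · exact exp_neg_abs_add_le hα hz k
    _ = _ := by rw [Real.exp_add]; ring

/-- At a pole the terms on the right take the default value of division by zero, so the identity is
asserted off the poles only; `clearedSum` is the holomorphic extension. -/
theorem clearedSum_eq (hα : 0 < α) (hE : 0 ≤ E) (hm : 0 < m)
    (hQ : ∀ ξ : ℂ, ρ ≤ |ξ.re| →
      m * Real.exp (Q.natDegree * max 0 ξ.re) ≤ ‖Q.eval (Complex.exp ξ)‖)
    (hp : NumeratorBound α K E Q.natDegree p) (hc : ∀ k, ‖c k‖ ≤ K₀ * (1 + |(k : ℝ)|))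
    {r : ℝ} {M : ℕ} (hM : r + ρ / α ≤ (M : ℝ) + 1) {z : ℂ} (hz : |z.re| ≤ r)
    (hreg : ∀ k : ℤ, Q.eval (Complex.exp (α * (z + k))) ≠ 0) :
    clearedSum α Q p c M z = poleProd α Q M z * ∑' k, c k * ratTerm α Q p k z := by
  classical
  have hsum : Summable fun k => tailTerm α Q p c M k z :=
    Summable.of_norm_bounded ((summable_one_add_abs_mul_exp hα).mul_left _)
      (norm_tailTerm_le hα hE hm hQ hp hc hM hz)
  have hfin : HasSum (fun k : ℤ => if k ∈ Finset.Icc (-(M : ℤ)) M then c k * ratTerm α Q p k z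
      else 0) (∑ k ∈ Finset.Icc (-(M : ℤ)) M, c k * ratTerm α Q p k z) := by
    have h1 : HasSum (fun k : ℤ => if k ∈ Finset.Icc (-(M : ℤ)) M then c k * ratTerm α Q p k z
        else 0) (∑ k ∈ Finset.Icc (-(M : ℤ)) M,
          if k ∈ Finset.Icc (-(M : ℤ)) M then c k * ratTerm α Q p k z else 0) :=
      hasSum_sum_of_ne_finset_zero fun b hb => if_neg hb
    rwa [Finset.sum_congr rfl fun k hk => if_pos hk] at h1
  have htot := hfin.add hsum.hasSum
  have heq : (fun k : ℤ => (if k ∈ Finset.Icc (-(M : ℤ)) M then c k * ratTerm α Q p k z else 0) +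
      tailTerm α Q p c M k z) = fun k => c k * ratTerm α Q p k z := by
    ext k
    unfold tailTerm
    split_ifs <;> simp
  rw [heq] at htot
  rw [htot.tsum_eq, mul_add, clearedSum, Finset.mul_sum]
  congr 1
  refine Finset.sum_congr rfl fun k hk => ?_
  rw [poleProd, ← Finset.mul_prod_erase _ _ hk, ratTerm]
  conv_rhs => rw [poleFactor]
  have := hreg k
  field_simp

theorem clearedSum_differentiableOn (hα : 0 < α) (hE : 0 ≤ E) (hm : 0 < m)
    (hQ : ∀ ξ : ℂ, ρ ≤ |ξ.re| →
      m * Real.exp (Q.natDegree * max 0 ξ.re) ≤ ‖Q.eval (Complex.exp ξ)‖)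
    (hp : NumeratorBound α K E Q.natDegree p) (hc : ∀ k, ‖c k‖ ≤ K₀ * (1 + |(k : ℝ)|))
    {r : ℝ} {M : ℕ} (hM : r + ρ / α ≤ (M : ℝ) + 1) :
    DifferentiableOn ℂ (clearedSum α Q p c M) (Complex.re ⁻¹' Set.Ioo (-r) r) := by
  have hprod : ∀ I : Finset ℤ, Differentiable ℂ fun z => ∏ n ∈ I, poleFactor α Q n z := fun I =>
    Differentiable.fun_finsetProd fun n _ => poleFactor_differentiable α Q n
  unfold clearedSum
  refine DifferentiableOn.add (Differentiable.differentiableOn ?_)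
    (DifferentiableOn.mul (hprod _).differentiableOn ?_)
  · refine Differentiable.fun_sum fun k _ => ?_
    exact (((hp.differentiable k).mul (poleNormalizer_differentiable _ _ _)).const_mul _).mul
      (hprod _)
  · refine Complex.differentiableOn_tsum_of_summable_norm
      ((summable_one_add_abs_mul_exp hα).mul_left _) (fun k => ?_)
      (isOpen_Ioo.preimage Complex.continuous_re)
      (fun k z hz => norm_tailTerm_le hα hE hm hQ hp hc hM (abs_le.mpr ⟨hz.1.le, hz.2.le⟩) k)
    unfold tailTerm
    split_ifs with hk
    · exact differentiableOn_const _
    · intro z hz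
      refine DifferentiableAt.differentiableWithinAt ?_
      have h1 := hQ (α * (z + k)) (le_abs_of_far hα hM hk (abs_le.mpr ⟨hz.1.le, hz.2.le⟩))
      have h2 : Q.eval (Complex.exp (α * (z + k))) ≠ 0 := by
        rw [← norm_pos_iff]
        exact lt_of_lt_of_le (by positivity) h1
      unfold ratTerm
      refine ((hp.differentiable k z).div ?_ h2).const_mul _
      have h3 : Differentiable ℂ fun z : ℂ => Complex.exp (α * (z + k)) := by fun_prop
      exact Q.differentiable.differentiableAt.comp z (h3 z)

theorem clearedSum_add_period (hα : 0 < α) {q : ℕ} (hp : NumeratorBound α K E q p)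
    (M : ℕ) (z : ℂ) :
    clearedSum α Q p c M (z + ((2 * Real.pi / α : ℝ) : ℂ) * Complex.I) = clearedSum α Q p c M z := by
  unfold clearedSum poleProd tailTerm ratTerm
  simp_rw [poleFactor_add_period hα, poleNormalizer_add_period hα, exp_add_period hα, hp.periodic]

theorem norm_poleFactor_le (hα : 0 < α) {K₁ : ℝ} (hQ : ∀ ξ : ℂ, ‖Q.eval (Complex.exp ξ)‖ ≤
      K₁ * Real.exp (Q.natDegree * max 0 ξ.re)) (n : ℤ) (z : ℂ) :
    ‖poleFactor α Q n z‖ ≤ K₁ * Real.exp (Q.natDegree * α * poleExponent n z.re) := by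
  unfold poleFactor
  rw [← exp_mul_norm_poleNormalizer hα, norm_mul, ← mul_assoc]
  gcongr
  simpa using hQ (α * (z + n))

theorem norm_prod_poleFactor_le (hα : 0 < α) {K₁ : ℝ} (hQ : ∀ ξ : ℂ, ‖Q.eval (Complex.exp ξ)‖ ≤
      K₁ * Real.exp (Q.natDegree * max 0 ξ.re)) (I : Finset ℤ) (z : ℂ) :
    ‖∏ n ∈ I, poleFactor α Q n z‖ ≤
      K₁ ^ I.card * Real.exp (Q.natDegree * α * ∑ n ∈ I, poleExponent n z.re) := by
  rw [norm_prod, Finset.mul_sum, Real.exp_sum, ← Finset.prod_const, ← Finset.prod_mul_distrib]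
  exact Finset.prod_le_prod (fun _ _ => norm_nonneg _) fun n _ => norm_poleFactor_le hα hQ n z

/-- Needed to return from `clearedSum` to the series on the real line; it costs only a factor
exponential in M. -/
theorem le_norm_poleProd (hα : 0 < α) {m₁ : ℝ} (hm₁ : 0 < m₁) (hQ : ∀ x : ℝ,
      m₁ * Real.exp (Q.natDegree * max 0 x) ≤ ‖Q.eval (Complex.exp (x : ℂ))‖) (M : ℕ) (y : ℝ) :
    m₁ ^ (2 * M + 1) ≤ ‖poleProd α Q M y‖ := by
  have hcard : (Finset.Icc (-(M : ℤ)) M).card = 2 * M + 1 := by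
    rw [Int.card_Icc]; omega
  rw [poleProd, norm_prod, ← hcard, ← Finset.prod_const]
  refine Finset.prod_le_prod (fun _ _ => hm₁.le) fun n _ => ?_
  unfold poleFactor
  rw [norm_mul]
  have h1 := hQ (α * (y + n))
  push_cast at h1
  have h2 := exp_mul_norm_poleNormalizer hα Q.natDegree n y
  rw [Complex.ofReal_re] at h2
  calc m₁ ≤ m₁ * Real.exp (Q.natDegree * α * poleExponent n y) := by
        have : 1 ≤ Real.exp (Q.natDegree * α * poleExponent n y) :=
          Real.one_le_exp (by have := poleExponent_nonneg n y; positivity)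
        nlinarith
    _ = m₁ * Real.exp (Q.natDegree * max 0 (α * (y + n))) * ‖poleNormalizer α Q.natDegree n y‖ := by
        rw [← h2]; ring
    _ ≤ _ := by gcongr

/-- Each numerator grows no faster than the denominator factor it replaces, so every summand obeys
the bound of the full product. The quadratic part of the exponent does not involve M. -/
theorem norm_clearedSum_le (hα : 0 < α) (hE : 0 ≤ E) (hm : 0 < m)
    (hQ : ∀ ξ : ℂ, ρ ≤ |ξ.re| →
      m * Real.exp (Q.natDegree * max 0 ξ.re) ≤ ‖Q.eval (Complex.exp ξ)‖)
    {K₁ : ℝ} (hK₁ : 1 ≤ K₁) (hQ₁ : ∀ ξ : ℂ, ‖Q.eval (Complex.exp ξ)‖ ≤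
      K₁ * Real.exp (Q.natDegree * max 0 ξ.re))
    (hp : NumeratorBound α K E Q.natDegree p) (hc : ∀ k, ‖c k‖ ≤ K₀ * (1 + |(k : ℝ)|))
    {R M : ℕ} (hM : R + ρ / α ≤ (M : ℝ) + 1) {z : ℂ} (hz : |z.re| = R) :
    ‖clearedSum α Q p c M z‖ ≤ K₁ ^ (2 * M + 1) *
      Real.exp (E * R ^ 2 / 2 + Q.natDegree * α * (R * (R + 1) / 2)) *
      ((2 * M + 1) * (1 + M) * (K₀ * K) + K₀ * (K / m) * Real.exp (α * R) *
        ∑' k : ℤ, (1 + |(k : ℝ)|) * Real.exp (-α * |(k : ℝ)|)) := by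
  classical
  have hK₀ : 0 ≤ K₀ := by simpa using (norm_nonneg _).trans (hc 0)
  have hK : 0 ≤ K := by
    have h1 := (norm_nonneg _).trans (hp.bound 0 0)
    exact nonneg_of_mul_nonneg_left h1 (Real.exp_pos _)
  have hcard : (Finset.Icc (-(M : ℤ)) M).card = 2 * M + 1 := by
    rw [Int.card_Icc]; omega
  have hσ := sum_poleExponent_le (Finset.Icc (-(M : ℤ)) M) R hz
  have hxsq : z.re ^ 2 = (R : ℝ) ^ 2 := by rw [← sq_abs, hz]
  set σ := ∑ n ∈ Finset.Icc (-(M : ℤ)) M, poleExponent n z.re with hσdef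
  have hexpσ : Real.exp (Q.natDegree * α * σ) ≤ Real.exp (Q.natDegree * α * (R * (R + 1) / 2)) := by
    gcongr
  have hB : ‖poleProd α Q M z‖ ≤ K₁ ^ (2 * M + 1) * Real.exp (Q.natDegree * α * (R * (R + 1) / 2)) := by
    have := norm_prod_poleFactor_le hα hQ₁ (Finset.Icc (-(M : ℤ)) M) z
    rw [hcard] at this
    exact this.trans (by gcongr)
  have hterm : ∀ k ∈ Finset.Icc (-(M : ℤ)) M,
      ‖c k * (p k z * poleNormalizer α Q.natDegree k z) *
        ∏ n ∈ (Finset.Icc (-(M : ℤ)) M).erase k, poleFactor α Q n z‖ ≤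
      K₁ ^ (2 * M + 1) * Real.exp (E * R ^ 2 / 2 + Q.natDegree * α * (R * (R + 1) / 2)) *
        ((1 + M) * (K₀ * K)) := by
    intro k hk
    have hck : ‖c k‖ ≤ K₀ * (1 + M) := by
      refine (hc k).trans ?_
      gcongr
      rw [Finset.mem_Icc] at hk
      have : |k| ≤ M := abs_le.mpr hk
      exact_mod_cast this
    have hnum : ‖p k z * poleNormalizer α Q.natDegree k z‖ ≤
        K * Real.exp (E * R ^ 2 / 2) * Real.exp (Q.natDegree * α * poleExponent k z.re) := by
      rw [norm_mul, ← exp_mul_norm_poleNormalizer hα, ← mul_assoc]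
      gcongr
      refine (hp.bound k z).trans ?_
      rw [mul_assoc, ← Real.exp_add, hxsq]
      gcongr
      have := mul_nonneg hα.le (abs_nonneg (z.re + k))
      linarith
    have hpr := norm_prod_poleFactor_le hα hQ₁ ((Finset.Icc (-(M : ℤ)) M).erase k) z
    have hsplit : poleExponent k z.re +
        ∑ n ∈ (Finset.Icc (-(M : ℤ)) M).erase k, poleExponent n z.re = σ :=
      Finset.add_sum_erase _ (fun n => poleExponent n z.re) hk
    have hpow : K₁ ^ ((Finset.Icc (-(M : ℤ)) M).erase k).card ≤ K₁ ^ (2 * M + 1) :=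
      pow_le_pow_right₀ hK₁ (by rw [← hcard]; exact Finset.card_erase_le)
    rw [norm_mul, norm_mul]
    calc _ ≤ (K₀ * (1 + M)) * (K * Real.exp (E * R ^ 2 / 2) *
          Real.exp (Q.natDegree * α * poleExponent k z.re)) *
          (K₁ ^ (2 * M + 1) * Real.exp (Q.natDegree * α *
            ∑ n ∈ (Finset.Icc (-(M : ℤ)) M).erase k, poleExponent n z.re)) := by
          gcongr
          exact hpr.trans (by gcongr)
      _ = K₁ ^ (2 * M + 1) * (Real.exp (E * R ^ 2 / 2) * Real.exp (Q.natDegree * α * σ)) *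
          ((1 + M) * (K₀ * K)) := by
          rw [← hsplit, mul_add (_ * α), Real.exp_add]; ring
      _ ≤ _ := by
          rw [Real.exp_add]
          gcongr
  have htail : ‖∑' k, tailTerm α Q p c M k z‖ ≤
      K₀ * (K / m) * Real.exp (E * R ^ 2 / 2 + α * R) *
        ∑' k : ℤ, (1 + |(k : ℝ)|) * Real.exp (-α * |(k : ℝ)|) := by
    rw [← tsum_mul_left]
    exact tsum_of_norm_bounded ((summable_one_add_abs_mul_exp hα).mul_left _).hasSum
      (norm_tailTerm_le hα hE hm hQ hp hc hM hz.le)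
  unfold clearedSum
  refine (norm_add_le _ _).trans ?_
  rw [mul_add]
  apply add_le_add
  · refine (norm_sum_le _ _).trans ((Finset.sum_le_sum hterm).trans (le_of_eq ?_))
    rw [Finset.sum_const, hcard, nsmul_eq_mul]
    push_cast
    ring
  · rw [norm_mul]
    refine (mul_le_mul hB htail (norm_nonneg _) (by positivity)).trans (le_of_eq ?_)
    rw [Real.exp_add, Real.exp_add]
    ring

end

theorem tendsto_exp_quadratic {a b d C : ℝ} (ha : a < 0) :
    Tendsto (fun n : ℕ => C * Real.exp (a * (n : ℝ) ^ 2 + b * n + d)) atTop (𝓝 0) := by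
  have h1 : Tendsto (fun n : ℕ => (n : ℝ)) atTop atTop := tendsto_natCast_atTop_atTop
  have h2 : Tendsto (fun n : ℕ => (n : ℝ) * (a * n + b) + d) atTop atBot := by
    apply tendsto_atBot_add_const_right
    apply h1.atTop_mul_atBot₀
    apply tendsto_atBot_add_const_right
    exact h1.const_mul_atTop_of_neg ha
  have h3 := (Real.tendsto_exp_atBot.comp h2).const_mul C
  rw [mul_zero] at h3
  refine h3.congr fun n => ?_
  simp only [Function.comp]
  ring_nf

/-- A series of translates with too many real zeros vanishes on the real line. -/
theorem tsum_ratTerm_eq_zero {α K E K₀ : ℝ} {Q : ℂ[X]} {p : ℤ → ℂ → ℂ} {c : ℤ → ℂ} (hα : 0 < α)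
    (hE : 0 ≤ E) (hQ : ∀ x : ℝ, 0 ≤ x → Q.eval (x : ℂ) ≠ 0)
    (hp : NumeratorBound α K E Q.natDegree p) (hc : ∀ k, ‖c k‖ ≤ K₀ * (1 + |(k : ℝ)|))
    {κ L N : ℕ} (hκ : 0 < κ) (hL : 0 < L) (hN : (Q.natDegree * α + E) * L < κ * α * N)
    {S : ℤ → Finset ℝ} (hScard : ∀ m, (S m).card = N)
    (hS : ∀ m, ∀ x ∈ S m, (m : ℝ) * L ≤ x ∧ x ≤ m * L + (L - 1))
    (hzero : ∀ m, ∀ x ∈ S m, ∀ j : ℤ,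
      (∀ k : ℤ, Q.eval (Complex.exp (α * (x + 2 * Real.pi * Complex.I * j / (κ * α : ℝ) + k))) ≠ 0) ∧
      ∑' k, c k * ratTerm α Q p k (x + 2 * Real.pi * Complex.I * j / (κ * α : ℝ)) = 0)
    (y : ℝ) : ∑' k, c k * ratTerm α Q p k y = 0 := by
  have hQ0 : Q.eval 0 ≠ 0 := by simpa using hQ 0 le_rfl
  have hne : Q ≠ 0 := by rintro rfl; simp at hQ0
  obtain ⟨m, ρ, hm, hρ, hQm⟩ := exists_le_norm_eval_exp hne hQ0
  obtain ⟨m₁, hm₁, hQm₁⟩ := exists_le_norm_eval_exp_real hQ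
  obtain ⟨K₁, hK₁, hQK₁⟩ := exists_norm_eval_exp_le Q le_rfl
  have hK₀ : 0 ≤ K₀ := by simpa using (norm_nonneg _).trans (hc 0)
  have hK : 0 ≤ K := by
    have h1 := (norm_nonneg _).trans (hp.bound 0 0)
    exact nonneg_of_mul_nonneg_left h1 (Real.exp_pos _)
  have hκ' : (0 : ℝ) < κ := by exact_mod_cast hκ
  set β : ℝ := κ * α with hβdef
  have hβ : 0 < β := by positivity
  set τ : ℝ := 2 * Real.pi / α with hτdef
  have hτ : 0 < τ := by have := Real.pi_pos; positivity
  have hα' : (α : ℂ) ≠ 0 := by exact_mod_cast hα.ne'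
  have hβτ : Complex.exp (β * (τ * Complex.I)) = 1 := by
    rw [show (β : ℂ) * (τ * Complex.I) = κ * (2 * Real.pi * Complex.I) by
      rw [hβdef, hτdef]; push_cast; field_simp]
    exact Complex.exp_nat_mul_two_pi_mul_I κ
  set Sg : ℝ := ∑' k : ℤ, (1 + |(k : ℝ)|) * Real.exp (-α * |(k : ℝ)|) with hSg
  have hSg0 : 0 ≤ Sg := tsum_nonneg fun k => by positivity
  -- With M = R + M₁ the uncleared terms are pole-free in the slightly wider strip |Re z| < R + 1.
  set M₁ : ℕ := ⌈ρ / α⌉₊ + 2 with hM₁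
  set X : ℝ := (1 + Real.exp (β * |y|)) / (1 - Real.exp (-β)) with hX
  have hX0 : 0 < X := by
    have : Real.exp (-β) < 1 := Real.exp_lt_one_iff.mpr (by linarith)
    apply div_pos (by positivity); linarith
  set F : ℂ := ∑' k, c k * ratTerm α Q p k y with hF
  -- The estimate for each `n`.
  have key : ∀ n : ℕ, |y| ≤ ((n : ℝ) + 1) * L + 1 →
      ‖F‖ ≤ (K₀ * K + K₀ * (K / m) * Sg) * Real.exp
        ((3 + α) * ((n + 1) * L + 1 + M₁) + (2 * ((n + 1) * L + 1 + M₁) + 1) * Real.log (K₁ / m₁) +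
          2 * N * n * Real.log X + (E * ((n + 1) * L + 1) ^ 2 / 2 +
            Q.natDegree * α * (((n + 1) * L + 1) * ((n + 1) * L + 1 + 1) / 2)) -
          β * L * N * (n * (n + 1) / 2)) := by
    intro n hy
    set R : ℕ := (n + 1) * L + 1 with hR
    have hRr : (R : ℝ) = ((n : ℝ) + 1) * L + 1 := by rw [hR]; push_cast; ring
    set M : ℕ := R + M₁ with hMdef
    have hMr : (M : ℝ) = R + M₁ := by rw [hMdef]; push_cast; ring
    have hceil : ρ / α + 2 ≤ M₁ := by
      rw [hM₁]; push_cast; linarith [Nat.le_ceil (ρ / α)]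
    have hMr1 : ((R : ℝ) + 1) + ρ / α ≤ (M : ℝ) + 1 := by rw [hMr]; linarith
    have hMr2 : (R : ℝ) + ρ / α ≤ (M : ℝ) + 1 := by linarith
    have hH := clearedSum_differentiableOn hα hE hm hQm hp hc hMr1
    have hBd : ∀ z : ℂ, |z.re| = ((n : ℝ) + 1) * L + 1 → ‖clearedSum α Q p c M z‖ ≤ _ :=
      fun z hz => norm_clearedSum_le hα hE hm hQm hK₁ hQK₁ hp hc hMr2 (hz.trans hRr.symm)
    have hmain := norm_le_of_zeros_in_strip hβ hτ hβτ hL (r := R + 1) (n := n)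
      (by rw [hRr]; linarith) hH (clearedSum_add_period hα hp M) hBd hScard hS
      (fun m' x hx hxr j => by
        obtain ⟨h1, h2⟩ := hzero m' x hx j
        rw [clearedSum_eq hα hE hm hQm hp hc hMr1 _ h1, h2, mul_zero]
        rw [show (x : ℂ) + 2 * Real.pi * Complex.I * j / β =
          (x : ℂ) + ((2 * Real.pi * j / β : ℝ) : ℂ) * Complex.I by push_cast; ring]
        simpa using hxr.le) hy
    have hreg : ∀ k : ℤ, Q.eval (Complex.exp (α * ((y : ℂ) + k))) ≠ 0 := by
      intro k
      have := hQ (Real.exp (α * (y + k))) (Real.exp_pos _).le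
      push_cast at this
      exact this
    rw [clearedSum_eq hα hE hm hQm hp hc hMr1 (by rw [Complex.ofReal_re, hRr]; linarith) hreg,
      norm_mul] at hmain
    have hlow := le_norm_poleProd hα hm₁ hQm₁ M y
    have h3 : m₁ ^ (2 * M + 1) * ‖F‖ ≤ _ :=
      (mul_le_mul_of_nonneg_right hlow (norm_nonneg _)).trans hmain
    -- Everything here is at most exponential in M, hence negligible against exponents quadratic in
    -- n.
    have hbr : (2 * (M : ℝ) + 1) * (1 + M) * (K₀ * K) + K₀ * (K / m) * Real.exp (α * R) * Sg ≤
        (K₀ * K + K₀ * (K / m) * Sg) * Real.exp ((3 + α) * M) := by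
      have e1 : 2 * (M : ℝ) + 1 ≤ Real.exp (2 * M) := Real.add_one_le_exp _
      have e2 : 1 + (M : ℝ) ≤ Real.exp M := by linarith [Real.add_one_le_exp (M : ℝ)]
      have hM0 : (0 : ℝ) ≤ M := Nat.cast_nonneg M
      have e3 : (2 * (M : ℝ) + 1) * (1 + M) ≤ Real.exp ((3 + α) * M) := by
        calc _ ≤ Real.exp (2 * M) * Real.exp M := by gcongr
          _ = Real.exp (3 * M) := by rw [← Real.exp_add]; ring_nf
          _ ≤ _ := by gcongr; linarith
      have e4 : Real.exp (α * R) ≤ Real.exp ((3 + α) * M) := by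
        apply Real.exp_le_exp.mpr
        have : (R : ℝ) ≤ M := by rw [hMr]; linarith [Nat.cast_nonneg (α := ℝ) M₁]
        nlinarith
      calc _ ≤ Real.exp ((3 + α) * M) * (K₀ * K) + K₀ * (K / m) * Real.exp ((3 + α) * M) * Sg := by
            gcongr
        _ = _ := by ring
    have hpowK : (K₁ / m₁) ^ (2 * M + 1) = Real.exp ((2 * M + 1) * Real.log (K₁ / m₁)) := by
      rw [← Real.exp_log (show 0 < K₁ / m₁ by positivity), ← Real.exp_nat_mul, Real.log_exp]
      push_cast; ring_nf
    have hpowX : X ^ (2 * N * n) = Real.exp (2 * N * n * Real.log X) := by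
      conv_lhs => rw [← Real.exp_log hX0, ← Real.exp_nat_mul]
      push_cast; ring_nf
    rw [← le_div_iff₀' (by positivity)] at h3
    refine h3.trans ?_
    calc _ ≤ K₁ ^ (2 * M + 1) *
          Real.exp (E * R ^ 2 / 2 + Q.natDegree * α * (R * (R + 1) / 2)) *
          ((K₀ * K + K₀ * (K / m) * Sg) * Real.exp ((3 + α) * M)) * X ^ (2 * N * n) *
          Real.exp (-(β * L * N * (n * (n + 1) / 2))) / m₁ ^ (2 * M + 1) := by
          gcongr
      _ = (K₀ * K + K₀ * (K / m) * Sg) * (Real.exp ((3 + α) * M) * (K₁ / m₁) ^ (2 * M + 1) *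
          X ^ (2 * N * n) * Real.exp (E * R ^ 2 / 2 + Q.natDegree * α * (R * (R + 1) / 2)) *
          Real.exp (-(β * L * N * (n * (n + 1) / 2)))) := by
          rw [div_pow K₁ m₁]; field_simp
      _ = _ := by
          rw [hpowK, hpowX, ← Real.exp_add, ← Real.exp_add, ← Real.exp_add, ← Real.exp_add, hMr, hRr]
          ring_nf
  set φ : ℝ → ℝ := fun n => (3 + α) * ((n + 1) * L + 1 + M₁) +
    (2 * ((n + 1) * L + 1 + M₁) + 1) * Real.log (K₁ / m₁) +
          2 * N * n * Real.log X + (E * ((n + 1) * L + 1) ^ 2 / 2 +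
            Q.natDegree * α * (((n + 1) * L + 1) * ((n + 1) * L + 1 + 1) / 2)) -
          β * L * N * (n * (n + 1) / 2) with hφ
  -- The exponent is a quadratic polynomial in n, determined by its leading coefficient and its
  -- values at 0 and 1. The density hypothesis `hN` says exactly that the leading coefficient is
  -- negative.
  have hquad : ∀ n : ℝ, φ n = ((Q.natDegree * α + E) * L - κ * α * N) * L / 2 * n ^ 2 +
      (φ 1 - φ 0 - ((Q.natDegree * α + E) * L - κ * α * N) * L / 2) * n + φ 0 := by
    intro n
    simp only [hφ, hβdef]
    ring
  have hL' : (0 : ℝ) < L := by exact_mod_cast hL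
  rw [hβdef] at hN
  have hneg : ((Q.natDegree * α + E) * L - κ * α * N) * L / 2 < 0 := by
    have : ((Q.natDegree * α + E) * L - κ * α * N) * L < 0 :=
      mul_neg_of_neg_of_pos (by linarith) hL'
    linarith
  have hlim := tendsto_exp_quadratic (C := K₀ * K + K₀ * (K / m) * Sg)
    (b := φ 1 - φ 0 - ((Q.natDegree * α + E) * L - κ * α * N) * L / 2) (d := φ 0) hneg
  have hev : ∀ᶠ n : ℕ in atTop, ‖F‖ ≤ (K₀ * K + K₀ * (K / m) * Sg) *
      Real.exp (((Q.natDegree * α + E) * L - κ * α * N) * L / 2 * (n : ℝ) ^ 2 +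
      (φ 1 - φ 0 - ((Q.natDegree * α + E) * L - κ * α * N) * L / 2) * n + φ 0) := by
    filter_upwards [eventually_ge_atTop ⌈|y|⌉₊] with n hn
    rw [← hquad]
    apply key
    have h1 : |y| ≤ n := (Nat.le_ceil _).trans (by exact_mod_cast hn)
    have h2 : (1 : ℝ) ≤ L := by exact_mod_cast hL
    have h3 : (0 : ℝ) ≤ n := Nat.cast_nonneg n
    nlinarith
  have := ge_of_tendsto hlim hev
  exact norm_le_zero_iff.mp this


/-! ### The classes `K(α)` and `C(α)`: sufficiency -/

theorem NumeratorBound.norm_ratTerm_le {α K E m : ℝ} {Q : ℂ[X]} {p : ℤ → ℂ → ℂ} (hm : 0 < m)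
    (hp : NumeratorBound α K E Q.natDegree p)
    (hQ : ∀ x : ℝ, m * Real.exp (Q.natDegree * max 0 x) ≤ ‖Q.eval (Complex.exp (x : ℂ))‖)
    (k : ℤ) (x : ℝ) :
    ‖ratTerm α Q p k x‖ ≤ K / m * Real.exp (E * x ^ 2 / 2 - α * |x + k|) := by
  have hK : 0 ≤ K := by
    have h1 := (norm_nonneg _).trans (hp.bound 0 0)
    exact nonneg_of_mul_nonneg_left h1 (Real.exp_pos _)
  have h1 := hp.bound k x
  rw [Complex.ofReal_re] at h1
  have h2 := hQ (α * (x + k))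
  push_cast at h2
  unfold ratTerm
  rw [norm_div]
  calc _ ≤ K * Real.exp (E * x ^ 2 / 2 +
          (Q.natDegree * max 0 (α * (x + k)) - α * |x + k|)) /
          (m * Real.exp (Q.natDegree * max 0 (α * (x + k)))) :=
          div_le_div₀ (by positivity) h1 (by positivity) h2
    _ = _ := by
          rw [mul_div_mul_comm, ← Real.exp_sub]
          congr 2; ring

namespace ClassK

variable {α : ℝ}

/-- The numerators of the translates. -/
noncomputable def numer (G : ClassK α) (k : ℤ) (z : ℂ) : ℂ := G.P.eval (Complex.exp (α * (z + k)))

/-- P(0) = 0 gives decay of the generator at -∞ and deg P < deg Q gives decay at +∞. With P = X ·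
`divX`, the exponent (q - 2) max(0, t) + t equals q max(0, t) - |t|. -/
theorem numeratorBound (hα : 0 < α) (G : ClassK α) :
    ∃ K, 0 < K ∧ NumeratorBound α K 0 G.Q.natDegree G.numer := by
  have hdeg : G.P.divX.natDegree ≤ G.Q.natDegree - 2 := by
    rw [natDegree_divX_eq_natDegree_tsub_one]
    have := G.deg_lt
    omega
  have hq : 2 ≤ G.Q.natDegree := by
    have := G.deg_lt
    have := G.one_le_deg
    omega
  obtain ⟨K, hK, h⟩ := exists_norm_eval_exp_le G.P.divX hdeg
  have hPX : G.P = G.P.divX * X := by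
    conv_lhs => rw [← divX_mul_X_add G.P, coeff_zero_eq_eval_zero, G.P_zero]
    simp
  refine ⟨K, by linarith, ⟨fun k => ?_, fun k z => ?_, fun k z => ?_⟩⟩
  · exact G.P.differentiable.comp (by fun_prop)
  · rw [numer, numer, exp_add_period hα]
  · have hre : (α * (z + k) : ℂ).re = α * (z.re + k) := by simp
    have h1 := h (α * (z + k))
    rw [numer, hPX, eval_mul, eval_X, norm_mul, Complex.norm_exp, hre]
    rw [hre] at h1
    calc _ ≤ K * Real.exp ((G.Q.natDegree - 2 : ℕ) * max 0 (α * (z.re + k))) *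
          Real.exp (α * (z.re + k)) := by gcongr
      _ = _ := by
          rw [mul_assoc, ← Real.exp_add, Nat.cast_sub hq]
          congr 2
          push_cast
          rw [show α * |z.re + k| = |α * (z.re + k)| by rw [abs_mul, abs_of_pos hα]]
          rcases le_total 0 (α * (z.re + k)) with h | h
          · rw [max_eq_right h, abs_of_nonneg h]; ring
          · rw [max_eq_left h, abs_of_nonpos h]; ring

theorem ratTerm_eq (G : ClassK α) (k : ℤ) (z : ℂ) :
    ratTerm α G.Q G.numer k z = G.toComplexFun (z + k) := rfl

theorem toFun_add_int (G : ClassK α) (x : ℝ) (k : ℤ) :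
    G.toFun (x + k) = ratTerm α G.Q G.numer k x := by
  rw [ratTerm_eq, toFun]; push_cast; rfl

theorem expDecay (hα : 0 < α) (G : ClassK α) : ExpDecay G.toFun := by
  obtain ⟨K, hK, hb⟩ := G.numeratorBound hα
  obtain ⟨m, hm, hQ⟩ := exists_le_norm_eval_exp_real G.Q_nonneg
  refine ⟨?_, K / m, α, by positivity, hα, fun x => ?_⟩
  · refine Continuous.div ?_ ?_ fun x => ?_
    · exact G.P.continuous.comp (by fun_prop)
    · exact G.Q.continuous.comp (by fun_prop)
    · have := G.Q_nonneg (Real.exp (α * x)) (Real.exp_pos _).le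
      push_cast at this
      exact this
  · have := hb.norm_ratTerm_le hm hQ 0 x
    rw [← toFun_add_int] at this
    simpa using this

/-- The symmetry amounts to the polynomial identity P(ζu) Q(u) = c P(u) Q(ζu). At a root w of Q it
leaves P(w) Q(ζw) = 0, and P(w) ≠ 0. -/
theorem eval_Q_mul_root (hα : 0 < α) (G : ClassK α) {k : ℕ} (hk : k ∈ G.symmetryOrders) {w : ℂ}
    (hw : G.Q.eval w = 0) : G.Q.eval (Complex.exp (2 * Real.pi * Complex.I / k) * w) = 0 := by
  obtain ⟨hk0, c, hc⟩ := hk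
  have hαc : (α : ℂ) ≠ 0 := by exact_mod_cast hα.ne'
  have hkc : (k : ℂ) ≠ 0 := by exact_mod_cast hk0.ne'
  set ζ : ℂ := Complex.exp (2 * Real.pi * Complex.I / k) with hζ
  have hζ0 : ζ ≠ 0 := Complex.exp_ne_zero _
  have hshift : ∀ z : ℂ, Complex.exp (α * (z + 2 * Real.pi * Complex.I / (k * α)))
      = ζ * Complex.exp (α * z) := by
    intro z
    rw [hζ, ← Complex.exp_add]
    congr 1
    field_simp
    ring
  set P' := G.P.comp (C ζ * X) with hP'
  set Q' := G.Q.comp (C ζ * X) with hQ'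
  have hscale : ∀ S : ℂ[X], S ≠ 0 → S.comp (C ζ * X) ≠ 0 := by
    intro S hS h
    apply hS
    apply Polynomial.funext
    intro r
    have := congrArg (Polynomial.eval (ζ⁻¹ * r)) h
    simpa [hζ0] using this
  have key : (P' * G.Q - C c * G.P * Q') * (G.Q * Q' * X) = 0 := by
    apply Polynomial.funext
    intro u
    by_cases hu : u = 0
    · simp [hu]
    by_cases h1 : G.Q.eval u = 0
    · simp [h1]
    by_cases h2 : G.Q.eval (ζ * u) = 0
    · simp [hQ', h2]
    have hz : Complex.exp (α * (Complex.log u / α)) = u := by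
      rw [mul_div_cancel₀ _ hαc, Complex.exp_log hu]
    have := hc (Complex.log u / α) (by simpa [Regular, hz] using h1)
      (by unfold Regular; rw [hshift, hz]; exact h2)
    simp only [toComplexFun] at this
    rw [hshift, hz] at this
    field_simp at this
    simp [hP', hQ', this]
    exact Or.inl (by ring)
  have hid : P' * G.Q = C c * G.P * Q' :=
    sub_eq_zero.mp ((mul_eq_zero.mp key).resolve_right
      (mul_ne_zero (mul_ne_zero G.Q_ne_zero (hscale _ G.Q_ne_zero)) X_ne_zero))
  have hc0 : c ≠ 0 := by
    rintro rfl
    have hP0 : P' ≠ 0 := hscale _ G.P_ne_zero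
    simp [hP0, G.Q_ne_zero] at hid
  have := congrArg (Polynomial.eval w) hid
  simp [hQ', hw, hc0] at this
  exact this.resolve_left fun h => G.no_common_zero w ⟨h, hw⟩

theorem exp_shift (hα : 0 < α) {k : ℕ} (hk : 0 < k) (z : ℂ) (n : ℕ) :
    Complex.exp (α * (z + 2 * Real.pi * Complex.I * n / (k * α))) =
      Complex.exp (2 * Real.pi * Complex.I / k) ^ n * Complex.exp (α * z) := by
  have hαc : (α : ℂ) ≠ 0 := by exact_mod_cast hα.ne'
  have hkc : (k : ℂ) ≠ 0 := by exact_mod_cast hk.ne'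
  rw [← Complex.exp_nat_mul, ← Complex.exp_add]
  congr 1
  field_simp
  ring

/-- A pole at the shifted point would propagate under multiplication by ζ and, as ζ^k = 1, return to
exp(αx) > 0, where Q does not vanish. -/
theorem regular_shift (hα : 0 < α) (G : ClassK α) {k : ℕ} (hk : k ∈ G.symmetryOrders) (x : ℝ)
    (n : ℕ) : G.Regular (x + 2 * Real.pi * Complex.I * n / (k * α)) := by
  have hk0 : 0 < k := hk.1
  unfold Regular
  rw [exp_shift hα hk0]
  set ζ : ℂ := Complex.exp (2 * Real.pi * Complex.I / k) with hζ
  have hζk : ζ ^ k = 1 := (Complex.isPrimitiveRoot_exp k hk0.ne').pow_eq_one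
  intro h
  have hall : ∀ j : ℕ, G.Q.eval (ζ ^ j * (ζ ^ n * Complex.exp (α * x))) = 0 := by
    intro j
    induction j with
    | zero => simpa using h
    | succ j ih => rw [pow_succ', mul_assoc]; exact G.eval_Q_mul_root hα hk ih
  have h1 := hall (n * (k - 1))
  rw [← mul_assoc, ← pow_add, show n * (k - 1) + n = k * n by
    obtain ⟨l, rfl⟩ : ∃ l, k = l + 1 := ⟨k - 1, by omega⟩
    simp; ring, pow_mul, hζk, one_pow, one_mul] at h1
  refine G.Q_nonneg (Real.exp (α * x)) (Real.exp_pos _).le ?_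
  push_cast
  exact h1

/-- A real zero of the series thus recurs at all multiples of 2πi/(kα): μ does not depend on x and
factors out of the sum over translates. Reducing j modulo k by the period 2πi/α leaves nonnegative
powers of c. -/
theorem exists_toComplexFun_shift (hα : 0 < α) (G : ClassK α) {k : ℕ} (hk : k ∈ G.symmetryOrders)
    (j : ℤ) : ∃ μ : ℂ, ∀ x : ℝ, G.Regular (x + 2 * Real.pi * Complex.I * j / (k * α)) ∧
      G.toComplexFun (x + 2 * Real.pi * Complex.I * j / (k * α)) = μ * G.toComplexFun x := by
  have hk0 : 0 < k := hk.1
  have hαc : (α : ℂ) ≠ 0 := by exact_mod_cast hα.ne'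
  have hkc : (k : ℂ) ≠ 0 := by exact_mod_cast hk0.ne'
  obtain ⟨-, c, hc⟩ := id hk
  have hnat : ∀ (n : ℕ) (x : ℝ),
      G.toComplexFun (x + 2 * Real.pi * Complex.I * n / (k * α)) = c ^ n * G.toComplexFun x := by
    intro n x
    induction n with
    | zero => simp
    | succ n ih =>
      have h1 : (x : ℂ) + 2 * Real.pi * Complex.I * n / (k * α) + 2 * Real.pi * Complex.I / (k * α) =
          x + 2 * Real.pi * Complex.I * (n + 1 : ℕ) / (k * α) := by
        push_cast; ring
      have h2 := hc _ (G.regular_shift hα hk x n) (by rw [h1]; exact G.regular_shift hα hk x (n + 1))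
      rw [h1, ih] at h2
      rw [h2]; ring
  obtain ⟨n, hn⟩ : ∃ n : ℕ, (n : ℤ) = j % k := ⟨(j % k).toNat, by
    have := Int.emod_nonneg j (show (k : ℤ) ≠ 0 by omega)
    omega⟩
  have hexp : ∀ x : ℝ, Complex.exp (α * (x + 2 * Real.pi * Complex.I * j / (k * α))) =
      Complex.exp (α * (x + 2 * Real.pi * Complex.I * n / (k * α))) := by
    intro x
    rw [Complex.exp_eq_exp_iff_exists_int]
    refine ⟨j / k, ?_⟩
    have h1 : (j : ℂ) = n + k * (j / k : ℤ) := by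
      have : j = n + k * (j / k) := by rw [hn]; exact (Int.emod_add_mul_ediv j k).symm
      exact_mod_cast this
    rw [h1]
    field_simp
    ring
  refine ⟨c ^ n, fun x => ⟨?_, ?_⟩⟩
  · have := G.regular_shift hα hk x n
    unfold Regular at this ⊢
    rwa [hexp]
  · rw [← hnat n x]
    unfold toComplexFun
    rw [hexp]

theorem isGaborFrame (hα : 0 < α) (G : ClassK α) (hV : FourierNonvanishing G.toFun) {Λ : Set ℝ}
    {D : ℝ} (hΛ : IsSeparatedSet Λ) (hD : HasLowerDensity Λ D) (hDq : (G.q : ℝ) / (G.k : ℝ) < D) :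
    IsGaborFrame G.toFun Λ intSet := by
  refine isGaborFrame_of_uniqueness (G.expDecay hα) hV hΛ hD hDq ?_
  intro c K₀ hc L N hL hN hzero x
  choose S hScard hS using hzero
  obtain ⟨K, -, hb⟩ := G.numeratorBound hα
  have hk := (isGreatest_k hα G).1
  have hk0 : (0 : ℝ) < G.k := by exact_mod_cast hk.1
  have hser : ∀ y : ℝ, shiftSum G.toFun c y = ∑' k, c k * ratTerm α G.Q G.numer k y := by
    intro y
    simp_rw [shiftSum, toFun_add_int]
  -- No Gaussian growth (E = 0) and k zeros per period: the threshold is q/k.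
  have := tsum_ratTerm_eq_zero hα le_rfl G.Q_nonneg hb hc (κ := G.k) hk.1 hL (S := S) ?_ hScard
    (fun m x hx => ⟨(hS m x hx).1, (hS m x hx).2.1⟩) ?_ x
  · rw [hser, this]
  · rw [div_mul_eq_mul_div, div_lt_iff₀ hk0] at hN
    rw [add_zero]
    have h1 := mul_lt_mul_of_pos_left hN hα
    unfold q at h1
    linarith
  · intro m x hx j
    obtain ⟨μ, hμ⟩ := G.exists_toComplexFun_shift hα hk j
    have harg : ∀ k : ℤ, (x : ℂ) + 2 * Real.pi * Complex.I * j / ((G.k * α : ℝ) : ℂ) + k =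
        ((x + k : ℝ) : ℂ) + 2 * Real.pi * Complex.I * j / (G.k * α) := by
      intro k; push_cast; ring
    constructor
    · intro k
      rw [harg]
      exact (hμ (x + k)).1
    · have : ∀ k : ℤ, c k * ratTerm α G.Q G.numer k
          (x + 2 * Real.pi * Complex.I * j / ((G.k * α : ℝ) : ℂ)) =
          μ * (c k * ratTerm α G.Q G.numer k x) := by
        intro k
        rw [ratTerm_eq, harg, (hμ (x + k)).2, ratTerm_eq]
        push_cast
        ring
      simp_rw [this]
      rw [tsum_mul_left, ← hser, (hS m x hx).2.2, mul_zero]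

end ClassK

namespace ClassC

variable {α : ℝ}

/-- The numerators of the translates, multiplied by `exp(αz²/2)`. -/
noncomputable def numer (G : ClassC α) (k : ℤ) (z : ℂ) : ℂ :=
  Complex.exp (-(α * z * k + α * k ^ 2 / 2)) * G.P.eval (Complex.exp (α * (z + k)))

/-- Multiplying by exp(αz²/2) leaves exp(-αzk), which has period 2πi/α because k is an integer. The
price is the growth exp(α(Re z)²/2), that is E = α. -/
theorem numeratorBound (hα : 0 < α) (G : ClassC α) :
    ∃ K, 0 < K ∧ NumeratorBound α K α G.Q.natDegree G.numer := by
  obtain ⟨K, hK, h⟩ := exists_norm_eval_exp_le G.P le_rfl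
  set d := G.P.natDegree
  -- The constant completes the square: -α|s|²/2 + (d + 1)α|s| ≤ α(d + 1)²/2.
  refine ⟨K * Real.exp (α * (d + 1) ^ 2 / 2), by positivity,
    ⟨fun k => ?_, fun k z => ?_, fun k z => ?_⟩⟩
  · refine Differentiable.mul (by fun_prop) ?_
    exact G.P.differentiable.comp (by fun_prop)
  · rw [numer, numer, exp_add_period hα]
    congr 1
    rw [Complex.exp_eq_exp_iff_exists_int]
    refine ⟨-k, ?_⟩
    have hαc : (α : ℂ) ≠ 0 := by exact_mod_cast hα.ne'
    push_cast
    field_simp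
    ring
  · have hre : (α * (z + k) : ℂ).re = α * (z.re + k) := by simp
    have hre2 : (-(α * z * k + α * k ^ 2 / 2) : ℂ).re = -(α * z.re * k + α * k ^ 2 / 2) := by
      rw [show (-(α * z * k + α * k ^ 2 / 2) : ℂ) =
        ((-(α * k) : ℝ) : ℂ) * z + ((-(α * k ^ 2 / 2) : ℝ) : ℂ) by push_cast; ring]
      rw [Complex.add_re, Complex.re_ofReal_mul, Complex.ofReal_re]
      ring
    have h1 := h (α * (z + k))
    rw [hre] at h1
    rw [numer, norm_mul, Complex.norm_exp, hre2]
    set s := z.re + k with hs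
    have hmax : max 0 (α * s) ≤ α * |s| := by
      apply max_le (by positivity)
      gcongr
      exact le_abs_self s
    calc _ ≤ Real.exp (-(α * z.re * k + α * k ^ 2 / 2)) * (K * Real.exp (d * max 0 (α * s))) := by
          gcongr
      _ = K * Real.exp (-(α * z.re * k + α * k ^ 2 / 2) + d * max 0 (α * s)) := by
          rw [Real.exp_add]; ring
      _ ≤ K * Real.exp (α * (d + 1) ^ 2 / 2 +
          (α * z.re ^ 2 / 2 + (G.Q.natDegree * max 0 (α * s) - α * |s|))) := by
          refine mul_le_mul_of_nonneg_left (Real.exp_le_exp.mpr ?_) (by linarith)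
          have e1 : -(α * z.re * k + α * k ^ 2 / 2) = α * z.re ^ 2 / 2 - α * |s| ^ 2 / 2 := by
            rw [sq_abs, hs]; ring
          rw [e1]
          have e2 : (d : ℝ) * max 0 (α * s) ≤ d * (α * |s|) := by gcongr
          have e3 : 0 ≤ (G.Q.natDegree : ℝ) * max 0 (α * s) := by positivity
          nlinarith [mul_nonneg hα.le (sq_nonneg (|s| - (d + 1)))]
      _ = _ := by rw [Real.exp_add]; ring

theorem toFun_add_int (G : ClassC α) (x : ℝ) (k : ℤ) :
    G.toFun (x + k) = Complex.exp (-(α * x ^ 2 / 2)) * ratTerm α G.Q G.numer k x := by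
  unfold toFun ratTerm numer
  have e : Complex.exp (-(α * (x + k) ^ 2 / 2)) =
      Complex.exp (-(α * x ^ 2 / 2)) * Complex.exp (-(α * x * k + α * k ^ 2 / 2)) := by
    rw [← Complex.exp_add]
    congr 1
    ring
  push_cast
  rw [e]
  ring

theorem expDecay (hα : 0 < α) (G : ClassC α) : ExpDecay G.toFun := by
  obtain ⟨K, hK, hb⟩ := G.numeratorBound hα
  obtain ⟨m, hm, hQ⟩ := exists_le_norm_eval_exp_real G.Q_nonneg
  refine ⟨?_, K / m, α, by positivity, hα, fun x => ?_⟩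
  · refine Continuous.mul (by fun_prop) (Continuous.div ?_ ?_ fun x => ?_)
    · exact G.P.continuous.comp (by fun_prop)
    · exact G.Q.continuous.comp (by fun_prop)
    · have := G.Q_nonneg (Real.exp (α * x)) (Real.exp_pos _).le
      push_cast at this
      exact this
  · have h1 := hb.norm_ratTerm_le hm hQ 0 x
    have h2 := G.toFun_add_int x 0
    rw [Int.cast_zero, add_zero] at h2
    rw [h2, norm_mul, show (-(α * x ^ 2 / 2) : ℂ) = ((-(α * x ^ 2 / 2) : ℝ) : ℂ) by push_cast; ring,
      Complex.norm_exp_ofReal]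
    calc _ ≤ Real.exp (-(α * x ^ 2 / 2)) *
          (K / m * Real.exp (α * x ^ 2 / 2 - α * |x + (0 : ℤ)|)) := by gcongr
      _ = K / m * (Real.exp (-(α * x ^ 2 / 2)) * Real.exp (α * x ^ 2 / 2 - α * |x + (0 : ℤ)|)) := by
          ring
      _ = _ := by
          rw [← Real.exp_add, Int.cast_zero, add_zero]
          congr 2; ring

theorem isGaborFrame (hα : 0 < α) (G : ClassC α) (hV : FourierNonvanishing G.toFun) {Λ : Set ℝ}
    {D : ℝ} (hΛ : IsSeparatedSet Λ) (hD : HasLowerDensity Λ D) (hDq : (G.q : ℝ) + 1 < D) :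
    IsGaborFrame G.toFun Λ intSet := by
  refine isGaborFrame_of_uniqueness (G.expDecay hα) hV hΛ hD hDq ?_
  intro c K₀ hc L N hL hN hzero x
  choose S hScard hS using hzero
  obtain ⟨K, -, hb⟩ := G.numeratorBound hα
  have hser : ∀ y : ℝ, shiftSum G.toFun c y =
      Complex.exp (-(α * y ^ 2 / 2)) * ∑' k, c k * ratTerm α G.Q G.numer k y := by
    intro y
    rw [shiftSum, ← tsum_mul_left]
    congr 1; ext k
    rw [toFun_add_int]; ring
  have hαc : (α : ℂ) ≠ 0 := by exact_mod_cast hα.ne'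
  -- E = α and one zero per period: the threshold is (qα + α)/α = q + 1.
  have := tsum_ratTerm_eq_zero hα hα.le G.Q_nonneg hb hc (κ := 1) one_pos hL (S := S) ?_ hScard
    (fun m x hx => ⟨(hS m x hx).1, (hS m x hx).2.1⟩) ?_ x
  · rw [hser, this, mul_zero]
  · have h1 := mul_lt_mul_of_pos_left hN hα
    unfold q at h1
    push_cast
    linarith
  · intro m x hx j
    have hper : ∀ k : ℤ, Complex.exp (α * (x + 2 * Real.pi * Complex.I * j /
        (((1 : ℕ) * α : ℝ) : ℂ) + k)) = Complex.exp (α * (x + k)) := by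
      intro k
      rw [Complex.exp_eq_exp_iff_exists_int]
      refine ⟨j, ?_⟩
      push_cast
      field_simp
      ring
    constructor
    · intro k
      rw [hper]
      have := G.Q_nonneg (Real.exp (α * (x + k))) (Real.exp_pos _).le
      push_cast at this
      exact this
    · have hterm : ∀ k : ℤ, ratTerm α G.Q G.numer k
          (x + 2 * Real.pi * Complex.I * j / (((1 : ℕ) * α : ℝ) : ℂ)) =
          ratTerm α G.Q G.numer k x := by
        intro k
        unfold ratTerm numer
        rw [hper]
        congr 2
        rw [Complex.exp_eq_exp_iff_exists_int]
        refine ⟨-(j * k), ?_⟩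
        push_cast
        field_simp
        ring
      simp_rw [hterm]
      have h0 := (hS m x hx).2.2
      rw [hser] at h0
      exact (mul_eq_zero.mp h0).resolve_left (Complex.exp_ne_zero _)

end ClassC


/-! ### Even generators do not give frames over the integer lattice -/

/-- The test coefficients `(-1)^k exp(-ε|k|)`. -/
noncomputable def altCoeff (ε : ℝ) (k : ℤ) : ℂ := (-1) ^ k * Real.exp (-ε * |(k : ℝ)|)

theorem norm_altCoeff (ε : ℝ) (k : ℤ) : ‖altCoeff ε k‖ = Real.exp (-ε * |(k : ℝ)|) := by
  unfold altCoeff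
  rw [norm_mul, norm_zpow, norm_neg, norm_one, one_zpow, one_mul, Complex.norm_real,
    Real.norm_of_nonneg (Real.exp_pos _).le]

/-- The reflection j ↦ -1 - j sends 1/2 + j to its negative and reverses the sign (-1)^j. This is
the zero of the Zak transform at (1/2, 1/2). -/
theorem tsum_alternating_eq_zero {g : ℝ → ℂ} (heven : ∀ x, g (-x) = g x) :
    ∑' j : ℤ, (-1 : ℂ) ^ j * g (1 / 2 + j) = 0 := by
  have h := (Equiv.subLeft (-1 : ℤ)).tsum_eq (fun j : ℤ => (-1 : ℂ) ^ j * g (1 / 2 + j))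
  have h2 : ∀ j : ℤ, (-1 : ℂ) ^ (Equiv.subLeft (-1 : ℤ) j) * g (1 / 2 + (Equiv.subLeft (-1 : ℤ) j : ℤ)) =
      -((-1 : ℂ) ^ j * g (1 / 2 + j)) := by
    intro j
    rw [Equiv.subLeft_apply, ← heven]
    have e1 : (-1 : ℂ) ^ (-1 - j) = -(-1 : ℂ) ^ j := by
      rw [zpow_sub₀ (by norm_num), ← inv_zpow' , div_eq_mul_inv, ← inv_zpow]
      norm_num
    rw [e1, neg_mul]
    congr 3
    push_cast; ring
  rw [tsum_congr h2, tsum_neg] at h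
  exact self_eq_neg.mp h.symm

theorem abs_exp_sub_one_le {t s : ℝ} (h : |t| ≤ s) : |Real.exp t - 1| ≤ s * Real.exp s := by
  have hs : 0 ≤ s := (abs_nonneg t).trans h
  have h1 : Real.exp t ≤ Real.exp s := Real.exp_le_exp.mpr ((le_abs_self t).trans h)
  have h2 : -s ≤ t := (abs_le.mp h).1
  have h3 := Real.add_one_le_exp t
  have h4 := Real.add_one_le_exp (-s)
  have h5 : 1 ≤ Real.exp s := Real.one_le_exp hs
  have h6 : Real.exp (-s) * Real.exp s = 1 := by rw [← Real.exp_add]; simp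
  have h7 : Real.exp s - 1 ≤ s * Real.exp s := by
    nlinarith [Real.exp_pos s]
  rw [abs_le]
  constructor
  · nlinarith
  · linarith

/-- For ε = 0 and x = 1/2 all these sums vanish. The perturbation is bounded relative to the
coefficient at m, so that squaring and summing over m compares directly with the ℓ² norm. -/
theorem exists_small_altCoeff {g : ℝ → ℂ} (hg : ExpDecay g) (heven : ∀ x, g (-x) = g x) {s : ℝ}
    (hs : 0 < s) : ∃ ε δ : ℝ, 0 < ε ∧ 0 < δ ∧ δ ≤ 1 / 2 ∧ ∀ x : ℝ, |x - 1 / 2| < δ → ∀ m : ℤ,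
      ‖∑' k : ℤ, altCoeff ε k * g (x - m + k)‖ ≤ s * ‖altCoeff ε m‖ := by
  obtain ⟨hcont, C, a, hC, ha, hga⟩ := id hg
  have hu : ∀ x : ℝ, |x| ≤ 1 → ∀ j : ℤ, ‖g (x + j)‖ ≤ C * Real.exp a * Real.exp (-a * |(j : ℝ)|) := by
    intro x hx j
    refine (hga _).trans ?_
    rw [mul_assoc]
    have := exp_neg_abs_add_le ha hx (j : ℝ)
    rw [mul_one] at this
    gcongr
  have hsum0 : Summable fun j : ℤ => C * Real.exp a * Real.exp (-a * |(j : ℝ)|) :=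
    (summable_exp_neg_abs ha).mul_left _
  have hsum1 := (summable_one_add_abs_mul_exp (half_pos ha)).mul_left (C * Real.exp a)
  set T := ∑' j : ℤ, C * Real.exp a * ((1 + |(j : ℝ)|) * Real.exp (-(a / 2) * |(j : ℝ)|)) with hT
  have hT0 : 0 ≤ T := tsum_nonneg fun j => by positivity
  -- The first bound keeps exp(ε|j|) below half of the decay of g; the second makes the error from
  -- varying the coefficients at most s/2.
  set ε : ℝ := min (a / 2) (s / (2 * (T + 1))) with hε
  have hε0 : 0 < ε := lt_min (by positivity) (by positivity)
  have hεT : ε * T ≤ s / 2 := by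
    calc ε * T ≤ s / (2 * (T + 1)) * (T + 1) := by
          gcongr
          · exact min_le_right _ _
          · linarith
      _ = s / 2 := by field_simp
  have hlim : Tendsto (fun x : ℝ => ∑' j : ℤ, ‖g (x + j) - g (1 / 2 + j)‖) (𝓝 (1 / 2)) (𝓝 0) := by
    have h0 : (0 : ℝ) = ∑' j : ℤ, ‖g (1 / 2 + (j : ℝ)) - g (1 / 2 + j)‖ := by simp
    rw [h0]
    refine tendsto_tsum_of_dominated_convergence (hsum0.add hsum0) (fun j => ?_) ?_
    · have : Continuous fun x : ℝ => ‖g (x + j) - g (1 / 2 + j)‖ := by fun_prop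
      exact this.tendsto _
    · have hnear : ∀ᶠ x : ℝ in 𝓝 (1 / 2), |x| ≤ 1 := by
        have : ∀ᶠ x : ℝ in 𝓝 (1 / 2), |x| < 1 :=
          continuous_abs.continuousAt.eventually (gt_mem_nhds (by norm_num [abs_of_pos]))
        exact this.mono fun x hx => hx.le
      filter_upwards [hnear] with x hx j
      rw [norm_norm]
      exact (norm_sub_le _ _).trans (add_le_add (hu x hx j) (hu (1 / 2) (by norm_num [abs_of_pos]) j))
  obtain ⟨δ, hδ, hδs⟩ := Metric.eventually_nhds_iff.mp (hlim.eventually (gt_mem_nhds (half_pos hs)))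
  refine ⟨ε, min δ (1 / 2), hε0, lt_min hδ (by norm_num), min_le_right _ _, fun x hx m => ?_⟩
  have hx1 : |x| ≤ 1 := by
    have h1 := abs_lt.mp (hx.trans_le (min_le_right _ _))
    rw [abs_le]; constructor <;> linarith [h1.1, h1.2]
  have hclose := hδs (y := x) (by rw [Real.dist_eq]; exact hx.trans_le (min_le_left _ _))
  have hgx : Summable fun j : ℤ => ‖g (x + j)‖ := hg.summable_norm x
  have hgh : Summable fun j : ℤ => ‖g (1 / 2 + j)‖ := hg.summable_norm _
  have hdiff : Summable fun j : ℤ => ‖g (x + j) - g (1 / 2 + j)‖ :=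
    Summable.of_nonneg_of_le (fun _ => norm_nonneg _) (fun j => norm_sub_le _ _) (hgx.add hgh)
  have hre : ∑' k : ℤ, altCoeff ε k * g (x - m + k) =
      ∑' j : ℤ, (altCoeff ε (m + j) * g (x + j) -
        altCoeff ε m * ((-1) ^ j * g (1 / 2 + j))) := by
    have hs1 : Summable fun j : ℤ => altCoeff ε (m + j) * g (x + j) := by
      refine Summable.of_norm_bounded hgx fun j => ?_
      rw [norm_mul, norm_altCoeff]
      refine mul_le_of_le_one_left (norm_nonneg _) (Real.exp_le_one_iff.mpr ?_)
      have := mul_nonneg hε0.le (abs_nonneg ((m + j : ℤ) : ℝ))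
      linarith
    have hs2 : Summable fun j : ℤ => altCoeff ε m * ((-1) ^ j * g (1 / 2 + j)) := by
      apply Summable.mul_left
      refine Summable.of_norm_bounded hgh fun j => ?_
      simp
    rw [hs1.tsum_sub hs2, tsum_mul_left, tsum_alternating_eq_zero heven, mul_zero, sub_zero,
      ← (Equiv.addLeft m).tsum_eq (fun k : ℤ => altCoeff ε k * g (x - m + k))]
    congr 1; ext j
    simp only [Equiv.coe_addLeft]
    congr 2
    push_cast; ring
  have hterm : ∀ j : ℤ, ‖altCoeff ε (m + j) * g (x + j) -
        altCoeff ε m * ((-1) ^ j * g (1 / 2 + j))‖ ≤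
      ‖altCoeff ε m‖ * (ε * (C * Real.exp a * ((1 + |(j : ℝ)|) * Real.exp (-(a / 2) * |(j : ℝ)|))) +
        ‖g (x + j) - g (1 / 2 + j)‖) := by
    intro j
    set t : ℝ := ε * |(m : ℝ)| - ε * |((m + j : ℤ) : ℝ)| with ht
    have hexp : Real.exp (-ε * |((m + j : ℤ) : ℝ)|) = Real.exp (-ε * |(m : ℝ)|) * Real.exp t := by
      rw [← Real.exp_add, ht]; ring_nf
    have heq : altCoeff ε (m + j) * g (x + j) - altCoeff ε m * ((-1) ^ j * g (1 / 2 + j)) =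
        altCoeff ε m * ((-1) ^ j * (((Real.exp t - 1 : ℝ) : ℂ) * g (x + j) +
          (g (x + j) - g (1 / 2 + j)))) := by
      unfold altCoeff
      rw [hexp, zpow_add₀ (by norm_num)]
      push_cast
      ring
    rw [heq, norm_mul, norm_mul, norm_zpow, norm_neg, norm_one, one_zpow, one_mul]
    gcongr
    refine (norm_add_le _ _).trans ?_
    gcongr
    rw [norm_mul, Complex.norm_real, Real.norm_eq_abs]
    have htj : |t| ≤ ε * |(j : ℝ)| := by
      rw [ht, ← mul_sub, abs_mul, abs_of_pos hε0]
      refine mul_le_mul_of_nonneg_left ?_ hε0.le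
      refine (abs_abs_sub_abs_le_abs_sub (m : ℝ) ((m + j : ℤ) : ℝ)).trans ?_
      push_cast
      rw [sub_add_cancel_left, abs_neg]
    calc |Real.exp t - 1| * ‖g (x + j)‖
        ≤ (ε * |(j : ℝ)| * Real.exp (ε * |(j : ℝ)|)) *
          (C * Real.exp a * Real.exp (-a * |(j : ℝ)|)) :=
          mul_le_mul (abs_exp_sub_one_le htj) (hu x hx1 j) (norm_nonneg _) (by positivity)
      _ ≤ (ε * (1 + |(j : ℝ)|) * Real.exp (a / 2 * |(j : ℝ)|)) *
          (C * Real.exp a * Real.exp (-a * |(j : ℝ)|)) := by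
          gcongr
          · linarith
          · exact min_le_left _ _
      _ = ε * (C * Real.exp a * ((1 + |(j : ℝ)|) *
          (Real.exp (a / 2 * |(j : ℝ)|) * Real.exp (-a * |(j : ℝ)|)))) := by ring
      _ = _ := by rw [← Real.exp_add]; ring_nf
  rw [hre]
  have hsumall := ((hsum1.mul_left ε).add hdiff).mul_left ‖altCoeff ε m‖
  refine (tsum_of_norm_bounded hsumall.hasSum hterm).trans ?_
  rw [tsum_mul_left, (hsum1.mul_left ε).tsum_add hdiff, tsum_mul_left, mul_comm]
  gcongr
  linarith

/-- The test function with fibers `c` over an interval around `1/2`. -/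
noncomputable def fiberFun (c : ℤ → ℂ) (δ : ℝ) (x : ℝ) : ℂ :=
  if |Int.fract x - 1 / 2| < δ then c ⌊x⌋ else 0

theorem fiberFun_measurable (c : ℤ → ℂ) (δ : ℝ) : Measurable (fiberFun c δ) := by
  unfold fiberFun
  refine Measurable.ite ?_ ?_ measurable_const
  · exact measurableSet_lt (by fun_prop) measurable_const
  · exact (measurable_of_countable c).comp Int.measurable_floor

theorem fiberFun_add_int (c : ℤ → ℂ) {δ : ℝ} (hδ : δ ≤ 1 / 2) {x : ℝ} (hx : x ∈ Set.Ioc (0 : ℝ) 1)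
    (k : ℤ) : fiberFun c δ (x + k) = if |x - 1 / 2| < δ then c k else 0 := by
  unfold fiberFun
  rw [Int.fract_add_intCast, Int.floor_add_intCast]
  rcases eq_or_lt_of_le hx.2 with rfl | h
  · rw [if_neg, if_neg]
    · norm_num; linarith
    · norm_num; linarith
  · have h1 : ⌊x⌋ = 0 := Int.floor_eq_zero_iff.mpr ⟨hx.1.le, h⟩
    have h2 : Int.fract x = x := Int.fract_eq_self.mpr ⟨hx.1.le, h⟩
    rw [h1, h2, zero_add]

/-- A function whose fibres near 1/2 are the near-kernel sequence `altCoeff` and whose other fibres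
vanish violates the lower bound. -/
theorem not_isGaborFrame_of_even {g : ℝ → ℂ} (hg : ExpDecay g) (heven : ∀ x, g (-x) = g x) :
    ¬ IsGaborFrame g intSet intSet := by
  rintro ⟨A, B, hA, -, hframe⟩
  -- With s = √A / 2 the total squared coefficients are at most (A/4)‖f‖², below the lower frame
  -- bound.
  obtain ⟨ε, δ, hε, hδ, hδ2, hsmall⟩ := exists_small_altCoeff hg.conj
    (fun x => by rw [heven]) (s := Real.sqrt A / 2) (by positivity)
  set c := altCoeff ε with hc
  set W := ∑' k : ℤ, ‖c k‖ₑ ^ 2 with hW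
  have hWtop : W ≠ ⊤ := by
    rw [hW, ← summable_norm_sq_iff]
    refine (summable_exp_neg_abs (mul_pos two_pos hε)).congr fun k => ?_
    rw [hc, norm_altCoeff, ← Real.exp_nat_mul]
    push_cast; ring_nf
  have hW0 : W ≠ 0 := by
    have : ‖c 0‖ₑ ^ 2 ≤ W := ENNReal.le_tsum 0
    intro h
    rw [h] at this
    have h1 : ‖c 0‖ = 1 := by rw [hc, norm_altCoeff]; simp
    have h2 : ‖c 0‖ₑ ^ 2 = 1 := by rw [← ofReal_norm_sq, h1]; simp
    rw [h2] at this
    simp at this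
  set f₀ := fiberFun c δ with hf₀
  have hfm : Measurable f₀ := fiberFun_measurable c δ
  set J : Set ℝ := {x | |x - 1 / 2| < δ} with hJ
  have hJm : MeasurableSet J := measurableSet_lt (by fun_prop) measurable_const
  have hnorm : ∫⁻ x, ‖f₀ x‖ₑ ^ 2 = ∫⁻ x in Set.Ioc (0 : ℝ) 1, J.indicator (fun _ => W) x := by
    rw [lintegral_eq_lintegral_tsum_add_int (hfm.enorm.pow_const 2)]
    refine setLIntegral_congr_fun measurableSet_Ioc fun x hx => ?_
    simp only [hf₀, fiberFun_add_int c hδ2 hx]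
    by_cases h : |x - 1 / 2| < δ
    · rw [Set.indicator_of_mem (show x ∈ J from h)]
      simp only [if_pos h, hW]
    · rw [Set.indicator_of_notMem (show x ∉ J from h)]
      simp only [if_neg h]
      simp
  have hint : ∫⁻ x in Set.Ioc (0 : ℝ) 1, J.indicator (fun _ => W) x =
      W * (volume.restrict (Set.Ioc (0 : ℝ) 1)) J := lintegral_indicator_const hJm W
  have hJ0 : (volume.restrict (Set.Ioc (0 : ℝ) 1)) J ≠ 0 := by
    rw [Measure.restrict_apply hJm]
    have hsub : Set.Ioo (1 / 2 - δ) (1 / 2 + δ) ⊆ J ∩ Set.Ioc 0 1 := by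
      intro x hx
      have h1 : 1 / 2 - δ < x := hx.1
      have h2 : x < 1 / 2 + δ := hx.2
      have h3 : |x - 1 / 2| < δ := abs_lt.mpr ⟨by linarith, by linarith⟩
      exact ⟨h3, Set.mem_Ioc.mpr ⟨by linarith, by linarith⟩⟩
    intro h0
    have h1 := measure_mono_null hsub h0
    rw [Real.volume_Ioo, ENNReal.ofReal_eq_zero] at h1
    linarith
  have hJtop : (volume.restrict (Set.Ioc (0 : ℝ) 1)) J ≠ ⊤ := measure_ne_top _ _
  have hLp : MemLp f₀ 2 volume := by
    rw [memLp_two_iff_lintegral hfm.aestronglyMeasurable, hnorm, hint]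
    exact ENNReal.mul_lt_top hWtop.lt_top hJtop.lt_top
  obtain ⟨hsm, hlo, -⟩ := hframe hLp.toLp
  have hsum := tsum_enorm_sq_gaborCoeff hg (Set.countable_range _) hfm hLp.coeFn_toLp (Λ := intSet)
  have hfn := enorm_sq_lp hLp.coeFn_toLp
  have hlo' : ENNReal.ofReal A * ∫⁻ x, ‖f₀ x‖ₑ ^ 2 ≤
      ∑' p : intSet × intSet, ‖gaborCoeff g hLp.toLp p.1 p.2‖ₑ ^ 2 := by
    rw [← hfn, ← ENNReal.ofReal_mul hA.le]
    refine (ENNReal.ofReal_le_ofReal hlo).trans (le_of_eq ?_)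
    rw [ENNReal.ofReal_tsum_of_nonneg (fun _ => by positivity) hsm]
    simp_rw [ofReal_norm_sq]
  have hup : ∑' p : intSet × intSet, ‖gaborCoeff g hLp.toLp p.1 p.2‖ₑ ^ 2 ≤
      ENNReal.ofReal (A / 4) * ∫⁻ x, ‖f₀ x‖ₑ ^ 2 := by
    rw [hsum, hnorm, ← lintegral_const_mul' _ _ ENNReal.ofReal_ne_top]
    refine setLIntegral_mono' measurableSet_Ioc fun x hx => ?_
    simp only [hf₀, fiberFun_add_int c hδ2 hx]
    by_cases h : |x - 1 / 2| < δ
    · rw [Set.indicator_of_mem (show x ∈ J from h)]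
      simp only [h, if_true]
      let e : ℤ ≃ intSet := Equiv.ofInjective ((↑) : ℤ → ℝ) Int.cast_injective
      rw [← e.tsum_eq, hW, ← ENNReal.tsum_mul_left]
      refine ENNReal.tsum_le_tsum fun m => ?_
      have h1 := hsmall x h m
      have h2 : ((e m : intSet) : ℝ) = m := rfl
      rw [h2, ← ofReal_norm_sq, ← ofReal_norm_sq, ← ENNReal.ofReal_mul (by positivity)]
      apply ENNReal.ofReal_le_ofReal
      calc _ ≤ (Real.sqrt A / 2 * ‖c m‖) ^ 2 := by gcongr
        _ = _ := by rw [mul_pow, div_pow, Real.sq_sqrt hA.le]; ring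
    · simp only [if_neg h]
      simp
  have hX0 : ∫⁻ x, ‖f₀ x‖ₑ ^ 2 ≠ 0 := by
    rw [hnorm, hint]; exact mul_ne_zero hW0 hJ0
  have hXtop : ∫⁻ x, ‖f₀ x‖ₑ ^ 2 ≠ ⊤ := by
    rw [hnorm, hint]; exact ENNReal.mul_ne_top hWtop hJtop
  have hlt : ENNReal.ofReal (A / 4) < ENNReal.ofReal A := by
    rw [ENNReal.ofReal_lt_ofReal_iff hA]; linarith
  exact absurd (ENNReal.mul_lt_mul_left hX0 hXtop hlt) (not_lt.mpr (hlo'.trans hup))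

/-! ### The integer lattice is separated and has lower density one. -/

theorem isSeparatedSet_intSet : IsSeparatedSet intSet := by
  refine ⟨1, one_pos, ?_⟩
  rintro _ ⟨a, rfl⟩ _ ⟨b, rfl⟩ h
  have hab : a - b ≠ 0 := fun h' => h (by rw [sub_eq_zero.mp h'])
  exact_mod_cast Int.one_le_abs hab

theorem hasLowerDensity_intSet : HasLowerDensity intSet 1 := by
  have hcount : ∀ R x : ℝ, ((intSet ∩ Set.Icc (x - R) (x + R)).ncard : ℤ) =
      max 0 (⌊x + R⌋ + 1 - ⌈x - R⌉) := by
    intro R x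
    have : intSet ∩ Set.Icc (x - R) (x + R) =
        ((↑) : ℤ → ℝ) '' (Finset.Icc ⌈x - R⌉ ⌊x + R⌋ : Finset ℤ) := by
      ext y
      simp only [intSet, Set.mem_inter_iff, Set.mem_range, Set.mem_Icc, Finset.coe_Icc,
        Set.mem_image, Int.ceil_le, Int.le_floor]
      constructor
      · rintro ⟨⟨n, rfl⟩, h⟩; exact ⟨n, h, rfl⟩
      · rintro ⟨n, h, rfl⟩; exact ⟨⟨n, rfl⟩, h⟩
    rw [this, Set.ncard_image_of_injective _ Int.cast_injective, Set.ncard_coe_finset, Int.card_Icc]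
    omega
  have hlow : ∀ R x : ℝ, 2 * R - 1 ≤ ((intSet ∩ Set.Icc (x - R) (x + R)).ncard : ℝ) := by
    intro R x
    have h1 : (⌊x + R⌋ + 1 - ⌈x - R⌉ : ℤ) ≤ ((intSet ∩ Set.Icc (x - R) (x + R)).ncard : ℤ) := by
      rw [hcount]; exact le_max_right _ _
    have h2 : ((⌊x + R⌋ + 1 - ⌈x - R⌉ : ℤ) : ℝ) ≤ ((intSet ∩ Set.Icc (x - R) (x + R)).ncard : ℝ) := by
      exact_mod_cast h1
    push_cast at h2
    linarith [Int.lt_floor_add_one (x + R), Int.ceil_lt_add_one (x - R)]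
  have hupp : ∀ R x : ℝ, 0 < R → ((intSet ∩ Set.Icc (x - R) (x + R)).ncard : ℝ) ≤ 2 * R + 1 := by
    intro R x hR
    have h1 := hcount R x
    have h2 : ((intSet ∩ Set.Icc (x - R) (x + R)).ncard : ℝ) =
        max 0 ((⌊x + R⌋ : ℝ) + 1 - ⌈x - R⌉) := by exact_mod_cast h1
    rw [h2]
    apply max_le (by linarith)
    linarith [Int.floor_le (x + R), Int.le_ceil (x - R)]
  unfold HasLowerDensity
  have hl : Tendsto (fun R : ℝ => 1 - 1 / 2 * R⁻¹) atTop (𝓝 1) := by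
    simpa using tendsto_const_nhds.sub ((tendsto_inv_atTop_zero (𝕜 := ℝ)).const_mul (1 / 2 : ℝ))
  have hu : Tendsto (fun R : ℝ => 1 + 1 / 2 * R⁻¹) atTop (𝓝 1) := by
    simpa using tendsto_const_nhds.add ((tendsto_inv_atTop_zero (𝕜 := ℝ)).const_mul (1 / 2 : ℝ))
  refine tendsto_of_tendsto_of_tendsto_of_le_of_le' hl hu ?_ ?_
  · filter_upwards [eventually_gt_atTop 0] with R hR
    refine le_ciInf fun x => ?_
    rw [le_div_iff₀ (by positivity)]
    refine le_trans (le_of_eq ?_) (hlow R x)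
    field_simp
  · filter_upwards [eventually_gt_atTop 0] with R hR
    refine (ciInf_le ⟨0, by rintro _ ⟨x, rfl⟩; positivity⟩ 0).trans ?_
    rw [div_le_iff₀ (by positivity)]
    refine (hupp R 0 hR).trans (le_of_eq ?_)
    field_simp


/-! ### Critical examples: the hyperbolic secant and the Gaussian. -/

/-- Substitution t = σ(y) with the logistic function σ, for which dt = σ(1 - σ) dy and 1 - σ = 1/(1
+ e^y). -/
theorem betaIntegral_one_sub_eq_integral (u : ℂ) :
    Complex.betaIntegral u (1 - u) = ∫ y : ℝ, Complex.exp (u * y) / (1 + Complex.exp y) := by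
  unfold Complex.betaIntegral
  rw [intervalIntegral.integral_of_le zero_le_one, integral_Ioc_eq_integral_Ioo,
    ← Real.range_sigmoid, ← Set.image_univ,
    integral_image_eq_integral_abs_deriv_smul MeasurableSet.univ
      (fun x _ => (Real.hasDerivAt_sigmoid x).hasDerivWithinAt) Real.sigmoid_injective.injOn,
    Measure.restrict_univ]
  congr 1; ext y
  have hs := Real.sigmoid_pos y
  have hs' : 0 < 1 - Real.sigmoid y := sub_pos.mpr (Real.sigmoid_lt_one y)
  have h1 : Real.sigmoid y = Real.exp (-Real.log (1 + Real.exp (-y))) := by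
    rw [Real.exp_neg, Real.exp_log (by positivity), Real.sigmoid_def]
  have h2 : 1 - Real.sigmoid y = Real.exp (-y - Real.log (1 + Real.exp (-y))) := by
    rw [sub_eq_add_neg (-y), Real.exp_add, ← h1, mul_comm, Real.sigmoid_mul_rexp_neg,
      Real.sigmoid_neg]
  have h3 : (1 + Complex.exp y) ≠ 0 := by
    exact_mod_cast (by positivity : (0 : ℝ) < 1 + Real.exp y).ne'
  have h4 : (1 - Real.sigmoid y) * (1 + Real.exp y) = 1 := by
    rw [← Real.sigmoid_neg, Real.sigmoid_def, neg_neg, inv_mul_cancel₀ (by positivity)]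
  rw [abs_of_pos (mul_pos hs hs'), Complex.real_smul, eq_div_iff h3, ← Complex.ofReal_one,
    ← Complex.ofReal_sub, Complex.cpow_def_of_ne_zero (by exact_mod_cast hs.ne'),
    Complex.cpow_def_of_ne_zero (by exact_mod_cast hs'.ne'), ← Complex.ofReal_log hs.le,
    ← Complex.ofReal_log hs'.le, ← Complex.ofReal_exp, ← Complex.ofReal_add, Complex.ofReal_mul]
  have h5 : ((1 - Real.sigmoid y : ℝ) : ℂ) * ((1 + Real.exp y : ℝ) : ℂ) = 1 := by
    exact_mod_cast h4
  set l := Real.log (1 + Real.exp (-y)) with hl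
  have h6 : ((Real.sigmoid y : ℝ) : ℂ) = Complex.exp (-l) := by
    rw [h1]; push_cast; rfl
  have h7 : Real.log (Real.sigmoid y) = -l := by rw [h1, Real.log_exp]
  have h8 : Real.log (1 - Real.sigmoid y) = -y - l := by rw [h2, Real.log_exp]
  rw [h7, h8]
  calc _ = (((1 - Real.sigmoid y : ℝ) : ℂ) * ((1 + Real.exp y : ℝ) : ℂ)) *
        (Complex.exp (-l) * (Complex.exp (((-l : ℝ) : ℂ) * (u - 1)) *
          Complex.exp (((-y - l : ℝ) : ℂ) * (((1 : ℝ) : ℂ) - u - ((1 : ℝ) : ℂ))))) := by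
        rw [h6, Complex.ofReal_one]; ring
    _ = _ := by
        rw [h5, one_mul, ← Complex.exp_add, ← Complex.exp_add]
        congr 1
        push_cast
        ring

theorem betaIntegral_one_sub_ne_zero {u : ℂ} (h0 : 0 < u.re) (h1 : u.re < 1) :
    Complex.betaIntegral u (1 - u) ≠ 0 := by
  have h2 : 0 < (1 - u).re := by simpa using h1
  have h := Complex.Gamma_mul_Gamma_eq_betaIntegral h0 h2
  rw [add_sub_cancel, Complex.Gamma_one, one_mul] at h
  rw [← h]
  exact mul_ne_zero (Complex.Gamma_ne_zero_of_re_pos h0) (Complex.Gamma_ne_zero_of_re_pos h2)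

/-- The hyperbolic secant `exp(αz) / (1 + exp(2αz))` as a member of `K(α)`. -/
noncomputable def sechGenerator (α : ℝ) : ClassK α where
  P := X
  Q := X ^ 2 + C 1
  P_ne_zero := X_ne_zero
  Q_ne_zero := (monic_X_pow_add_C 1 two_ne_zero).ne_zero
  no_common_zero := by
    rintro z ⟨h1, h2⟩
    simp only [eval_X] at h1
    simp [h1] at h2
  one_le_deg := by simp
  deg_lt := by rw [natDegree_X, natDegree_X_pow_add_C]; norm_num
  P_zero := by simp
  Q_nonneg := by
    intro x _ h
    simp only [eval_add, eval_pow, eval_X, eval_C] at h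
    have : x ^ 2 + 1 = 0 := by exact_mod_cast h
    linarith [sq_nonneg x]

theorem sechGenerator_toFun (α x : ℝ) : (sechGenerator α).toFun x =
    Complex.exp (α * x) / (1 + Complex.exp (2 * α * x)) := by
  simp only [ClassK.toFun, ClassK.toComplexFun, sechGenerator, eval_add, eval_pow, eval_X, eval_C]
  rw [← Complex.exp_nat_mul, add_comm]
  push_cast
  ring_nf

theorem sechGenerator_even (α x : ℝ) :
    (sechGenerator α).toFun (-x) = (sechGenerator α).toFun x := by
  rw [sechGenerator_toFun, sechGenerator_toFun]
  have h : ∀ y : ℝ, (1 + Complex.exp (2 * α * y)) ≠ 0 := by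
    intro y
    have : (0 : ℝ) < 1 + Real.exp (2 * α * y) := by positivity
    exact_mod_cast this.ne'
  rw [div_eq_div_iff (h _) (h _), mul_add, mul_add, ← Complex.exp_add, ← Complex.exp_add, mul_one,
    mul_one, add_comm]
  push_cast
  ring_nf

theorem sechGenerator_q (α : ℝ) : (sechGenerator α).q = 2 :=
  natDegree_X_pow_add_C

/-- The upper bound is k ≤ q = 2; conversely, a shift by half the period changes the sign of exp(αz)
and hence of the generator. -/
theorem sechGenerator_k {α : ℝ} (hα : 0 < α) : (sechGenerator α).k = 2 := by
  have hgr := ClassK.isGreatest_k hα (sechGenerator α)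
  apply le_antisymm
  · rw [← sechGenerator_q α]
    exact ClassK.le_q_of_mem hα _ hgr.1
  · apply hgr.2
    refine ⟨two_pos, -1, fun z _ _ => ?_⟩
    have hα' : (α : ℂ) ≠ 0 := by exact_mod_cast hα.ne'
    have h : Complex.exp (α * (z + 2 * Real.pi * Complex.I / ((2 : ℕ) * α))) =
        -Complex.exp (α * z) := by
      rw [← Complex.exp_add_pi_mul_I]
      congr 1
      push_cast
      field_simp
    simp only [ClassK.toComplexFun, sechGenerator, eval_add, eval_pow, eval_X, eval_C, h]
    ring

/-- After y = 2αx the transform is a multiple of B(u, 1 - u) = Γ(u)Γ(1 - u) with Re u = 1/2, and Γ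
has no zeros. -/
theorem fourier_sechGenerator_ne_zero {α : ℝ} (hα : 0 < α) (t : ℝ) :
    𝓕 (sechGenerator α).toFun t ≠ 0 := by
  set u : ℂ := 1 / 2 - (Real.pi * t / α : ℝ) * Complex.I with hu
  have hre : u.re = 1 / 2 := by simp [hu]
  have hα' : (α : ℂ) ≠ 0 := by exact_mod_cast hα.ne'
  have h := Measure.integral_comp_mul_left
    (fun y : ℝ => Complex.exp (u * y) / (1 + Complex.exp y)) (2 * α)
  rw [← betaIntegral_one_sub_eq_integral] at h
  have heq : 𝓕 (sechGenerator α).toFun t =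
      ∫ x : ℝ, Complex.exp (u * ((2 * α * x : ℝ) : ℂ)) /
        (1 + Complex.exp ((2 * α * x : ℝ) : ℂ)) := by
    rw [Real.fourier_real_eq_integral_exp_smul]
    congr 1; ext x
    rw [sechGenerator_toFun, smul_eq_mul, ← mul_div_assoc, ← Complex.exp_add, hu]
    push_cast
    congr 2
    field_simp
    ring
  rw [heq, h]
  refine smul_ne_zero (by positivity) (betaIntegral_one_sub_ne_zero ?_ ?_) <;> rw [hre] <;> norm_num

theorem exists_classK_not_isGaborFrame {α : ℝ} (hα : 0 < α) :
    ∃ G : ClassK α, FourierNonvanishing G.toFun ∧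
      ∃ Λ : Set ℝ, IsSeparatedSet Λ ∧ HasLowerDensity Λ ((G.q : ℝ) / (G.k : ℝ)) ∧
        ¬ IsGaborFrame G.toFun Λ intSet := by
  refine ⟨sechGenerator α, fun b _ _ => ⟨0, fourier_sechGenerator_ne_zero hα _⟩, intSet,
    isSeparatedSet_intSet, ?_,
    not_isGaborFrame_of_even ((sechGenerator α).expDecay hα) (sechGenerator_even α)⟩
  rw [sechGenerator_q, sechGenerator_k hα, div_self (by norm_num)]
  exact hasLowerDensity_intSet

/-- The Gaussian `exp(-αz²/2)` as a member of `C(α)`. -/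
noncomputable def gaussianGenerator (α : ℝ) : ClassC α where
  P := 1
  Q := 1
  P_ne_zero := one_ne_zero
  Q_ne_zero := one_ne_zero
  no_common_zero := by simp
  Q_nonneg := by simp

theorem gaussianGenerator_toFun (α x : ℝ) :
    (gaussianGenerator α).toFun x = Complex.exp (-(α / 2 : ℝ) * x ^ 2) := by
  simp only [ClassC.toFun, gaussianGenerator, eval_one, div_one, mul_one]
  push_cast
  ring_nf

theorem fourier_gaussianGenerator_ne_zero {α : ℝ} (hα : 0 < α) (t : ℝ) :
    𝓕 (gaussianGenerator α).toFun t ≠ 0 := by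
  have hb : 0 < (((α / 2 : ℝ) : ℂ)).re := by rw [Complex.ofReal_re]; positivity
  have heq : 𝓕 (gaussianGenerator α).toFun t = ∫ x : ℝ,
      Complex.exp (Complex.I * ((-2 * Real.pi * t : ℝ) : ℂ) * x) *
        Complex.exp (-((α / 2 : ℝ) : ℂ) * x ^ 2) := by
    rw [Real.fourier_real_eq_integral_exp_smul]
    congr 1; ext x
    rw [gaussianGenerator_toFun, smul_eq_mul]
    push_cast
    ring_nf
  rw [heq, fourierIntegral_gaussian hb]
  refine mul_ne_zero ?_ (Complex.exp_ne_zero _)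
  rw [Complex.cpow_ne_zero_iff_of_exponent_ne_zero (by norm_num), ← Complex.ofReal_div]
  exact_mod_cast (by positivity : Real.pi / (α / 2) ≠ 0)

theorem exists_classC_not_isGaborFrame {α : ℝ} (hα : 0 < α) :
    ∃ G : ClassC α, FourierNonvanishing G.toFun ∧
      ∃ Λ : Set ℝ, IsSeparatedSet Λ ∧ HasLowerDensity Λ ((G.q : ℝ) + 1) ∧
        ¬ IsGaborFrame G.toFun Λ intSet := by
  refine ⟨gaussianGenerator α, fun b _ _ => ⟨0, fourier_gaussianGenerator_ne_zero hα _⟩, intSet,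
    isSeparatedSet_intSet, ?_,
    not_isGaborFrame_of_even ((gaussianGenerator α).expDecay hα) fun x => ?_⟩
  · have : (gaussianGenerator α).q = 0 := natDegree_one
    rw [this, Nat.cast_zero, zero_add]
    exact hasLowerDensity_intSet
  · rw [gaussianGenerator_toFun, gaussianGenerator_toFun]
    push_cast
    rw [neg_sq]

end GaborRational

open GaborRational in
theorem theorem1p11 :
    -- (i) sufficiency for the class `K(α)`
    (∀ α : ℝ, 0 < α → ∀ G : ClassK α, FourierNonvanishing G.toFun →
      ∀ (Λ : Set ℝ) (D : ℝ), IsSeparatedSet Λ → HasLowerDensity Λ D →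
        (G.q : ℝ) / (G.k : ℝ) < D → IsGaborFrame G.toFun Λ intSet) ∧
    -- (ii) sharpness for the class `K(α)`
    (∀ α : ℝ, 0 < α → ∃ G : ClassK α, FourierNonvanishing G.toFun ∧
      ∃ Λ : Set ℝ, IsSeparatedSet Λ ∧ HasLowerDensity Λ ((G.q : ℝ) / (G.k : ℝ)) ∧
        ¬ IsGaborFrame G.toFun Λ intSet) ∧
    -- (iii) sufficiency for the class `C(α)`
    (∀ α : ℝ, 0 < α → ∀ G : ClassC α, FourierNonvanishing G.toFun →
      ∀ (Λ : Set ℝ) (D : ℝ), IsSeparatedSet Λ → HasLowerDensity Λ D →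
        (G.q : ℝ) + 1 < D → IsGaborFrame G.toFun Λ intSet) ∧
    -- (iv) sharpness for the class `C(α)`
    (∀ α : ℝ, 0 < α → ∃ G : ClassC α, FourierNonvanishing G.toFun ∧
      ∃ Λ : Set ℝ, IsSeparatedSet Λ ∧ HasLowerDensity Λ ((G.q : ℝ) + 1) ∧
        ¬ IsGaborFrame G.toFun Λ intSet) := by
  exact ⟨fun _ hα G hV _ _ hΛ hD hDq => G.isGaborFrame hα hV hΛ hD hDq,
    fun _ hα => exists_classK_not_isGaborFrame hα,
    fun _ hα G hV _ _ hΛ hD hDq => G.isGaborFrame hα hV hΛ hD hDq,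
    fun _ hα => exists_classC_not_isGaborFrame hα⟩
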